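/- Let $d\ge 5$. A positive solution in $L^{2d/(d-2)}(\mathbb{R}^d)$ means a real function $\omega\in L^{2d/(d-2)}(\mathbb{R}^d)$ with $\omega>0$ almost everywhere such that $$-\Delta\omega=\left(|x|^{-4}*|\omega|^2\right)\omega \quad\text{on }\mathbb{R}^d$$ in the sense of distributions. Functions are identified when they agree almost everywhere. There is a constant $c_0>0$, depending only on $d$, such that: 1. every positive solution $\omega$ in $L^{2d/(d-2)}(\mathbb{R}^d)$ is, for some point $x_0\in\mathbb{R}^d$, radially symmetric about $x_0$ and strictly decreasing in $|x-x_0|$, and for some $t>0$ it equals $$c_0\left(\frac{t}{t^2+|x-x_0|^2}\right)^{\frac{d-2}{2}};$$ 2. conversely, for all $x_0\in\mathbb{R}^d$ and $t>0$ this function is a positive solution in $L^{2d/(d-2)}(\mathbb{R}^d)$. In particular the positive solution is unique up to translation and scaling: if $\omega_1,\omega_2$ are positive solutions in $L^{2d/(d-2)}(\mathbb{R}^d)$, then there are $a\in\mathbb{R}^d$ and $s>0$ with $\omega_2(x)=s^{(d-2)/2}\,\omega_1(s(x-a))$ for almost every $x$. -/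

import Mathlib

open MeasureTheory Filter Set
open scoped ContDiff Laplacian

noncomputable section

/-- The Hartree potential `|x|⁻⁴ * |u|²`. -/
def hartreePotential {d : ℕ} (u : EuclideanSpace ℝ (Fin d) → ℝ)
    (x : EuclideanSpace ℝ (Fin d)) : ℝ :=
  ∫ y, |u y| ^ 2 / ‖x - y‖ ^ 4

/-- `-Δu = (|x|⁻⁴ * |u|²) u` on `ℝᵈ` in the sense of distributions, i.e. tested against all smooth
compactly supported functions.  It is only used for `u ∈ L^{2d/(d-2)}` with `d ≥ 5`, where the
Hartree potential is finite almost everywhere and both integrands below are integrable. -/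
def IsHartreeSolution {d : ℕ} (u : EuclideanSpace ℝ (Fin d) → ℝ) : Prop :=
  ∀ φ : EuclideanSpace ℝ (Fin d) → ℝ, ContDiff ℝ ∞ φ → HasCompactSupport φ →
    ∫ x, u x * (-(Δ φ x)) = ∫ x, hartreePotential u x * u x * φ x

/-- A positive solution of `-Δu = (|x|⁻⁴ * |u|²) u` in `L^{2d/(d-2)}(ℝᵈ)`. -/
structure IsPositiveHartreeSolution {d : ℕ} (u : EuclideanSpace ℝ (Fin d) → ℝ) : Prop where
  memLp : MemLp u (ENNReal.ofReal (2 * (d : ℝ) / ((d : ℝ) - 2))) volume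
  pos : ∀ᵐ x, 0 < u x
  solves : IsHartreeSolution u

/-- `u` agrees almost everywhere with a strictly decreasing function of the distance to `x₀`. -/
def IsRadiallyDecreasingAbout {d : ℕ} (x₀ : EuclideanSpace ℝ (Fin d))
    (u : EuclideanSpace ℝ (Fin d) → ℝ) : Prop :=
  ∃ g : ℝ → ℝ, StrictAntiOn g (Ici 0) ∧ ∀ᵐ x, u x = g ‖x - x₀‖

/-- The function `c (t / (t² + |x - x₀|²))^{(d-2)/2}`. -/
def bubble {d : ℕ} (c t : ℝ) (x₀ x : EuclideanSpace ℝ (Fin d)) : ℝ :=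
  c * (t / (t ^ 2 + ‖x - x₀‖ ^ 2)) ^ (((d : ℝ) - 2) / 2)

end

/-! The exponents are exactly those for which the equation is conformally invariant, and the
classification is the method of moving spheres carried out on an integral equation.

Testing the equation with the difference of two smooth truncations of `|y - x|^(2-d)`, at scales `a`
and `a⁻¹`, and letting `a → 0` gives `κ u = |x|^(2-d) * (V u)` almost everywhere, where `V = |x|⁻⁴ *
u²` (`IsPositiveHartreeSolution.exists_isHartreeSystem`). Finiteness of the potentials comes from
the Hardy–Littlewood–Sobolev inequality `lpn_rieszPot_le`. The right-hand side, taken as the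
representative of `u`, is lower semicontinuous; no further regularity of `u` is needed.

For a centre `c`, compare `u` in the ball `B(c, R)` with its reflection `refl c R u`. Folding the
exterior of the ball into the ball leaves a kernel difference of constant sign (`reflKernel_lt`).
Hence `u ≤ refl c R u` as soon as the set where this fails has small measure, in particular for
small `R`. It is false for large `R`, since the integral of `u^(2d/(d-2))` is finite and nonzero. At
the last admissible radius the two functions coincide, for otherwise the inequality is strict and
the radius could grow (`exists_ae_eq_refl`). So every `c` has a radius `lam c` with `u = refl c (lam
c) u`.

The ball `B(c, lam c)` carries half of the mass of `u^(2d/(d-2))`, which makes `lam` Lipschitz. The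
decay of the mass at infinity does not depend on the centre, which gives `u = a * lam^(2-d)`. The
symmetries then become a functional equation for `lam`. It carries differentiability of `lam²` from
one point, provided by Rademacher's theorem, to all points, and forces `lam x ^ 2 = ‖x - e‖ ^ 2 + b`
(`exists_sq_eq_of_inversion_eq`). Thus `u` is a bubble.

Conversely, inversions act transitively enough on bubbles that the Hartree potential of a bubble is
a constant times its squared weight (`rieszPot_bubbleSource`), while `-Δ` of a bubble is `d (d - 2)`
times squared weight times bubble. Matching the constants determines `c₀`
(`isHartreeSolution_bubble_iff`). -/

open Metric Topology
open scoped ENNReal NNReal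

noncomputable section

variable {d : ℕ}

local notation "E" => EuclideanSpace ℝ (Fin d)

/-! ### Lower semicontinuity of parametrised integrals -/

section Semicontinuity

/-- Fatou's lemma along a sequence violating the inequality; first countability provides the
sequence. -/
theorem lowerSemicontinuous_lintegral_param {X Y : Type*} [TopologicalSpace X]
    [FirstCountableTopology X] [MeasurableSpace Y] {μ : Measure Y} {K : X → Y → ℝ≥0∞}
    (hm : ∀ x, AEMeasurable (K x) μ) (hl : ∀ y, LowerSemicontinuous fun x => K x y) :
    LowerSemicontinuous fun x => ∫⁻ y, K x y ∂μ := by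
  intro x a ha
  by_contra hcon
  obtain ⟨s, hs, hsa⟩ := exists_seq_forall_of_frequently (not_eventually.1 hcon)
  have h1 : ∫⁻ y, K x y ∂μ ≤ ∫⁻ y, liminf (fun n => K (s n) y) atTop ∂μ :=
    lintegral_mono fun y => ((hl y).le_liminf x).trans (hs.liminf_le_liminf_comp)
  have h2 : ∫⁻ y, liminf (fun n => K (s n) y) atTop ∂μ ≤
      liminf (fun n => ∫⁻ y, K (s n) y ∂μ) atTop := lintegral_liminf_le' fun n => hm _
  have h3 : liminf (fun n => ∫⁻ y, K (s n) y ∂μ) atTop ≤ a :=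
    liminf_le_of_frequently_le (Frequently.of_forall fun n => not_lt.1 (hsa n))
  exact absurd ha (not_lt.2 (h1.trans (h2.trans h3)))

theorem LowerSemicontinuous.ennreal_mul_const {X : Type*} [TopologicalSpace X] {f : X → ℝ≥0∞}
    (hf : LowerSemicontinuous f) (c : ℝ≥0∞) : LowerSemicontinuous fun x => f x * c := by
  -- Multiplication by `⊤` is discontinuous at `0`; there the product is `⊤` on the open set where
  -- `f` is positive.
  rcases eq_or_ne c ⊤ with rfl | hc
  · intro x a ha
    have hx : f x ≠ 0 := by
      rintro h
      simp [h] at ha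
    have := hf x 0 (pos_iff_ne_zero.2 hx)
    filter_upwards [this] with y hy
    simp only [ENNReal.mul_top (ne_of_gt hy)]
    simpa only [ENNReal.mul_top hx] using ha
  · exact (ENNReal.continuous_mul_const hc).comp_lowerSemicontinuous hf
      fun a b h => mul_le_mul_left h c

end Semicontinuity

/-! ### The Hardy–Littlewood maximal theorem -/

section Maximal

/-- The centred Hardy–Littlewood maximal function. -/
def maxFun (g : E → ℝ≥0∞) (x : E) : ℝ≥0∞ :=
  ⨆ s : Ioi (0 : ℝ), (volume (ball x s))⁻¹ * ∫⁻ y in ball x s, g y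

theorem volume_ball_eq (x : E) {r : ℝ} (hr : 0 < r) :
    volume (ball x r) = ENNReal.ofReal (r ^ d) * volume (ball (0 : E) 1) := by
  simpa using Measure.addHaar_ball_of_pos volume x hr

theorem volume_closedBall_eq (x : E) {r : ℝ} (hr : 0 < r) :
    volume (closedBall x r) = ENNReal.ofReal (r ^ d) * volume (ball (0 : E) 1) := by
  simpa using Measure.addHaar_closedBall volume x hr.le

theorem volume_unitBall_ne_zero : volume (ball (0 : E) 1) ≠ 0 :=
  (measure_ball_pos volume _ one_pos).ne'

theorem volume_unitBall_ne_top : volume (ball (0 : E) 1) ≠ ⊤ := measure_ball_lt_top.ne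

theorem setLIntegral_ball_le_maxFun (g : E → ℝ≥0∞) (x : E) {s : ℝ} (hs : 0 < s) :
    ∫⁻ y in ball x s, g y ≤ volume (ball x s) * maxFun g x := by
  have h : (volume (ball x s))⁻¹ * ∫⁻ y in ball x s, g y ≤ maxFun g x :=
    le_iSup (fun s : Ioi (0 : ℝ) => (volume (ball x s))⁻¹ * ∫⁻ y in ball x s, g y) ⟨s, hs⟩
  calc ∫⁻ y in ball x s, g y
      = volume (ball x s) * ((volume (ball x s))⁻¹ * ∫⁻ y in ball x s, g y) := by
        rw [← mul_assoc, ENNReal.mul_inv_cancel (measure_ball_pos volume x hs).ne'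
          measure_ball_lt_top.ne, one_mul]
    _ ≤ _ := by gcongr

theorem lowerSemicontinuous_setLIntegral_ball {g : E → ℝ≥0∞} (hg : AEMeasurable g) (s : ℝ) :
    LowerSemicontinuous fun x : E => ∫⁻ y in ball x s, g y := by
  simp_rw [← lintegral_indicator measurableSet_ball]
  refine lowerSemicontinuous_lintegral_param (fun x => hg.indicator measurableSet_ball) fun y => ?_
  have : (fun x : E => (ball x s).indicator g y) = (ball y s).indicator fun _ => g y := by
    ext x
    simp only [indicator, mem_ball, dist_comm]
  rw [this]
  exact isOpen_ball.lowerSemicontinuous_indicator zero_le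

theorem lowerSemicontinuous_maxFun {g : E → ℝ≥0∞} (hg : AEMeasurable g) :
    LowerSemicontinuous (maxFun g) := by
  refine lowerSemicontinuous_iSup fun s => ?_
  have h := (lowerSemicontinuous_setLIntegral_ball hg s).ennreal_mul_const
    (volume (ball (0 : E) s))⁻¹
  refine fun x => ?_
  simpa only [mul_comm, Measure.addHaar_ball_center] using h x

/-- Weak type `(1,1)` bound for the maximal function. -/
theorem volume_lt_maxFun_le (hd : d ≠ 0) (g : E → ℝ≥0∞) {t : ℝ≥0∞} (ht : t ≠ 0) (ht' : t ≠ ⊤) :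
    volume {x | t < maxFun g x} ≤ 4 ^ d * t⁻¹ * ∫⁻ y, g y := by
  by_cases hgi : ∫⁻ y, g y = ⊤
  · rw [hgi, ENNReal.mul_top]
    · exact le_top
    · simp [ht']
  set κ := volume (ball (0 : E) 1) with hκ
  have hex : ∀ x ∈ {x | t < maxFun g x}, ∃ s : ℝ, 0 < s ∧
      t * volume (closedBall x s) ≤ ∫⁻ y in closedBall x s, g y := by
    intro x hx
    obtain ⟨⟨s, hs⟩, hst⟩ := lt_iSup_iff.1 (show t < ⨆ s : Ioi (0 : ℝ), _ from hx)
    refine ⟨s, hs, ?_⟩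
    have h1 : volume (closedBall x s) = volume (ball x s) := by
      rw [volume_closedBall_eq x hs, volume_ball_eq x hs]
    have h0 := (measure_ball_pos volume x hs).ne'
    calc t * volume (closedBall x s)
        ≤ ((volume (ball x s))⁻¹ * ∫⁻ y in ball x s, g y) * volume (ball x s) := by
          rw [h1]; gcongr
      _ = ∫⁻ y in ball x s, g y := by
          rw [mul_comm, ← mul_assoc, ENNReal.mul_inv_cancel h0 measure_ball_lt_top.ne, one_mul]
      _ ≤ _ := lintegral_mono_set ball_subset_closedBall
  choose! s hs0 hs using hex
  -- The Vitali covering lemma needs bounded radii. Finiteness of `∫ g` bounds `s x ^ d`, and the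
  -- `1` in the maximum allows `s x ≤ s x ^ d`.
  have hR : ∀ x ∈ {x | t < maxFun g x},
      s x ≤ max 1 (t⁻¹ * κ⁻¹ * ∫⁻ y, g y).toReal := by
    intro x hx
    rcases le_or_gt (s x) 1 with h | h
    · exact h.trans (le_max_left _ _)
    refine le_trans ?_ (le_max_right _ _)
    have h1 : t * (ENNReal.ofReal (s x ^ d) * κ) ≤ ∫⁻ y, g y := by
      rw [hκ, ← volume_closedBall_eq x (hs0 x hx)]
      exact (hs x hx).trans (setLIntegral_le_lintegral _ _)
    have h2 : ENNReal.ofReal (s x ^ d) ≤ t⁻¹ * κ⁻¹ * ∫⁻ y, g y := by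
      calc ENNReal.ofReal (s x ^ d)
          = t⁻¹ * κ⁻¹ * (t * (ENNReal.ofReal (s x ^ d) * κ)) := by
            rw [show t⁻¹ * κ⁻¹ * (t * (ENNReal.ofReal (s x ^ d) * κ)) =
              (t⁻¹ * t) * (κ⁻¹ * κ) * ENNReal.ofReal (s x ^ d) by ring,
              ENNReal.inv_mul_cancel ht ht',
              ENNReal.inv_mul_cancel volume_unitBall_ne_zero volume_unitBall_ne_top]
            simp
        _ ≤ _ := by gcongr
    have h3 : s x ^ d ≤ (t⁻¹ * κ⁻¹ * ∫⁻ y, g y).toReal := by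
      refine (ENNReal.ofReal_le_iff_le_toReal ?_).1 h2
      refine ENNReal.mul_ne_top (ENNReal.mul_ne_top ?_ ?_) hgi
      · exact ENNReal.inv_ne_top.2 ht
      · exact ENNReal.inv_ne_top.2 volume_unitBall_ne_zero
    exact (le_self_pow₀ h.le hd).trans h3
  -- The enlargement factor `4` is the source of the constant `4 ^ d`.
  obtain ⟨u, hut, hdisj, hcov⟩ := Vitali.exists_disjoint_subfamily_covering_enlargement_closedBall
    {x | t < maxFun g x} (fun x => x) s _ hR 4 (by norm_num)
  have hu : u.Countable := by
    refine hdisj.countable_of_nonempty_interior fun x hx => ?_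
    exact ⟨x, ball_subset_interior_closedBall (mem_ball_self (hs0 x (hut hx)))⟩
  calc volume {x | t < maxFun g x}
      ≤ volume (⋃ b ∈ u, closedBall b (4 * s b)) := by
        refine measure_mono fun x hx => ?_
        obtain ⟨b, hb, hsub⟩ := hcov x hx
        exact mem_biUnion hb (hsub (mem_closedBall_self (hs0 x hx).le))
    _ ≤ ∑' b : u, volume (closedBall (b : E) (4 * s b)) := measure_biUnion_le _ hu _
    _ ≤ ∑' b : u, 4 ^ d * t⁻¹ * ∫⁻ y in closedBall (b : E) (s b), g y := by
        refine ENNReal.tsum_le_tsum fun b => ?_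
        have hb := hut b.2
        have hpos := hs0 b hb
        have h4 : volume (closedBall (b : E) (4 * s b)) =
            4 ^ d * volume (closedBall (b : E) (s b)) := by
          rw [volume_closedBall_eq _ hpos, volume_closedBall_eq _ (by positivity), mul_pow,
            ENNReal.ofReal_mul (by positivity), mul_assoc, ENNReal.ofReal_pow (by norm_num)]
          norm_num
        rw [h4, mul_assoc]
        gcongr
        calc volume (closedBall (b : E) (s b))
            = t⁻¹ * (t * volume (closedBall (b : E) (s b))) := by
              rw [← mul_assoc, ENNReal.inv_mul_cancel ht ht', one_mul]
          _ ≤ _ := by gcongr; exact hs b hb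
    _ = 4 ^ d * t⁻¹ * ∫⁻ y in ⋃ b ∈ u, closedBall b (s b), g y := by
        rw [ENNReal.tsum_mul_left,
          lintegral_biUnion hu (fun b _ => isClosed_closedBall.measurableSet) hdisj]
    _ ≤ _ := mul_le_mul_right (setLIntegral_le_lintegral _ _) _

theorem lintegral_Ioi_indicator_rpow {r : ℝ} (hr : 0 < r) (a : ℝ≥0∞) :
    ∫⁻ t in Ioi (0 : ℝ), {t | ENNReal.ofReal t < a}.indicator
      (fun t => ENNReal.ofReal (r * t ^ (r - 1))) t = a ^ r := by
  have hfin : ∀ b : ℝ, 0 ≤ b → ∫⁻ t in Ioo (0 : ℝ) b, ENNReal.ofReal (r * t ^ (r - 1)) =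
      ENNReal.ofReal b ^ r := by
    intro b hb
    rw [restrict_Ioo_eq_restrict_Ioc, ← ofReal_integral_eq_lintegral_ofReal,
      ← intervalIntegral.integral_of_le hb, intervalIntegral.integral_const_mul,
      integral_rpow (Or.inl (by linarith)), ENNReal.ofReal_rpow_of_nonneg hb hr.le]
    · rw [sub_add_cancel, Real.zero_rpow hr.ne', sub_zero, mul_div_cancel₀ _ hr.ne']
    · refine Integrable.const_mul ?_ _
      exact (intervalIntegrable_iff_integrableOn_Ioc_of_le hb).1
        (intervalIntegral.intervalIntegrable_rpow' (by linarith))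
    · refine (ae_restrict_iff' measurableSet_Ioc).2 (Eventually.of_forall fun t ht => ?_)
      have := ht.1
      positivity
  have hind : ∀ b : ℝ, 0 ≤ b → ∫⁻ t in Ioi (0 : ℝ),
      {t | ENNReal.ofReal t < ENNReal.ofReal b}.indicator
      (fun t => ENNReal.ofReal (r * t ^ (r - 1))) t = ENNReal.ofReal b ^ r := by
    intro b hb
    rw [← hfin b hb, setLIntegral_indicator (measurableSet_lt ENNReal.measurable_ofReal
      measurable_const)]
    congr 2
    ext t
    simp only [mem_inter_iff, mem_ofPred_eq, mem_Ioi, mem_Ioo]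
    constructor
    · rintro ⟨h1, h2⟩
      exact ⟨h2, (ENNReal.ofReal_lt_ofReal_iff_of_nonneg h2.le).1 h1⟩
    · rintro ⟨h1, h2⟩
      exact ⟨(ENNReal.ofReal_lt_ofReal_iff_of_nonneg h1.le).2 h2, h1⟩
  rcases eq_or_ne a ⊤ with rfl | ha
  · rw [ENNReal.top_rpow_of_pos hr]
    -- For `a = ⊤` the integral dominates the one with endpoint `b ^ (1 / r)`, whose value is `b`.
    refine ENNReal.eq_top_of_forall_nnreal_le fun b => ?_
    have h1 := hind ((b : ℝ) ^ (1 / r)) (by positivity)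
    rw [ENNReal.ofReal_rpow_of_nonneg (by positivity) hr.le, ← Real.rpow_mul b.coe_nonneg,
      one_div_mul_cancel hr.ne', Real.rpow_one, ENNReal.ofReal_coe_nnreal] at h1
    rw [← h1]
    refine lintegral_mono fun t => ?_
    exact indicator_le_indicator_of_subset (fun t _ => ENNReal.ofReal_lt_top) (fun _ => zero_le) t
  · have := hind a.toReal ENNReal.toReal_nonneg
    rwa [ENNReal.ofReal_toReal ha] at this

/-- The layer cake formula for powers of a function with values in `ℝ≥0∞`. -/
theorem lintegral_rpow_eq_lintegral_volume_lt {f : E → ℝ≥0∞} (hf : Measurable f) {r : ℝ}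
    (hr : 0 < r) :
    ∫⁻ x, f x ^ r = ∫⁻ t in Ioi (0 : ℝ), ENNReal.ofReal (r * t ^ (r - 1)) *
      volume {x | ENNReal.ofReal t < f x} := by
  simp_rw [← lintegral_Ioi_indicator_rpow hr]
  rw [lintegral_lintegral_swap]
  · refine lintegral_congr fun t => ?_
    have : (fun x => {t | ENNReal.ofReal t < f x}.indicator
        (fun t => ENNReal.ofReal (r * t ^ (r - 1))) t) =
        {x | ENNReal.ofReal t < f x}.indicator fun _ => ENNReal.ofReal (r * t ^ (r - 1)) := by
      ext x
      simp only [indicator, mem_ofPred_eq]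
    rw [this, lintegral_indicator (measurableSet_lt measurable_const hf), setLIntegral_const]
  · have h : MeasurableSet {p : E × ℝ | ENNReal.ofReal p.2 < f p.1} :=
      measurableSet_lt (by fun_prop) (by fun_prop)
    exact (Measurable.indicator (f := fun p : E × ℝ => ENNReal.ofReal (r * p.2 ^ (r - 1)))
      (by fun_prop) h).aemeasurable

/-- The maximal function is bounded on `L^r` for `r > 1`. -/
theorem lintegral_maxFun_rpow_le (hd : d ≠ 0) {g : E → ℝ≥0∞} (hg : Measurable g) {r : ℝ}
    (hr : 1 < r) :
    ∫⁻ x, maxFun g x ^ r ≤ 4 ^ d * 2 ^ r * ENNReal.ofReal (r / (r - 1)) * ∫⁻ y, g y ^ r := by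
  have hr1 : 0 < r - 1 := by linarith
  have hM : Measurable (maxFun g) := (lowerSemicontinuous_maxFun hg.aemeasurable).measurable
  -- Marcinkiewicz truncation: the part of `g` below `t / 2` has averages at most `t / 2`, so only
  -- the part above `t / 2` enters the weak-type bound at height `t / 2`.
  have key : ∀ t ∈ Ioi (0 : ℝ), volume {x | ENNReal.ofReal t < maxFun g x} ≤
      4 ^ d * (ENNReal.ofReal t / 2)⁻¹ * ∫⁻ y, {y | ENNReal.ofReal t < 2 * g y}.indicator g y := by
    intro t ht
    refine le_trans (measure_mono ?_) (volume_lt_maxFun_le hd _ ?_ ?_)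
    · intro x hx
      simp only [mem_ofPred_eq] at hx ⊢
      by_contra hcon
      rw [not_lt] at hcon
      refine absurd hx (not_lt.2 ?_)
      refine iSup_le fun ⟨s, hs⟩ => ?_
      have h0 := (measure_ball_pos volume x hs).ne'
      calc (volume (ball x s))⁻¹ * ∫⁻ y in ball x s, g y
          ≤ (volume (ball x s))⁻¹ * ∫⁻ y in ball x s,
            ({y | ENNReal.ofReal t < 2 * g y}.indicator g y + ENNReal.ofReal t / 2) := by
            gcongr with y
            by_cases hy : ENNReal.ofReal t < 2 * g y
            · rw [indicator_of_mem (by exact hy)]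
              exact le_self_add
            · rw [indicator_of_notMem (by exact hy), zero_add,
                ENNReal.le_div_iff_mul_le (by simp) (by simp), mul_comm]
              exact not_lt.1 hy
        _ = (volume (ball x s))⁻¹ * (∫⁻ y in ball x s,
              {y | ENNReal.ofReal t < 2 * g y}.indicator g y) + ENNReal.ofReal t / 2 := by
            rw [lintegral_add_right _ measurable_const, mul_add, setLIntegral_const,
              mul_comm (ENNReal.ofReal t / 2), ← mul_assoc,
              ENNReal.inv_mul_cancel h0 measure_ball_lt_top.ne, one_mul]
        _ ≤ maxFun ({y | ENNReal.ofReal t < 2 * g y}.indicator g) x + ENNReal.ofReal t / 2 := by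
            gcongr
            exact le_iSup (fun s : Ioi (0 : ℝ) => (volume (ball x s))⁻¹ * ∫⁻ y in ball x s,
              {y | ENNReal.ofReal t < 2 * g y}.indicator g y) ⟨s, hs⟩
        _ ≤ ENNReal.ofReal t / 2 + ENNReal.ofReal t / 2 := by gcongr
        _ = ENNReal.ofReal t := ENNReal.add_halves _
    · simpa using ht
    · exact (ENNReal.div_lt_top ENNReal.ofReal_ne_top (by simp)).ne
  have hsw : AEMeasurable (Function.uncurry fun (t : ℝ) (y : E) =>
      {t | ENNReal.ofReal t < 2 * g y}.indicator
        (fun t => ENNReal.ofReal ((r - 1) * t ^ (r - 1 - 1))) t * g y)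
      ((volume.restrict (Ioi 0)).prod volume) := by
    have h : MeasurableSet {p : ℝ × E | ENNReal.ofReal p.1 < 2 * g p.2} :=
      measurableSet_lt (by fun_prop) (by fun_prop)
    exact ((Measurable.indicator (f := fun p : ℝ × E => ENNReal.ofReal
      ((r - 1) * p.1 ^ (r - 1 - 1))) (by fun_prop) h).mul (hg.comp measurable_snd)).aemeasurable
  calc ∫⁻ x, maxFun g x ^ r
      = ∫⁻ t in Ioi (0 : ℝ), ENNReal.ofReal (r * t ^ (r - 1)) *
        volume {x | ENNReal.ofReal t < maxFun g x} :=
        lintegral_rpow_eq_lintegral_volume_lt hM (by linarith)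
    _ ≤ ∫⁻ t in Ioi (0 : ℝ), 4 ^ d * 2 * ENNReal.ofReal (r / (r - 1)) * ∫⁻ y,
          {t | ENNReal.ofReal t < 2 * g y}.indicator
          (fun t => ENNReal.ofReal ((r - 1) * t ^ (r - 1 - 1))) t * g y := by
        refine setLIntegral_mono' measurableSet_Ioi fun t ht => ?_
        have ht0 : 0 < t := ht
        have e1 : ∫⁻ y, {t | ENNReal.ofReal t < 2 * g y}.indicator
            (fun t => ENNReal.ofReal ((r - 1) * t ^ (r - 1 - 1))) t * g y =
            ENNReal.ofReal ((r - 1) * t ^ (r - 1 - 1)) *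
              ∫⁻ y, {y | ENNReal.ofReal t < 2 * g y}.indicator g y := by
          rw [← lintegral_const_mul]
          · refine lintegral_congr fun y => ?_
            simp only [indicator, mem_ofPred_eq]
            split_ifs <;> simp
          · exact hg.indicator (measurableSet_lt measurable_const (by fun_prop))
        rw [e1]
        refine (mul_le_mul_right (key t ht) _).trans (le_of_eq ?_)
        rw [← mul_assoc, ← mul_assoc, ← mul_assoc]
        congr 1
        rw [ENNReal.inv_div (by simp) (by simp)]
        have e2 : (2 : ℝ≥0∞) / ENNReal.ofReal t = ENNReal.ofReal (2 / t) := by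
          rw [ENNReal.ofReal_div_of_pos ht0]; norm_num
        have e3 : (4 : ℝ≥0∞) ^ d = ENNReal.ofReal (4 ^ d) := by
          rw [ENNReal.ofReal_pow (by norm_num)]; norm_num
        have e4 : (2 : ℝ≥0∞) = ENNReal.ofReal 2 := by norm_num
        rw [e2, e3, e4, ← ENNReal.ofReal_mul (by positivity), ← ENNReal.ofReal_mul (by positivity),
          ← ENNReal.ofReal_mul (by positivity), ← ENNReal.ofReal_mul (by positivity),
          ← ENNReal.ofReal_mul (by positivity)]
        congr 1
        rw [Real.rpow_sub_one ht0.ne' (r - 1)]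
        field_simp
    _ = 4 ^ d * 2 * ENNReal.ofReal (r / (r - 1)) * ∫⁻ y, (2 * g y) ^ (r - 1) * g y := by
        rw [lintegral_const_mul' _ _ (by finiteness), lintegral_lintegral_swap hsw]
        congr 1
        refine lintegral_congr fun y => ?_
        rw [lintegral_mul_const, lintegral_Ioi_indicator_rpow hr1]
        exact Measurable.indicator (by fun_prop)
          (measurableSet_lt ENNReal.measurable_ofReal measurable_const)
    _ = 4 ^ d * 2 ^ r * ENNReal.ofReal (r / (r - 1)) * ∫⁻ y, g y ^ r := by
        have e : ∀ y, (2 * g y) ^ (r - 1) * g y = 2 ^ (r - 1) * g y ^ r := by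
          intro y
          rw [ENNReal.mul_rpow_of_nonneg _ _ hr1.le, mul_assoc]
          congr 1
          nth_rw 2 [← ENNReal.rpow_one (g y)]
          rw [← ENNReal.rpow_add_of_nonneg _ _ hr1.le zero_le_one, sub_add_cancel]
        simp_rw [e]
        rw [lintegral_const_mul' _ _ (by finiteness)]
        have e5 : (2 : ℝ≥0∞) ^ r = 2 * 2 ^ (r - 1) := by
          nth_rw 2 [← ENNReal.rpow_one 2]
          rw [← ENNReal.rpow_add_of_nonneg _ _ zero_le_one hr1.le]
          congr 1; ring
        rw [e5]
        ring

end Maximal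

/-! ### Riesz potentials and the Hardy–Littlewood–Sobolev inequality -/

section Riesz

/-- The Riesz-type potential `|x|⁻ᵃ * g` of a function with values in `ℝ≥0∞`. -/
def rieszPot (a : ℝ) (g : E → ℝ≥0∞) (x : E) : ℝ≥0∞ := ∫⁻ y, edist x y ^ (-a) * g y

/-- The `L^p` norm of a function with values in `ℝ≥0∞`. -/
def lpn (p : ℝ) (f : E → ℝ≥0∞) : ℝ≥0∞ := (∫⁻ x, f x ^ p) ^ (1 / p)

theorem rieszPot_congr {a : ℝ} {g h : E → ℝ≥0∞} (hgh : g =ᵐ[volume] h) :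
    rieszPot a g = rieszPot a h := by
  ext x
  exact lintegral_congr_ae (hgh.mono fun y hy => by simp only [hy])

theorem lpn_congr {p : ℝ} {g h : E → ℝ≥0∞} (hgh : g =ᵐ[volume] h) : lpn p g = lpn p h := by
  unfold lpn
  rw [lintegral_congr_ae (g := fun x => h x ^ p) (hgh.mono fun y hy => by simp only [hy])]

theorem lpn_mono {p : ℝ} (hp : 0 < p) {g h : E → ℝ≥0∞} (hgh : ∀ᵐ x, g x ≤ h x) :
    lpn p g ≤ lpn p h :=
  ENNReal.rpow_le_rpow (lintegral_mono_ae (hgh.mono fun _ hx => ENNReal.rpow_le_rpow hx hp.le))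
    (by positivity)

theorem lowerSemicontinuous_rieszPot (a : ℝ) {g : E → ℝ≥0∞} (hg : AEMeasurable g) :
    LowerSemicontinuous (rieszPot a g) := by
  refine lowerSemicontinuous_lintegral_param (fun x => ?_) fun y => ?_
  · exact (by fun_prop : Measurable fun y => edist x y ^ (-a)).aemeasurable.mul hg
  · refine LowerSemicontinuous.ennreal_mul_const (f := fun x => edist x y ^ (-a)) ?_ _
    exact (ENNReal.continuous_rpow_const.comp
      (continuous_id.edist continuous_const)).lowerSemicontinuous

theorem rieszPot_ne_zero {a : ℝ} (ha : 0 < a) {g : E → ℝ≥0∞} (hg : AEMeasurable g)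
    (hpos : ∀ᵐ y, 0 < g y) (x : E) : rieszPot a g x ≠ 0 := by
  intro h0
  have hm : Measurable fun y => edist x y ^ (-a) := by fun_prop
  have h0 := (lintegral_eq_zero_iff' (hm.aemeasurable.mul hg)).1 h0
  obtain ⟨y, hy, hgy⟩ := (h0.and hpos).exists
  rcases mul_eq_zero.1 hy with h | h
  · rw [ENNReal.rpow_eq_zero_iff] at h
    rcases h with ⟨-, h⟩ | ⟨h, -⟩
    · linarith
    · exact edist_ne_top x y h
  · exact hgy.ne' h

/-- The antiderivative of `a s^(-a-1)` writes the kernel as a superposition of indicators of balls,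
which brings the potential within reach of the maximal function. -/
theorem edist_rpow_neg_eq_lintegral {a : ℝ} (ha : 0 < a) {x y : E} (hxy : y ≠ x) :
    edist x y ^ (-a) = ∫⁻ s in Ioi (0 : ℝ), (ball x s).indicator
      (fun _ => ENNReal.ofReal (a * s ^ (-a - 1))) y := by
  have hb : 0 < dist y x := dist_pos.2 hxy
  have e : ∀ s : ℝ, (ball x s).indicator (fun _ => ENNReal.ofReal (a * s ^ (-a - 1))) y =
      (Ioi (dist y x)).indicator (fun s => ENNReal.ofReal (a * s ^ (-a - 1))) s := by
    intro s
    simp only [indicator, mem_ball, mem_Ioi]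
  simp_rw [e]
  rw [setLIntegral_indicator measurableSet_Ioi,
    show Ioi (dist y x) ∩ Ioi 0 = Ioi (dist y x) from
      inter_eq_left.2 (Ioi_subset_Ioi hb.le), ← ofReal_integral_eq_lintegral_ofReal,
    integral_const_mul, integral_Ioi_rpow_of_lt (by linarith) hb, edist_comm, edist_dist,
    ENNReal.ofReal_rpow_of_pos hb]
  · congr 1
    rw [sub_add_cancel]
    field_simp
  · exact (integrableOn_Ioi_rpow_of_lt (by linarith) hb).const_mul _
  · refine (ae_restrict_iff' measurableSet_Ioi).2 (Eventually.of_forall fun t ht => ?_)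
    have : 0 < t := hb.trans ht
    positivity

theorem rieszPot_eq_lintegral_ball (hd : d ≠ 0) {a : ℝ} (ha : 0 < a) {g : E → ℝ≥0∞}
    (hg : Measurable g) (x : E) :
    rieszPot a g x = ∫⁻ s in Ioi (0 : ℝ), ENNReal.ofReal (a * s ^ (-a - 1)) *
      ∫⁻ y in ball x s, g y := by
  have : Nonempty (Fin d) := ⟨⟨0, Nat.pos_of_ne_zero hd⟩⟩
  have h1 : rieszPot a g x = ∫⁻ y, ∫⁻ s in Ioi (0 : ℝ), (ball x s).indicator
      (fun _ => ENNReal.ofReal (a * s ^ (-a - 1))) y * g y := by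
    refine lintegral_congr_ae ?_
    have : ∀ᵐ y : E, y ≠ x := by simp [ae_iff]
    filter_upwards [this] with y hy
    rw [lintegral_mul_const, edist_rpow_neg_eq_lintegral ha hy]
    have : (fun s : ℝ => (ball x s).indicator (fun _ => ENNReal.ofReal (a * s ^ (-a - 1))) y) =
      (Ioi (dist y x)).indicator (fun s => ENNReal.ofReal (a * s ^ (-a - 1))) := by
      ext s
      simp only [indicator, mem_ball, mem_Ioi]
    rw [this]
    exact Measurable.indicator (by fun_prop) measurableSet_Ioi
  rw [h1, lintegral_lintegral_swap]
  · refine lintegral_congr fun s => ?_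
    rw [← lintegral_indicator measurableSet_ball, ← lintegral_const_mul _
      (hg.indicator measurableSet_ball)]
    refine lintegral_congr fun y => ?_
    simp only [indicator]
    split_ifs <;> simp
  · have h : MeasurableSet {p : E × ℝ | dist p.1 x < p.2} :=
      measurableSet_lt (by fun_prop) (by fun_prop)
    exact ((Measurable.indicator (f := fun p : E × ℝ => ENNReal.ofReal
      (a * p.2 ^ (-a - 1))) (by fun_prop) h).mul (hg.comp measurable_fst)).aemeasurable

theorem setLIntegral_le_lpn_mul {r : ℝ} (hr : 1 < r) {g : E → ℝ≥0∞} (hg : AEMeasurable g)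
    (s : Set E) : ∫⁻ y in s, g y ≤ lpn r g * volume s ^ (1 - 1 / r) := by
  have hc : r.HolderConjugate (r / (r - 1)) := Real.HolderConjugate.conjExponent hr
  have := ENNReal.lintegral_mul_le_Lp_mul_Lq (volume.restrict s) hc hg.restrict
    (aemeasurable_const (b := (1 : ℝ≥0∞)))
  simp only [Pi.mul_apply, mul_one, ENNReal.one_rpow, lintegral_const, one_mul,
    Measure.restrict_apply_univ] at this
  refine this.trans ?_
  have e : 1 / (r / (r - 1)) = 1 - 1 / r := by
    have : r ≠ 0 := by linarith
    field_simp
  rw [e]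
  gcongr
  unfold lpn
  gcongr
  exact Measure.restrict_le_self

/-- Balls of radius at most `R` are controlled by the maximal function, larger ones by Hölder. The
relation `hq` is what turns the exponent in the second integral into `-(d / q) - 1`. -/
theorem rieszPot_le_split (hd : d ≠ 0) {a r q : ℝ} (ha : 0 < a) (had : a < d) (hr : 1 < r)
    (hrq : r < q) (hq : d / q = d / r + a - d) {g : E → ℝ≥0∞} (hg : Measurable g) (x : E)
    {R : ℝ} (hR : 0 < R) :
    rieszPot a g x ≤ ENNReal.ofReal (a / (d - a)) * volume (ball (0 : E) 1) *
        (ENNReal.ofReal (R ^ (d - a)) * maxFun g x) +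
      ENNReal.ofReal (a * q / d) * volume (ball (0 : E) 1) ^ (1 - 1 / r) *
        (ENNReal.ofReal (R ^ (-(d / q))) * lpn r g) := by
  have hd0 : (0 : ℝ) < d := by positivity
  have hq0 : 0 < q := by linarith
  have hκ := volume_unitBall_ne_top (d := d)
  set κ := volume (ball (0 : E) 1)
  rw [rieszPot_eq_lintegral_ball hd ha hg, ← Ioc_union_Ioi_eq_Ioi hR.le,
    lintegral_union measurableSet_Ioi (by
      rw [disjoint_left]; intro t ht ht'; exact absurd ht.2 (not_le.2 ht'))]
  refine add_le_add ?_ ?_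
  · calc ∫⁻ s in Ioc 0 R, ENNReal.ofReal (a * s ^ (-a - 1)) * ∫⁻ y in ball x s, g y
        ≤ ∫⁻ s in Ioc 0 R, ENNReal.ofReal (a * s ^ (d - a - 1)) * (κ * maxFun g x) := by
          refine setLIntegral_mono' measurableSet_Ioc fun s hs => ?_
          have hs0 := hs.1
          refine (mul_le_mul_right (setLIntegral_ball_le_maxFun g x hs0) _).trans (le_of_eq ?_)
          rw [volume_ball_eq x hs0, ← mul_assoc, ← mul_assoc, ← ENNReal.ofReal_mul (by positivity),
            mul_assoc]
          congr 2
          rw [mul_assoc, ← Real.rpow_natCast, ← Real.rpow_add hs0]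
          congr 2; ring
      _ = ENNReal.ofReal (a / (d - a) * R ^ (d - a)) * (κ * maxFun g x) := by
          rw [lintegral_mul_const _ (by fun_prop), ← ofReal_integral_eq_lintegral_ofReal,
            ← intervalIntegral.integral_of_le hR.le, intervalIntegral.integral_const_mul,
            integral_rpow (Or.inl (by linarith)), sub_add_cancel, Real.zero_rpow (by linarith)]
          · congr 2; ring
          · refine Integrable.const_mul ?_ _
            exact (intervalIntegrable_iff_integrableOn_Ioc_of_le hR.le).1
              (intervalIntegral.intervalIntegrable_rpow' (by linarith))
          · refine (ae_restrict_iff' measurableSet_Ioc).2 (Eventually.of_forall fun t ht => ?_)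
            have := ht.1
            positivity
      _ = _ := by
          rw [ENNReal.ofReal_mul (div_nonneg ha.le (by linarith))]
          ring
  · have e1 : ∀ s : ℝ, 0 < s → volume (ball x s) ^ (1 - 1 / r) =
        ENNReal.ofReal (s ^ (d - d / r)) * κ ^ (1 - 1 / r) := by
      intro s hs
      have h1r : 0 ≤ 1 - 1 / r := by
        rw [sub_nonneg, div_le_one (by linarith)]; exact hr.le
      rw [volume_ball_eq x hs, ENNReal.mul_rpow_of_nonneg _ _ h1r,
        ENNReal.ofReal_rpow_of_nonneg (by positivity) h1r, ← Real.rpow_natCast,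
        ← Real.rpow_mul hs.le]
      congr 3; ring
    calc ∫⁻ s in Ioi R, ENNReal.ofReal (a * s ^ (-a - 1)) * ∫⁻ y in ball x s, g y
        ≤ ∫⁻ s in Ioi R, ENNReal.ofReal (a * s ^ (-(d / q) - 1)) *
            (lpn r g * κ ^ (1 - 1 / r)) := by
          refine setLIntegral_mono' measurableSet_Ioi fun s hs => ?_
          have hs0 : 0 < s := hR.trans hs
          refine (mul_le_mul_right (setLIntegral_le_lpn_mul hr hg.aemeasurable _) _).trans
            (le_of_eq ?_)
          rw [e1 s hs0, mul_left_comm (lpn r g), ← mul_assoc,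
            ← ENNReal.ofReal_mul (by positivity)]
          congr 2
          rw [mul_assoc, ← Real.rpow_add hs0]
          congr 2; linarith
      _ = ENNReal.ofReal (a * q / d * R ^ (-(d / q))) * (lpn r g * κ ^ (1 - 1 / r)) := by
          have hdq : 0 < d / q := by positivity
          rw [lintegral_mul_const _ (by fun_prop), ← ofReal_integral_eq_lintegral_ofReal,
            integral_const_mul, integral_Ioi_rpow_of_lt (by linarith) hR, sub_add_cancel]
          · congr 2
            field_simp
          · exact (integrableOn_Ioi_rpow_of_lt (by linarith) hR).const_mul _
          · refine (ae_restrict_iff' measurableSet_Ioi).2 (Eventually.of_forall fun t ht => ?_)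
            have : 0 < t := hR.trans ht
            positivity
      _ = _ := by
          rw [ENNReal.ofReal_mul (by positivity)]
          ring

theorem rieszPot_eq_zero_of_maxFun_eq_zero (hd : d ≠ 0) {a : ℝ} (ha : 0 < a) {g : E → ℝ≥0∞}
    (hg : Measurable g) {x : E} (h : maxFun g x = 0) : rieszPot a g x = 0 := by
  rw [rieszPot_eq_lintegral_ball hd ha hg, setLIntegral_congr_fun (g := fun _ => 0)
    measurableSet_Ioi, lintegral_zero]
  intro s hs
  have := setLIntegral_ball_le_maxFun g x hs
  simp only [h, mul_zero, nonpos_iff_eq_zero] at this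
  simp [this]

/-- Hedberg's pointwise inequality. -/
theorem rieszPot_rpow_le (hd : d ≠ 0) {a r q : ℝ} (ha : 0 < a) (had : a < d) (hr : 1 < r)
    (hrq : r < q) (hq : d / q = d / r + a - d) :
    ∃ C : ℝ≥0∞, C ≠ ⊤ ∧ ∀ g : E → ℝ≥0∞, Measurable g → lpn r g ≠ 0 → lpn r g ≠ ⊤ → ∀ x,
      rieszPot a g x ^ q ≤ C * (maxFun g x ^ r * lpn r g ^ (q - r)) := by
  have hd0 : (0 : ℝ) < d := by positivity
  have hq0 : 0 < q := by linarith
  have hκ := volume_unitBall_ne_top (d := d)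
  have hκ0 := volume_unitBall_ne_zero (d := d)
  have h1r : 0 ≤ 1 - 1 / r := by
    rw [sub_nonneg, div_le_one (by linarith)]; exact hr.le
  set D₁ := ENNReal.ofReal (a / (d - a)) * volume (ball (0 : E) 1)
  set D₂ := ENNReal.ofReal (a * q / d) * volume (ball (0 : E) 1) ^ (1 - 1 / r)
  have hD : (D₁ + D₂) ^ q ≠ ⊤ := by
    refine ENNReal.rpow_ne_top_of_nonneg hq0.le (ENNReal.add_ne_top.2 ⟨?_, ?_⟩)
    · exact ENNReal.mul_ne_top ENNReal.ofReal_ne_top hκ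
    · exact ENNReal.mul_ne_top ENNReal.ofReal_ne_top (ENNReal.rpow_ne_top_of_nonneg h1r hκ)
  have hD1 : D₁ ≠ 0 := by
    refine mul_ne_zero ?_ hκ0
    simpa using div_pos ha (by linarith)
  refine ⟨(D₁ + D₂) ^ q, hD, fun g hg hN0 hN x => ?_⟩
  rcases eq_or_ne (maxFun g x) 0 with hM0 | hM0
  · rw [rieszPot_eq_zero_of_maxFun_eq_zero hd ha hg hM0, ENNReal.zero_rpow_of_pos hq0]
    exact zero_le
  rcases eq_or_ne (maxFun g x) ⊤ with hM | hM
  · rw [hM, ENNReal.top_rpow_of_pos (by linarith), ENNReal.top_mul, ENNReal.mul_top]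
    · exact le_top
    · exact (ENNReal.rpow_pos_of_nonneg (by positivity) hq0.le).ne'
    · exact (ENNReal.rpow_pos_of_nonneg (pos_iff_ne_zero.2 hN0) (by linarith)).ne'
  set m := (maxFun g x).toReal with hm
  set n := (lpn r g).toReal with hn
  have hm0 : 0 < m := ENNReal.toReal_pos hM0 hM
  have hn0 : 0 < n := ENNReal.toReal_pos hN0 hN
  have hMm : maxFun g x = ENNReal.ofReal m := (ENNReal.ofReal_toReal hM).symm
  have hNn : lpn r g = ENNReal.ofReal n := (ENNReal.ofReal_toReal hN).symm
  -- This radius balances the two terms of the split: both become `m ^ (r / q) * n ^ (1 - r / q)` up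
  -- to constants.
  set R := (n / m) ^ (r / d) with hR
  have hR0 : 0 < R := by positivity
  have e1 : R ^ (-(d / q)) * n = m ^ (r / q) * n ^ (1 - r / q) := by
    rw [hR, ← Real.rpow_mul (by positivity), Real.div_rpow hn0.le hm0.le,
      show r / d * -(d / q) = -(r / q) by field_simp, Real.rpow_neg hn0.le, Real.rpow_neg hm0.le,
      Real.rpow_sub hn0, Real.rpow_one]
    field_simp
  have e2 : R ^ (d - a) * m = m ^ (r / q) * n ^ (1 - r / q) := by
    rw [← e1, show (d : ℝ) - a = d / r + -(d / q) by linarith, Real.rpow_add hR0]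
    have : R ^ (d / r : ℝ) = n / m := by
      rw [hR, ← Real.rpow_mul (by positivity), show r / d * (d / r) = 1 by field_simp,
        Real.rpow_one]
    rw [this]
    field_simp
  have hs := rieszPot_le_split hd ha had hr hrq hq hg x hR0
  rw [hMm, hNn, ← ENNReal.ofReal_mul (by positivity), ← ENNReal.ofReal_mul (by positivity), e1, e2,
    ← add_mul] at hs
  refine (ENNReal.rpow_le_rpow hs hq0.le).trans (le_of_eq ?_)
  rw [ENNReal.mul_rpow_of_nonneg _ _ hq0.le, hMm, hNn, ENNReal.ofReal_rpow_of_pos hm0,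
    ENNReal.ofReal_rpow_of_pos hn0, ENNReal.ofReal_rpow_of_nonneg (by positivity) hq0.le,
    ← ENNReal.ofReal_mul (by positivity), Real.mul_rpow (by positivity) (by positivity),
    ← Real.rpow_mul hm0.le, ← Real.rpow_mul hn0.le]
  congr 4 <;> field_simp

/-- The Hardy–Littlewood–Sobolev inequality. -/
theorem lpn_rieszPot_le (hd : d ≠ 0) {a r q : ℝ} (ha : 0 < a) (had : a < d) (hr : 1 < r)
    (hrq : r < q) (hq : d / q = d / r + a - d) :
    ∃ C : ℝ≥0∞, C ≠ ⊤ ∧ C ≠ 0 ∧ ∀ g : E → ℝ≥0∞, AEMeasurable g →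
      lpn q (rieszPot a g) ≤ C * lpn r g := by
  have hq0 : 0 < q := by linarith
  have hr0 : 0 < r := by linarith
  obtain ⟨C₁, hC₁, h₁⟩ := rieszPot_rpow_le hd ha had hr hrq hq
  set C₂ : ℝ≥0∞ := 4 ^ d * 2 ^ r * ENNReal.ofReal (r / (r - 1)) with hC₂
  have hC₂' : C₂ ≠ ⊤ := by finiteness
  -- The summand `1` keeps the constant nonzero, so that the bound is trivial when the norm of `g`
  -- is `⊤`.
  refine ⟨(C₁ * C₂) ^ (1 / q) + 1, ?_, by simp, ?_⟩
  · exact ENNReal.add_ne_top.2 ⟨ENNReal.rpow_ne_top_of_nonneg (by positivity)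
      (ENNReal.mul_ne_top hC₁ hC₂'), by simp⟩
  have main : ∀ g : E → ℝ≥0∞, Measurable g →
      lpn q (rieszPot a g) ≤ ((C₁ * C₂) ^ (1 / q) + 1) * lpn r g := by
    intro g hg
    rcases eq_or_ne (lpn r g) 0 with h0 | h0
    · have hg0 : g =ᵐ[volume] fun _ => 0 := by
        have h := (ENNReal.rpow_eq_zero_iff_of_pos (by positivity)).1 h0
        rw [lintegral_eq_zero_iff (by fun_prop)] at h
        filter_upwards [h] with x hx
        exact (ENNReal.rpow_eq_zero_iff_of_pos hr0).1 hx
      have : rieszPot a g = fun _ => 0 := by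
        rw [rieszPot_congr hg0]
        ext x
        simp [rieszPot]
      rw [this]
      simp [lpn, hq0]
    rcases eq_or_ne (lpn r g) ⊤ with hN | hN
    · rw [hN, ENNReal.mul_top (by simp)]
      exact le_top
    have hM : _ ≤ C₂ * _ := lintegral_maxFun_rpow_le hd hg hr
    clear_value C₂
    have hNr : ∫⁻ y, g y ^ r = lpn r g ^ r := by
      rw [lpn, ← ENNReal.rpow_mul, one_div_mul_cancel hr0.ne', ENNReal.rpow_one]
    have : ∫⁻ x, rieszPot a g x ^ q ≤ C₁ * C₂ * lpn r g ^ q := by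
      calc ∫⁻ x, rieszPot a g x ^ q
          ≤ ∫⁻ x, C₁ * (maxFun g x ^ r * lpn r g ^ (q - r)) :=
            lintegral_mono fun x => h₁ g hg h0 hN x
        _ = C₁ * ((∫⁻ x, maxFun g x ^ r) * lpn r g ^ (q - r)) := by
            rw [lintegral_const_mul' _ _ hC₁, lintegral_mul_const'
              _ _ (ENNReal.rpow_ne_top_of_nonneg (by linarith) hN)]
        _ ≤ C₁ * ((C₂ * lpn r g ^ r) * lpn r g ^ (q - r)) := by
            rw [← hNr]; gcongr
        _ = _ := by
            rw [mul_assoc C₂, ← ENNReal.rpow_add _ _ h0 hN, add_sub_cancel, mul_assoc]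
    calc lpn q (rieszPot a g) ≤ (C₁ * C₂ * lpn r g ^ q) ^ (1 / q) :=
          ENNReal.rpow_le_rpow this (by positivity)
      _ = (C₁ * C₂) ^ (1 / q) * lpn r g := by
          rw [ENNReal.mul_rpow_of_nonneg _ _ (by positivity), ← ENNReal.rpow_mul,
            mul_one_div_cancel hq0.ne', ENNReal.rpow_one]
      _ ≤ _ := by gcongr; exact le_self_add
  intro g hg
  rw [rieszPot_congr hg.ae_eq_mk, lpn_congr hg.ae_eq_mk]
  exact main _ hg.measurable_mk

end Riesz

/-! ### Inversions, Kelvin transforms and comparison of potentials -/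

section Inversion

open EuclideanGeometry (inversion)

/-- The conformal factor of the inversion in the sphere of centre `c` and radius `R`. -/
def invFactor (c : E) (R : ℝ) (y : E) : ℝ≥0∞ := ENNReal.ofReal (R / dist y c)

/-- The Kelvin transform of weight `b`. -/
def kelvin (b : ℝ) (c : E) (R : ℝ) (g : E → ℝ≥0∞) (y : E) : ℝ≥0∞ :=
  invFactor c R y ^ b * g (inversion c R y)

theorem ae_ne (hd : d ≠ 0) (c : E) : ∀ᵐ y : E, y ≠ c := by
  have : Nonempty (Fin d) := ⟨⟨0, Nat.pos_of_ne_zero hd⟩⟩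
  simp [ae_iff]

theorem invFactor_ne_zero {c y : E} {R : ℝ} (hR : 0 < R) (hy : y ≠ c) : invFactor c R y ≠ 0 := by
  have := div_pos hR (dist_pos.2 hy)
  simpa [invFactor] using this

theorem invFactor_ne_top (c y : E) (R : ℝ) : invFactor c R y ≠ ⊤ := ENNReal.ofReal_ne_top

theorem invFactor_rpow_ne_zero {c y : E} {R : ℝ} (hR : 0 < R) (hy : y ≠ c) (b : ℝ) :
    invFactor c R y ^ b ≠ 0 :=
  (ENNReal.rpow_pos (pos_iff_ne_zero.2 (invFactor_ne_zero hR hy)) (invFactor_ne_top c y R)).ne'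

theorem invFactor_rpow_ne_top {c y : E} {R : ℝ} (hR : 0 < R) (hy : y ≠ c) (b : ℝ) :
    invFactor c R y ^ b ≠ ⊤ :=
  ENNReal.rpow_ne_top_of_ne_zero (invFactor_ne_zero hR hy) (invFactor_ne_top c y R)

theorem measurable_invFactor (c : E) (R : ℝ) : Measurable (invFactor c R) := by
  unfold invFactor; fun_prop

theorem measurable_inversion (c : E) (R : ℝ) : Measurable (inversion c R) := by
  have : inversion c R = fun x : E => (R / dist x c) ^ 2 • (x - c) + c := by
    ext x; simp [inversion]
  rw [this]
  fun_prop

theorem measurable_kelvin (b : ℝ) (c : E) (R : ℝ) {g : E → ℝ≥0∞} (hg : Measurable g) :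
    Measurable (kelvin b c R g) :=
  ((measurable_invFactor c R).pow_const b).mul (hg.comp (measurable_inversion c R))

theorem invFactor_mul_inversion {c y : E} {R : ℝ} (hR : 0 < R) (hy : y ≠ c) :
    invFactor c R y * invFactor c R (inversion c R y) = 1 := by
  have h := dist_pos.2 hy
  rw [invFactor, invFactor, EuclideanGeometry.dist_inversion_center,
    ← ENNReal.ofReal_mul (by positivity)]
  rw [show R / dist y c * (R / (R ^ 2 / dist y c)) = 1 by field_simp, ENNReal.ofReal_one]

theorem edist_inversion_inversion {c y z : E} {R : ℝ} (hR : 0 < R) (hy : y ≠ c) (hz : z ≠ c) :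
    edist (inversion c R y) (inversion c R z) =
      invFactor c R y * invFactor c R z * edist y z := by
  have h := dist_pos.2 hy
  have h' := dist_pos.2 hz
  rw [edist_dist, EuclideanGeometry.dist_inversion_inversion hy hz, invFactor, invFactor,
    edist_dist y z, ← ENNReal.ofReal_mul (by positivity), ← ENNReal.ofReal_mul (by positivity)]
  congr 1
  field_simp

theorem kelvin_kelvin {b : ℝ} {c : E} {R : ℝ} (hR : 0 < R) (g : E → ℝ≥0∞) {y : E} (hy : y ≠ c) :
    kelvin b c R (kelvin b c R g) y = g y := by
  have hy' : inversion c R y ≠ c := by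
    rwa [Ne, EuclideanGeometry.inversion_eq_center hR.ne']
  unfold kelvin
  rw [EuclideanGeometry.inversion_inversion c hR.ne', ← mul_assoc,
    ← ENNReal.mul_rpow_of_ne_top (invFactor_ne_top _ _ _) (invFactor_ne_top _ _ _),
    invFactor_mul_inversion hR hy, ENNReal.one_rpow, one_mul]

theorem kelvin_mul {b b' : ℝ} {c : E} {R : ℝ} (hR : 0 < R) (g h : E → ℝ≥0∞) {y : E} (hy : y ≠ c) :
    kelvin (b + b') c R (fun x => g x * h x) y = kelvin b c R g y * kelvin b' c R h y := by
  unfold kelvin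
  rw [ENNReal.rpow_add _ _ (invFactor_ne_zero hR hy) (invFactor_ne_top _ _ _)]
  ring

theorem kelvin_rpow {b p : ℝ} (hp : 0 ≤ p) (c : E) (R : ℝ) (g : E → ℝ≥0∞) (y : E) :
    kelvin b c R g y ^ p = kelvin (b * p) c R (fun x => g x ^ p) y := by
  unfold kelvin
  rw [ENNReal.mul_rpow_of_nonneg _ _ hp, ENNReal.rpow_mul]

/-- Change of variables for an inversion. -/
theorem lintegral_kelvin (hd : d ≠ 0) {c : E} {R : ℝ} (hR : 0 < R) (h : E → ℝ≥0∞) :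
    ∫⁻ y, kelvin (2 * d) c R h y = ∫⁻ y, h y := by
  have hae : ({c}ᶜ : Set E) =ᵐ[volume] univ := by
    rw [ae_eq_univ, compl_compl]
    have : Nonempty (Fin d) := ⟨⟨0, Nat.pos_of_ne_zero hd⟩⟩
    exact measure_singleton c
  have himg : inversion c R '' {c}ᶜ = {c}ᶜ := by
    rw [Set.image_compl_eq (EuclideanGeometry.inversion_bijective c hR.ne'), image_singleton,
      EuclideanGeometry.inversion_self]
  have key := lintegral_image_eq_lintegral_abs_det_fderiv_mul volume
    (s := ({c}ᶜ : Set E)) (measurableSet_singleton c).compl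
    (fun x hx => (EuclideanGeometry.hasFDerivAt_inversion (R := R) hx).hasFDerivWithinAt)
    (EuclideanGeometry.inversion_injective c hR.ne').injOn h
  rw [himg, setLIntegral_congr hae, setLIntegral_univ] at key
  rw [key, ← setLIntegral_univ, ← setLIntegral_congr hae]
  refine setLIntegral_congr_fun (measurableSet_singleton c).compl fun y hy => ?_
  have hy' : y ≠ c := hy
  have hpos := div_pos hR (dist_pos.2 hy')
  simp only [kelvin, invFactor]
  congr 1
  -- The derivative of the inversion is the squared conformal factor times a reflection, whose
  -- determinant is `±1`.
  have hdet : |((R / dist y c) ^ 2 • ((ℝ ∙ (y - c))ᗮ.reflection : E →L[ℝ] E)).det| =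
      (R / dist y c) ^ (2 * (d : ℝ)) := by
    rw [ContinuousLinearMap.det]
    simp only [ContinuousLinearMap.toLinearMap_smul]
    rw [LinearMap.det_smul, abs_mul]
    have : |LinearMap.det (((ℝ ∙ (y - c))ᗮ.reflection : E →L[ℝ] E) : E →ₗ[ℝ] E)| = 1 := by
      have h := Submodule.det_reflection (ℝ ∙ (y - c))ᗮ
      rw [show (((ℝ ∙ (y - c))ᗮ.reflection : E →L[ℝ] E) : E →ₗ[ℝ] E) =
        ((ℝ ∙ (y - c))ᗮ.reflection).toLinearMap from rfl, h, abs_pow]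
      simp
    rw [this, mul_one, finrank_euclideanSpace_fin, abs_of_pos (by positivity), ← pow_mul,
      ← Real.rpow_natCast]
    push_cast
    rfl
  rw [hdet, ENNReal.ofReal_rpow_of_pos hpos]

/-- Inversions preserve null sets: the change of variables is applied to the indicator of a
measurable null set. -/
theorem ae_comp_inversion (hd : d ≠ 0) {c : E} {R : ℝ} (hR : 0 < R) {p : E → Prop}
    (hp : ∀ᵐ x, p x) : ∀ᵐ x, p (inversion c R x) := by
  obtain ⟨t, ht, htm, ht0⟩ := exists_measurable_superset_of_null (ae_iff.1 hp)
  have h := lintegral_kelvin hd (c := c) hR (t.indicator 1)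
  rw [lintegral_indicator_one htm, ht0,
    lintegral_eq_zero_iff (measurable_kelvin _ _ _ (measurable_one.indicator htm))] at h
  filter_upwards [h, ae_ne hd c] with x hx hxc
  by_contra hcon
  have hmem : inversion c R x ∈ t := ht hcon
  simp only [kelvin, indicator_of_mem hmem, Pi.one_apply, mul_one, Pi.zero_apply] at hx
  exact invFactor_rpow_ne_zero hR hxc _ hx

/-- The potential intertwines Kelvin transforms. -/
theorem kelvin_rieszPot (hd : d ≠ 0) {a : ℝ} {c : E} {R : ℝ} (hR : 0 < R) (g : E → ℝ≥0∞) {y : E}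
    (hy : y ≠ c) :
    kelvin a c R (rieszPot a g) y = rieszPot a (kelvin (2 * d - a) c R g) y := by
  unfold rieszPot
  rw [kelvin, ← lintegral_kelvin hd (c := c) hR,
    ← lintegral_const_mul' _ _ (invFactor_rpow_ne_top hR hy _)]
  refine lintegral_congr_ae ?_
  filter_upwards [ae_ne hd c] with z hz
  simp only [kelvin]
  have hjy := invFactor_ne_zero hR hy
  have hjz := invFactor_ne_zero hR hz
  have hty := invFactor_ne_top c y R
  have htz := invFactor_ne_top c z R
  -- Distances pick up the conformal factor at both ends. At `y` it cancels the weight `a`; at `z`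
  -- it lowers the Jacobian weight `2 d` to `2 d - a`.
  rw [edist_inversion_inversion hR hy hz,
    ENNReal.mul_rpow_of_ne_top (ENNReal.mul_ne_top hty htz) (edist_ne_top _ _),
    ENNReal.mul_rpow_of_ne_top hty htz]
  rw [show 2 * (d : ℝ) = a + (2 * d - a) by ring, ENNReal.rpow_add _ _ hjz htz]
  have e : ∀ j : ℝ≥0∞, j ≠ 0 → j ≠ ⊤ → j ^ a * j ^ (-a) = 1 := fun j h h' => by
    rw [← ENNReal.rpow_add _ _ h h', add_neg_cancel, ENNReal.rpow_zero]
  calc invFactor c R y ^ a * (invFactor c R z ^ a * invFactor c R z ^ (2 * (d : ℝ) - a) *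
        (invFactor c R y ^ (-a) * invFactor c R z ^ (-a) * edist y z ^ (-a) *
          g (inversion c R z)))
      = (invFactor c R y ^ a * invFactor c R y ^ (-a)) *
        (invFactor c R z ^ a * invFactor c R z ^ (-a)) * (edist y z ^ (-a) *
          (invFactor c R z ^ (2 * (d : ℝ) - a) * g (inversion c R z))) := by ring
    _ = _ := by rw [e _ hjy hty, e _ hjz htz, one_mul, one_mul]; congr 3; ring_nf

/-- The kernel of the reflected potential. -/
def reflKernel (a : ℝ) (c : E) (R : ℝ) (y z : E) : ℝ≥0∞ :=
  invFactor c R z ^ a * edist y (inversion c R z) ^ (-a)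

theorem measurable_reflKernel (a : ℝ) (c : E) (R : ℝ) (y : E) :
    Measurable (reflKernel a c R y) := by
  have := measurable_inversion c R
  have := measurable_invFactor c R
  unfold reflKernel
  fun_prop

theorem lintegral_compl_ball_eq (hd : d ≠ 0) {c : E} {R : ℝ} (hR : 0 < R) (h : E → ℝ≥0∞) :
    ∫⁻ z in (ball c R)ᶜ, h z = ∫⁻ z in ball c R, kelvin (2 * d) c R h z := by
  rw [← lintegral_indicator measurableSet_ball.compl, ← lintegral_kelvin hd (c := c) hR,
    ← lintegral_indicator measurableSet_ball]
  have hsph : ∀ᵐ z : E, z ∉ sphere c R := by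
    have : Nonempty (Fin d) := ⟨⟨0, Nat.pos_of_ne_zero hd⟩⟩
    exact measure_eq_zero_iff_ae_notMem.1 (Measure.addHaar_sphere volume c R)
  refine lintegral_congr_ae ?_
  filter_upwards [ae_ne hd c, hsph] with z hz hzs
  have hpos := dist_pos.2 hz
  have hiff : inversion c R z ∈ (ball c R)ᶜ ↔ z ∈ ball c R := by
    rw [mem_compl_iff, mem_ball, mem_ball, EuclideanGeometry.dist_inversion_center, not_lt,
      le_div_iff₀ hpos, sq, mul_le_mul_iff_right₀ hR]
    exact ⟨fun h => lt_of_le_of_ne h hzs, le_of_lt⟩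
  by_cases hzb : z ∈ ball c R
  · rw [indicator_of_mem hzb, kelvin, kelvin, indicator_of_mem (hiff.2 hzb)]
  · rw [indicator_of_notMem hzb, kelvin, indicator_of_notMem (fun h => hzb (hiff.1 h)), mul_zero]

/-- Inversion carries the exterior of the ball to the interior, so the whole potential becomes an
integral over the ball with a direct and a reflected kernel. -/
theorem rieszPot_eq_setLIntegral_ball (hd : d ≠ 0) {a : ℝ} {c : E} {R : ℝ} (hR : 0 < R)
    {g : E → ℝ≥0∞} (hg : Measurable g) (y : E) :
    rieszPot a g y = ∫⁻ z in ball c R,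
      (edist y z ^ (-a) * g z + reflKernel a c R y z * kelvin (2 * d - a) c R g z) := by
  have hm : Measurable fun z => edist y z ^ (-a) * g z := by fun_prop
  rw [lintegral_add_left hm, rieszPot,
    ← lintegral_add_compl (fun z => edist y z ^ (-a) * g z) (measurableSet_ball (x := c) (ε := R)),
    lintegral_compl_ball_eq hd hR]
  congr 1
  refine setLIntegral_congr_fun_ae measurableSet_ball ?_
  filter_upwards [ae_ne hd c] with z hz _
  simp only [kelvin, reflKernel]
  nth_rw 1 [show 2 * (d : ℝ) = a + (2 * d - a) by ring]
  rw [ENNReal.rpow_add _ _ (invFactor_ne_zero hR hz) (invFactor_ne_top _ _ _)]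
  ring

/-- Since the Kelvin transform is an involution, the two densities merely trade places. Comparing
the potentials then reduces to comparing the two kernels. -/
theorem rieszPot_kelvin_eq_setLIntegral_ball (hd : d ≠ 0) {a : ℝ} {c : E} {R : ℝ} (hR : 0 < R)
    {g : E → ℝ≥0∞} (hg : Measurable g) (y : E) :
    rieszPot a (kelvin (2 * d - a) c R g) y = ∫⁻ z in ball c R,
      (edist y z ^ (-a) * kelvin (2 * d - a) c R g z + reflKernel a c R y z * g z) := by
  rw [rieszPot_eq_setLIntegral_ball hd hR (measurable_kelvin _ _ _ hg)]
  refine setLIntegral_congr_fun_ae measurableSet_ball ?_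
  filter_upwards [ae_ne hd c] with z hz _
  rw [kelvin_kelvin hR g hz]

/-- With `p = y - c`, `q = z - c` and `z*` the inverse point of `z`, the claim is `R |y - z| < |z -
c| |y - z*|`. The difference of the squares is `(R² - |p|²) (R² - |q|²)`, positive inside the ball.
-/
theorem reflKernel_lt {a : ℝ} (ha : 0 < a) {c y z : E} {R : ℝ} (hR : 0 < R) (hy : y ∈ ball c R)
    (hz : z ∈ ball c R) (hzc : z ≠ c) (hyz : y ≠ z) :
    reflKernel a c R y z < edist y z ^ (-a) := by
  have hpos := dist_pos.2 hzc
  have hne : y ≠ inversion c R z := by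
    rintro rfl
    rw [mem_ball] at hy hz
    rw [EuclideanGeometry.dist_inversion_center, div_lt_iff₀ hpos] at hy
    nlinarith
  have hlt : R * dist y z < dist z c * dist y (inversion c R z) := by
    have h0 : 0 ≤ dist z c * dist y (inversion c R z) := by positivity
    refine lt_of_pow_lt_pow_left₀ 2 h0 ?_
    rw [mem_ball, dist_eq_norm] at hy hz
    rw [dist_eq_norm] at hpos
    have e1 : inversion c R z = (R / ‖z - c‖) ^ 2 • (z - c) + c := by
      simp [inversion, dist_eq_norm]
    rw [mul_pow, mul_pow, e1, dist_eq_norm, dist_eq_norm, dist_eq_norm]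
    set p := y - c with hp
    set q := z - c with hq
    rw [show y - z = p - q by rw [hp, hq]; abel,
      show y - ((R / ‖q‖) ^ 2 • q + c) = p - (R / ‖q‖) ^ 2 • q by rw [hp]; abel]
    rw [norm_sub_sq_real p q, norm_sub_sq_real p ((R / ‖q‖) ^ 2 • q), inner_smul_right, norm_smul,
      Real.norm_eq_abs,
      abs_of_nonneg (sq_nonneg _)]
    have e2 : ‖q‖ ^ 2 * (‖p‖ ^ 2 - 2 * ((R / ‖q‖) ^ 2 * inner ℝ p q) +
        ((R / ‖q‖) ^ 2 * ‖q‖) ^ 2) = ‖q‖ ^ 2 * ‖p‖ ^ 2 - 2 * R ^ 2 * inner ℝ p q + R ^ 4 := by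
      field_simp
    rw [e2]
    have h1 : 0 < R ^ 2 - ‖p‖ ^ 2 := by nlinarith [norm_nonneg p]
    have h2 : 0 < R ^ 2 - ‖q‖ ^ 2 := by nlinarith [norm_nonneg q]
    nlinarith [mul_pos h1 h2]
  have hyz' := dist_pos.2 hyz
  have hyz'' := dist_pos.2 hne
  rw [reflKernel, invFactor, edist_dist, edist_dist, ENNReal.ofReal_rpow_of_pos hyz',
    ENNReal.ofReal_rpow_of_pos hyz'', ENNReal.ofReal_rpow_of_pos (by positivity),
    ← ENNReal.ofReal_mul (by positivity), ENNReal.ofReal_lt_ofReal_iff (by positivity)]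
  rw [Real.rpow_neg (by positivity), Real.rpow_neg (by positivity), ← div_eq_mul_inv,
    ← Real.div_rpow (by positivity) (by positivity), ← Real.inv_rpow (by positivity)]
  refine Real.rpow_lt_rpow (by positivity) ?_ ha
  rw [div_div, div_lt_iff₀ (by positivity)]
  field_simp
  linarith

/-- Comparison of a potential with its Kelvin transform inside the ball of inversion. -/
theorem rieszPot_le_add (hd : d ≠ 0) {a : ℝ} (ha : 0 < a) {c : E} {R : ℝ} (hR : 0 < R)
    {g : E → ℝ≥0∞} (hg : Measurable g) {y : E} (hy : y ∈ ball c R) (hyc : y ≠ c) :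
    rieszPot a g y ≤ kelvin a c R (rieszPot a g) y +
      ∫⁻ z in ball c R, edist y z ^ (-a) * (g z - kelvin (2 * d - a) c R g z) := by
  have hg' := measurable_kelvin (2 * d - a) c R hg
  rw [kelvin_rieszPot hd hR g hyc, rieszPot_kelvin_eq_setLIntegral_ball hd hR hg,
    rieszPot_eq_setLIntegral_ball hd hR hg, ← lintegral_add_right _ (by fun_prop)]
  refine setLIntegral_mono_ae' measurableSet_ball ?_
  filter_upwards [ae_ne hd c, ae_ne hd y] with z hzc hzy hz
  have hlt := reflKernel_lt ha hR hy hz hzc (Ne.symm hzy)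
  set P := edist y z ^ (-a)
  set Q := reflKernel a c R y z
  set g' := kelvin (2 * d - a) c R g z
  -- With `Q < P`: if `g z ≤ g'`, the larger kernel should multiply the larger density
  -- (rearrangement); otherwise the error term `P * (g z - g')` makes up the difference.
  rcases le_total (g z) g' with h | h
  · rw [tsub_eq_zero_of_le h, mul_zero, add_zero]
    obtain ⟨t, ht⟩ := exists_add_of_le h
    rw [ht, mul_add, mul_add]
    calc P * g z + (Q * g z + Q * t) ≤ P * g z + (Q * g z + P * t) := by gcongr
      _ = _ := by ring
  · obtain ⟨t, ht⟩ := exists_add_of_le h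
    rw [ht]
    rcases eq_or_ne g' ⊤ with h' | h'
    · have hP : P ≠ 0 := (zero_le.trans_lt hlt).ne'
      simp [h', ENNReal.mul_top hP]
    · rw [ENNReal.add_sub_cancel_left h', mul_add, mul_add]
      calc P * g' + P * t + Q * g' ≤ P * g' + P * t + Q * g' + Q * t := le_self_add
        _ = _ := by ring

/-- Strict comparison: a potential below its Kelvin transform touches it only if the densities
agree. -/
theorem rieszPot_le_kelvin (hd : d ≠ 0) {a : ℝ} (ha : 0 < a) {c : E} {R : ℝ} (hR : 0 < R)
    {g : E → ℝ≥0∞} (hg : Measurable g)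
    (hle : ∀ᵐ z, z ∈ ball c R → g z ≤ kelvin (2 * d - a) c R g z) {y : E} (hy : y ∈ ball c R)
    (hyc : y ≠ c) :
    rieszPot a g y ≤ kelvin a c R (rieszPot a g) y ∧
      (rieszPot a g y = kelvin a c R (rieszPot a g) y → rieszPot a g y ≠ ⊤ →
        ∀ᵐ z, z ∈ ball c R → g z = kelvin (2 * d - a) c R g z) := by
  have hg' := measurable_kelvin (2 * d - a) c R hg
  have hQ := measurable_reflKernel a c R y
  rw [kelvin_rieszPot hd hR g hyc, rieszPot_kelvin_eq_setLIntegral_ball hd hR hg,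
    rieszPot_eq_setLIntegral_ball hd hR hg]
  have hmono : ∀ᵐ z, z ∈ ball c R →
      edist y z ^ (-a) * g z + reflKernel a c R y z * kelvin (2 * d - a) c R g z ≤
      edist y z ^ (-a) * kelvin (2 * d - a) c R g z + reflKernel a c R y z * g z := by
    filter_upwards [ae_ne hd c, ae_ne hd y, hle] with z hzc hzy hgz hz
    have hlt := reflKernel_lt ha hR hy hz hzc (Ne.symm hzy)
    obtain ⟨t, ht⟩ := exists_add_of_le (hgz hz)
    rw [ht, mul_add, mul_add]
    calc _ ≤ edist y z ^ (-a) * g z + (reflKernel a c R y z * g z + edist y z ^ (-a) * t) := by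
          gcongr
      _ = _ := by ring
  refine ⟨setLIntegral_mono_ae' measurableSet_ball hmono, fun heq hfin => ?_⟩
  -- Equal finite integrals of ordered integrands force equality almost everywhere; writing the
  -- transform of `g` as `g z + t`, this becomes `Q * t = P * t` with `Q < P`, whence `t = 0`.
  have hae := ae_eq_of_ae_le_of_lintegral_le
    ((ae_restrict_iff' measurableSet_ball).2 hmono) hfin (by fun_prop) heq.ge
  have hfin' := ae_lt_top (by fun_prop) hfin
  rw [EventuallyEq, ae_restrict_iff' measurableSet_ball] at hae
  rw [ae_restrict_iff' measurableSet_ball] at hfin'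
  filter_upwards [ae_ne hd c, ae_ne hd y, hle, hae, hfin'] with z hzc hzy hgz hz1 hz2 hz
  have hlt := reflKernel_lt ha hR hy hz hzc (Ne.symm hzy)
  have h1 := hz1 hz
  have h2 := hz2 hz
  have h3 := hgz hz
  have hP : edist y z ^ (-a) ≠ ⊤ :=
    ENNReal.rpow_ne_top_of_ne_zero (edist_pos.2 (Ne.symm hzy)).ne' (edist_ne_top _ _)
  obtain ⟨t, ht⟩ := exists_add_of_le h3
  rw [ht] at h1 h2 ⊢
  set P := edist y z ^ (-a)
  set Q := reflKernel a c R y z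
  have hPg : P * g z + Q * g z ≠ ⊤ := by
    refine ne_top_of_le_ne_top h2.ne ?_
    gcongr
    exact le_self_add
  have h4 : Q * t = P * t := by
    refine (ENNReal.add_right_inj hPg).1 ?_
    calc P * g z + Q * g z + Q * t = P * g z + Q * (g z + t) := by ring
      _ = _ := h1
      _ = _ := by ring
  have ht : t = 0 := by
    by_contra h0
    have htop : t ≠ ⊤ := by
      rintro rfl
      have : P * ⊤ = (⊤ : ℝ≥0∞) := ENNReal.mul_top (zero_le.trans_lt hlt).ne'
      rw [this] at h4
      have hQ0 : Q * ⊤ = (⊤ : ℝ≥0∞) := h4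
      rw [mul_add, hQ0] at h2
      simp at h2
    exact (ENNReal.mul_lt_mul_left h0 htop hlt).ne h4
  rw [ht, add_zero]

end Inversion

/-! ### Hölder, Minkowski and absolute continuity for `lpn` -/

section Lpn

theorem lpn_mul_le {p q r : ℝ} (hp : 0 < p) (hpq : p < q) (hpqr : 1 / p = 1 / q + 1 / r)
    {f g : E → ℝ≥0∞} (hf : Measurable f) (hg : Measurable g) :
    lpn p (fun x => f x * g x) ≤ lpn q f * lpn r g :=
  ENNReal.lintegral_Lp_mul_le_Lq_mul_Lr hp hpq hpqr volume hf.aemeasurable hg.aemeasurable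

theorem lpn_add_le {p : ℝ} (hp : 1 ≤ p) {f g : E → ℝ≥0∞} (hf : Measurable f) (hg : Measurable g) :
    lpn p (fun x => f x + g x) ≤ lpn p f + lpn p g :=
  ENNReal.lintegral_Lp_add_le hf.aemeasurable hg.aemeasurable hp

theorem lpn_const_mul {p : ℝ} (hp : 0 < p) {k : ℝ≥0∞} (hk : k ≠ ⊤) (f : E → ℝ≥0∞) :
    lpn p (fun x => k * f x) = k * lpn p f := by
  unfold lpn
  simp_rw [ENNReal.mul_rpow_of_nonneg _ _ hp.le]
  rw [lintegral_const_mul' _ _ (ENNReal.rpow_ne_top_of_nonneg hp.le hk),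
    ENNReal.mul_rpow_of_nonneg _ _ (by positivity), ← ENNReal.rpow_mul, mul_one_div_cancel hp.ne',
    ENNReal.rpow_one]

theorem lpn_indicator {p : ℝ} (hp : 0 < p) {s : Set E} (hs : MeasurableSet s) (f : E → ℝ≥0∞) :
    lpn p (s.indicator f) = (∫⁻ x in s, f x ^ p) ^ (1 / p) := by
  unfold lpn
  rw [← lintegral_indicator hs]
  congr 2
  ext x
  by_cases hx : x ∈ s
  · simp [hx]
  · simp [hx, hp]

theorem lpn_ne_top_iff {p : ℝ} (hp : 0 < p) {f : E → ℝ≥0∞} :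
    lpn p f ≠ ⊤ ↔ ∫⁻ x, f x ^ p ≠ ⊤ := by
  unfold lpn
  rw [Ne, ENNReal.rpow_eq_top_iff_of_pos (by positivity)]

theorem ae_eq_zero_of_lpn_eq_zero {p : ℝ} (hp : 0 < p) {f : E → ℝ≥0∞} (hf : Measurable f)
    (h : lpn p f = 0) : ∀ᵐ x, f x = 0 := by
  have h := (ENNReal.rpow_eq_zero_iff_of_pos (by positivity)).1 h
  rw [lintegral_eq_zero_iff (by fun_prop)] at h
  filter_upwards [h] with x hx
  exact (ENNReal.rpow_eq_zero_iff_of_pos hp).1 hx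

theorem ae_lt_top_of_lpn_ne_top {p : ℝ} (hp : 0 < p) {f : E → ℝ≥0∞} (hf : Measurable f)
    (h : lpn p f ≠ ⊤) : ∀ᵐ x, f x < ⊤ := by
  filter_upwards [ae_lt_top (by fun_prop) ((lpn_ne_top_iff hp).1 h)] with x hx
  exact (ENNReal.rpow_lt_top_iff_of_pos hp).1 hx

/-- Absolute continuity of the integral, at threshold `(ε / (k + 1)) ^ p`; the `+ 1` avoids division
by zero. -/
theorem exists_lpn_indicator_lt {p : ℝ} (hp : 0 < p) {f : E → ℝ≥0∞} (h : lpn p f ≠ ⊤)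
    {k : ℝ≥0∞} (hk : k ≠ ⊤) {ε : ℝ≥0∞} (hε : ε ≠ 0) :
    ∃ δ > 0, ∀ s : Set E, MeasurableSet s → volume s < δ → k * lpn p (s.indicator f) ≤ ε := by
  have hk1 : k + 1 ≠ ⊤ := ENNReal.add_ne_top.2 ⟨hk, ENNReal.one_ne_top⟩
  have hpos : (ε / (k + 1)) ^ p ≠ 0 :=
    (ENNReal.rpow_pos_of_nonneg (ENNReal.div_pos hε hk1) hp.le).ne'
  obtain ⟨δ, hδ, hs⟩ := exists_pos_setLIntegral_lt_of_measure_lt ((lpn_ne_top_iff hp).1 h) hpos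
  refine ⟨δ, hδ, fun s hms hvs => ?_⟩
  rw [lpn_indicator hp hms]
  calc k * (∫⁻ x in s, f x ^ p) ^ (1 / p) ≤ (k + 1) * ((ε / (k + 1)) ^ p) ^ (1 / p) := by
        gcongr
        · exact le_self_add
        · exact (hs s hvs).le
    _ = ε := by
        rw [← ENNReal.rpow_mul, mul_one_div_cancel hp.ne', ENNReal.rpow_one,
          ENNReal.mul_div_cancel (by simp) hk1]

end Lpn

/-! ### The integral system and its comparison estimates -/

section System

/-- Positive finite-energy solutions of `u = C |x|^{2-d} * ((|x|⁻⁴ * u²) u)`. -/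
structure IsHartreeSystem (C : ℝ≥0∞) (u : E → ℝ≥0∞) : Prop where
  five_le : 5 ≤ d
  const_ne_zero : C ≠ 0
  const_ne_top : C ≠ ⊤
  measurable : Measurable u
  eq : ∀ x, u x = C * rieszPot ((d : ℝ) - 2) (fun y => rieszPot 4 (fun z => u z ^ 2) y * u y) x
  lpn_ne_top : lpn (2 * d / (d - 2)) u ≠ ⊤
  pos : ∀ᵐ x, 0 < u x

variable {C : ℝ≥0∞} {u : EuclideanSpace ℝ (Fin d) → ℝ≥0∞}

theorem five_le_cast (hd : 5 ≤ d) : (5 : ℝ) ≤ d := by exact_mod_cast hd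

/-- The Hardy–Littlewood–Sobolev inequality for the Hartree potential. -/
theorem exists_lpn_rieszPot_four_le (hd : 5 ≤ d) : ∃ K : ℝ≥0∞, K ≠ ⊤ ∧ ∀ g : E → ℝ≥0∞,
    AEMeasurable g → lpn (d / 2) (rieszPot 4 g) ≤ K * lpn (d / (d - 2)) g := by
  have hd5 := five_le_cast hd
  have h2 : (0 : ℝ) < d - 2 := by linarith
  obtain ⟨K, hK, -, h⟩ := lpn_rieszPot_le (d := d) (a := 4) (r := d / (d - 2)) (q := d / 2)
    (by omega) (by norm_num) (by linarith) (by rw [lt_div_iff₀ h2]; linarith)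
    (by rw [div_lt_div_iff₀ h2 two_pos]; nlinarith) (by field_simp; ring)
  exact ⟨K, hK, h⟩

/-- The exponent `2 d / (d + 2)` is where Hölder puts the product of a potential in `L^(d/2)` and a
solution in `L^(2d/(d-2))`, so the system maps its space to itself. -/
theorem exists_lpn_rieszPot_sub_two_le (hd : 5 ≤ d) : ∃ K : ℝ≥0∞, K ≠ ⊤ ∧ ∀ g : E → ℝ≥0∞,
    AEMeasurable g → lpn (2 * d / (d - 2)) (rieszPot ((d : ℝ) - 2) g) ≤
      K * lpn (2 * d / (d + 2)) g := by
  have hd5 := five_le_cast hd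
  have h2 : (0 : ℝ) < d - 2 := by linarith
  have h3 : (0 : ℝ) < d + 2 := by linarith
  obtain ⟨K, hK, -, h⟩ := lpn_rieszPot_le (d := d) (a := (d : ℝ) - 2) (r := 2 * d / (d + 2))
    (q := 2 * d / (d - 2))
    (by omega) h2 (by linarith) (by rw [lt_div_iff₀ h3]; linarith)
    (by rw [div_lt_div_iff₀ h3 h2]; nlinarith) (by field_simp; ring)
  exact ⟨K, hK, h⟩

theorem lpn_sq_eq (hd : 5 ≤ d) (u : E → ℝ≥0∞) :
    lpn (d / (d - 2)) (fun x => u x ^ 2) = lpn (2 * d / (d - 2)) u ^ 2 := by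
  have hd5 := five_le_cast hd
  have h2 : (0 : ℝ) < d - 2 := by linarith
  unfold lpn
  rw [← ENNReal.rpow_natCast, ← ENNReal.rpow_mul]
  have : ∀ x, (u x ^ 2) ^ ((d : ℝ) / (d - 2)) = u x ^ (2 * (d : ℝ) / (d - 2)) := by
    intro x
    rw [← ENNReal.rpow_natCast, ← ENNReal.rpow_mul]
    congr 1; push_cast; ring
  simp_rw [this]
  congr 1
  push_cast
  field_simp

theorem lpn_rieszPot_four_sq_ne_top (hd : 5 ≤ d) (hm : AEMeasurable u)
    (hu : lpn (2 * d / (d - 2)) u ≠ ⊤) :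
    lpn (d / 2) (rieszPot 4 (fun z => u z ^ 2)) ≠ ⊤ := by
  obtain ⟨K, hK, h⟩ := exists_lpn_rieszPot_four_le hd
  refine ne_top_of_le_ne_top ?_ (h _ (hm.pow_const 2))
  rw [lpn_sq_eq hd]
  finiteness

namespace IsHartreeSystem

/-- The potential of a solution. -/
abbrev pot (u : E → ℝ≥0∞) : E → ℝ≥0∞ := rieszPot 4 (fun z => u z ^ 2)

theorem measurable_pot (h : IsHartreeSystem C u) : Measurable (pot u) :=
  (lowerSemicontinuous_rieszPot _ (h.measurable.pow_const 2).aemeasurable).measurable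

/-- The equation holds at every point, and potentials of nonnegative functions are lower
semicontinuous. -/
theorem lowerSemicontinuous (h : IsHartreeSystem C u) : LowerSemicontinuous u := by
  have h1 := (lowerSemicontinuous_rieszPot ((d : ℝ) - 2)
    (h.measurable_pot.mul h.measurable).aemeasurable).ennreal_mul_const C
  have : u = fun x => rieszPot ((d : ℝ) - 2) (pot u * u) x * C := by
    ext x
    rw [h.eq x, mul_comm]
    rfl
  rw [this]
  exact h1

theorem lpn_pot_ne_top (h : IsHartreeSystem C u) : lpn (d / 2) (pot u) ≠ ⊤ :=
  lpn_rieszPot_four_sq_ne_top h.five_le h.measurable.aemeasurable h.lpn_ne_top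

theorem ae_lt_top (h : IsHartreeSystem C u) : ∀ᵐ x, u x < ⊤ := by
  have hd5 := five_le_cast h.five_le
  have h2 : (0 : ℝ) < d - 2 := by linarith
  exact ae_lt_top_of_lpn_ne_top (by positivity) h.measurable h.lpn_ne_top

theorem ae_pot_lt_top (h : IsHartreeSystem C u) : ∀ᵐ x, pot u x < ⊤ := by
  have hd5 := five_le_cast h.five_le
  exact ae_lt_top_of_lpn_ne_top (by positivity) h.measurable_pot h.lpn_pot_ne_top

theorem pot_pos (h : IsHartreeSystem C u) (x : E) : pot u x ≠ 0 :=
  rieszPot_ne_zero four_pos (h.measurable.pow_const 2).aemeasurable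
    (h.pos.mono fun _ hx => ENNReal.pow_pos hx 2) x

/-- The reflection of a solution in a sphere. -/
abbrev refl (c : E) (R : ℝ) (u : E → ℝ≥0∞) : E → ℝ≥0∞ := kelvin ((d : ℝ) - 2) c R u

theorem measurable_refl (h : IsHartreeSystem C u) (c : E) (R : ℝ) : Measurable (refl c R u) :=
  measurable_kelvin _ _ _ h.measurable

/-- The weight of `u²` is twice `d - 2`, which is the weight `2 d - 4` dual to the kernel `|x|⁻⁴`.
This coincidence, with the one in `kelvin_pot_mul`, is the conformal invariance of the equation. -/
theorem kelvin_sq (c : E) (R : ℝ) (u : E → ℝ≥0∞) (y : E) :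
    kelvin (2 * d - 4) c R (fun z => u z ^ 2) y = refl c R u y ^ 2 := by
  have := kelvin_rpow (b := (d : ℝ) - 2) (p := 2) zero_le_two c R u y
  simp only [ENNReal.rpow_two] at this
  rw [this]
  congr 1
  ring

/-- The weights add up: `4 + (d - 2) = 2 d - (d - 2)`, dual to the Newtonian kernel. -/
theorem kelvin_pot_mul {c : E} {R : ℝ} (hR : 0 < R) (u : E → ℝ≥0∞) {y : E} (hy : y ≠ c) :
    kelvin (2 * d - ((d : ℝ) - 2)) c R (fun z => pot u z * u z) y =
      kelvin 4 c R (pot u) y * refl c R u y := by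
  rw [← kelvin_mul hR _ _ hy]
  congr 1
  ring

theorem refl_eq (h : IsHartreeSystem C u) (c : E) (R : ℝ) (y : E) :
    refl c R u y = C * kelvin ((d : ℝ) - 2) c R
      (rieszPot ((d : ℝ) - 2) (fun y => pot u y * u y)) y := by
  simp only [refl, kelvin]
  rw [h.eq (EuclideanGeometry.inversion c R y)]
  ring

/-- Points of the ball at which a solution exceeds its reflection. -/
def badSet (c : E) (R : ℝ) (u : E → ℝ≥0∞) : Set E := {y ∈ ball c R | refl c R u y < u y}

theorem measurableSet_badSet (h : IsHartreeSystem C u) (c : E) (R : ℝ) :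
    MeasurableSet (badSet c R u) :=
  measurableSet_ball.inter (measurableSet_lt (h.measurable_refl c R) h.measurable)

/-- Only points where `u` exceeds its reflection `U` contribute to the error term of
`rieszPot_le_add`, and there `u² - U² ≤ 2 u (u - U)`. Differences in `ℝ≥0∞` are truncated, so they
act as positive parts. -/
theorem sub_pot_le (h : IsHartreeSystem C u) {c : E} {R : ℝ} (hR : 0 < R) {y : E}
    (hy : y ∈ ball c R) (hyc : y ≠ c) :
    pot u y - kelvin 4 c R (pot u) y ≤ rieszPot 4 (fun z => 2 * ((badSet c R u).indicator u z *
      (ball c R).indicator (fun y => u y - refl c R u y) z)) y := by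
  have hd : d ≠ 0 := by have := h.five_le; omega
  rw [tsub_le_iff_left]
  refine (rieszPot_le_add hd (by norm_num) hR (h.measurable.pow_const 2) hy hyc).trans ?_
  gcongr
  rw [← lintegral_indicator measurableSet_ball]
  refine lintegral_mono fun z => ?_
  by_cases hz : z ∈ ball c R
  · rw [indicator_of_mem hz]
    gcongr
    rw [kelvin_sq]
    by_cases hb : z ∈ badSet c R u
    · beta_reduce
      rw [indicator_of_mem hb, indicator_of_mem hz, tsub_le_iff_left]
      have hle : u z ≤ refl c R u z + (u z - refl c R u z) := le_add_tsub
      have hle2 := hb.2.le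
      set w := u z - refl c R u z
      set U := refl c R u z
      calc u z ^ 2 = u z * u z := sq _
        _ ≤ u z * (U + w) := by gcongr
        _ = U * u z + u z * w := by ring
        _ ≤ U * (U + w) + u z * w := by gcongr
        _ = U ^ 2 + (U * w + u z * w) := by ring
        _ ≤ U ^ 2 + (u z * w + u z * w) := by gcongr
        _ = _ := by ring
    · have : u z ≤ refl c R u z := by
        by_contra hcon
        exact hb ⟨hz, not_le.1 hcon⟩
      rw [tsub_eq_zero_of_le (by gcongr)]
      exact zero_le
  · rw [indicator_of_notMem hz]
    exact zero_le

/-- Write `V'` for the Kelvin transform of `V = pot u` and `U` for the reflection of `u`. Then `V u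
- V' U` splits into `V (u - U)`, present only on the bad set, and `u (V - V')`. -/
theorem sub_refl_le (h : IsHartreeSystem C u) {c : E} {R : ℝ} (hR : 0 < R) {y : E}
    (hy : y ∈ ball c R) (hyc : y ≠ c) :
    u y - refl c R u y ≤ C * rieszPot ((d : ℝ) - 2) (fun z =>
      (badSet c R u).indicator (pot u) z *
        (ball c R).indicator (fun y => u y - refl c R u y) z +
      u z * (ball c R).indicator (fun y => pot u y - kelvin 4 c R (pot u) y) z) y := by
  have hd5 := five_le_cast h.five_le
  have hd : d ≠ 0 := by have := h.five_le; omega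
  rw [tsub_le_iff_left, h.refl_eq]
  nth_rw 1 [h.eq y]
  rw [← mul_add]
  gcongr
  refine (rieszPot_le_add (g := fun z => pot u z * u z) hd (by linarith) hR
    (h.measurable_pot.mul h.measurable) hy hyc).trans ?_
  gcongr
  rw [← lintegral_indicator measurableSet_ball]
  refine lintegral_mono_ae ?_
  filter_upwards [ae_ne hd c] with z hzc
  by_cases hz : z ∈ ball c R
  · rw [indicator_of_mem hz, indicator_of_mem hz, indicator_of_mem hz]
    gcongr
    have e := kelvin_pot_mul hR u hzc
    rw [e, tsub_le_iff_left]
    have hV : pot u z ≤ kelvin 4 c R (pot u) z + (pot u z - kelvin 4 c R (pot u) z) := le_add_tsub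
    have hu : u z ≤ refl c R u z + (u z - refl c R u z) := le_add_tsub
    have hle : ∀ U : ℝ≥0∞, U ≤ u z → U ≤ refl c R u z → pot u z * U ≤
        kelvin 4 c R (pot u) z * refl c R u z +
          u z * (pot u z - kelvin 4 c R (pot u) z) := by
      intro U h1 h2
      calc pot u z * U ≤ (kelvin 4 c R (pot u) z + (pot u z - kelvin 4 c R (pot u) z)) * U := by
            gcongr
        _ = kelvin 4 c R (pot u) z * U + U * (pot u z - kelvin 4 c R (pot u) z) := by ring
        _ ≤ _ := by gcongr
    by_cases hb : z ∈ badSet c R u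
    · rw [indicator_of_mem hb]
      calc pot u z * u z ≤ pot u z * (refl c R u z + (u z - refl c R u z)) := by gcongr
        _ = pot u z * refl c R u z + pot u z * (u z - refl c R u z) := by ring
        _ ≤ (kelvin 4 c R (pot u) z * refl c R u z +
          u z * (pot u z - kelvin 4 c R (pot u) z)) + pot u z * (u z - refl c R u z) := by
            gcongr
            exact hle _ hb.2.le le_rfl
        _ = _ := by ring
    · have : u z ≤ refl c R u z := by
        by_contra hcon
        exact hb ⟨hz, not_le.1 hcon⟩
      refine (hle _ le_rfl this).trans ?_
      gcongr
      exact le_add_self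
  · rw [indicator_of_notMem hz]
    exact zero_le

theorem measurable_indicator_sub_refl (h : IsHartreeSystem C u) (c : E) (R : ℝ) :
    Measurable ((ball c R).indicator fun y => u y - refl c R u y) :=
  (h.measurable.sub (h.measurable_refl c R)).indicator measurableSet_ball

theorem measurable_indicator_sub_pot (h : IsHartreeSystem C u) (c : E) (R : ℝ) :
    Measurable ((ball c R).indicator fun y => pot u y - kelvin 4 c R (pot u) y) :=
  (h.measurable_pot.sub (measurable_kelvin _ _ _ h.measurable_pot)).indicator measurableSet_ball

theorem lpn_sub_pot_le (h : IsHartreeSystem C u) {K : ℝ≥0∞}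
    (hK : ∀ g : E → ℝ≥0∞, AEMeasurable g →
      lpn (d / 2) (rieszPot 4 g) ≤ K * lpn (d / (d - 2)) g)
    (c : E) {R : ℝ} (hR : 0 < R) :
    lpn (d / 2) ((ball c R).indicator fun y => pot u y - kelvin 4 c R (pot u) y) ≤
      K * (2 * (lpn (2 * d / (d - 2)) ((badSet c R u).indicator u) *
        lpn (2 * d / (d - 2)) ((ball c R).indicator fun y => u y - refl c R u y))) := by
  have hd5 := five_le_cast h.five_le
  have hd : d ≠ 0 := by have := h.five_le; omega
  have h2 : (0 : ℝ) < d - 2 := by linarith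
  have hn : (0 : ℝ) < d / (d - 2) := by positivity
  have hmuS := h.measurable.indicator (h.measurableSet_badSet c R)
  have hmw := h.measurable_indicator_sub_refl c R
  have h1 : lpn (d / (d - 2)) (fun z => (badSet c R u).indicator u z *
      (ball c R).indicator (fun y => u y - refl c R u y) z) ≤ _ :=
    lpn_mul_le (q := 2 * d / (d - 2)) (r := 2 * d / (d - 2)) hn
      (by rw [div_lt_div_iff₀ h2 h2]; nlinarith) (by field_simp; ring) hmuS hmw
  refine le_trans (lpn_mono (by positivity) ?_) ((hK (fun z => 2 * ((badSet c R u).indicator u z *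
      (ball c R).indicator (fun y => u y - refl c R u y) z)) ?_).trans ?_)
  · filter_upwards [ae_ne hd c] with y hyc
    by_cases hy : y ∈ ball c R
    · rw [indicator_of_mem hy]
      exact h.sub_pot_le hR hy hyc
    · rw [indicator_of_notMem hy]
      exact zero_le
  · exact ((hmuS.mul hmw).const_mul 2).aemeasurable
  · rw [lpn_const_mul hn (by simp)]
    exact mul_le_mul_right (mul_le_mul_right h1 _) _

theorem lpn_sub_refl_le (h : IsHartreeSystem C u) {K : ℝ≥0∞}
    (hK : ∀ g : E → ℝ≥0∞, AEMeasurable g → lpn (2 * d / (d - 2)) (rieszPot ((d : ℝ) - 2) g) ≤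
      K * lpn (2 * d / (d + 2)) g)
    (c : E) {R : ℝ} (hR : 0 < R) :
    lpn (2 * d / (d - 2)) ((ball c R).indicator fun y => u y - refl c R u y) ≤
      C * (K * (lpn (d / 2) ((badSet c R u).indicator (pot u)) *
        lpn (2 * d / (d - 2)) ((ball c R).indicator fun y => u y - refl c R u y) +
        lpn (2 * d / (d - 2)) u *
          lpn (d / 2) ((ball c R).indicator fun y => pot u y - kelvin 4 c R (pot u) y))) := by
  have hd5 := five_le_cast h.five_le
  have hd : d ≠ 0 := by have := h.five_le; omega
  have h2 : (0 : ℝ) < d - 2 := by linarith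
  have hp : (0 : ℝ) < 2 * d / (d - 2) := by positivity
  have hl : (1 : ℝ) ≤ 2 * d / (d + 2) := by
    rw [le_div_iff₀ (by positivity)]; linarith
  have hmu := h.measurable
  have hmpS := h.measurable_pot.indicator (h.measurableSet_badSet c R)
  have hmw := h.measurable_indicator_sub_refl c R
  have hmv := h.measurable_indicator_sub_pot c R
  have h1 : lpn (2 * d / (d + 2)) (fun z => (badSet c R u).indicator (pot u) z *
      (ball c R).indicator (fun y => u y - refl c R u y) z) ≤ _ :=
    lpn_mul_le (q := d / 2) (r := 2 * d / (d - 2)) (by positivity)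
      (by rw [div_lt_div_iff₀ (by positivity) two_pos]; nlinarith) (by field_simp; ring) hmpS hmw
  have h2' : lpn (2 * d / (d + 2)) (fun z => u z *
      (ball c R).indicator (fun y => pot u y - kelvin 4 c R (pot u) y) z) ≤ _ :=
    lpn_mul_le (q := 2 * d / (d - 2)) (r := d / 2) (by positivity)
      (by rw [div_lt_div_iff₀ (by positivity) h2]; nlinarith) (by field_simp; ring) hmu hmv
  refine le_trans (lpn_mono (h := fun y => C * rieszPot ((d : ℝ) - 2) (fun z =>
      (badSet c R u).indicator (pot u) z *
        (ball c R).indicator (fun y => u y - refl c R u y) z +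
      u z * (ball c R).indicator (fun y => pot u y - kelvin 4 c R (pot u) y) z) y) hp ?_) ?_
  · filter_upwards [ae_ne hd c] with y hyc
    by_cases hy : y ∈ ball c R
    · rw [indicator_of_mem hy]
      exact h.sub_refl_le hR hy hyc
    · rw [indicator_of_notMem hy]
      exact zero_le
  · rw [lpn_const_mul hp h.const_ne_top]
    refine mul_le_mul_right ((hK _ ((hmpS.mul hmw).add (hmu.mul hmv)).aemeasurable).trans ?_) _
    exact mul_le_mul_right ((lpn_add_le hl (hmpS.mul hmw) (hmu.mul hmv)).trans
      (add_le_add h1 h2')) _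

/-- A solution lies below its reflection as soon as the exceptional set is small. -/
theorem exists_ae_le_refl_of_volume_lt (h : IsHartreeSystem C u) :
    ∃ η : ℝ≥0∞, 0 < η ∧ ∀ (c : E) (R : ℝ), 0 < R → volume (badSet c R u) < η →
      ∀ᵐ y, y ∈ ball c R → u y ≤ refl c R u y := by
  have hd5 := five_le_cast h.five_le
  have h2 : (0 : ℝ) < d - 2 := by linarith
  have hp : (0 : ℝ) < 2 * d / (d - 2) := by positivity
  obtain ⟨K₁, hK₁, hls₁⟩ := exists_lpn_rieszPot_four_le h.five_le
  obtain ⟨K₂, hK₂, hls₂⟩ := exists_lpn_rieszPot_sub_two_le h.five_le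
  have hNt := h.lpn_ne_top
  have hCt := h.const_ne_top
  -- The two thresholds make each coefficient in the combined estimate for the norm `W` of the
  -- excess at most `1 / 4`, so that `W ≤ W / 2`.
  obtain ⟨δ₁, hδ₁, hs₁⟩ := exists_lpn_indicator_lt (p := d / 2) (by positivity) h.lpn_pot_ne_top
    (k := C * K₂) (by finiteness) (ε := 1 / 4) (by simp)
  obtain ⟨δ₂, hδ₂, hs₂⟩ := exists_lpn_indicator_lt hp h.lpn_ne_top
    (k := C * K₂ * lpn (2 * d / (d - 2)) u * K₁ * 2) (by finiteness) (ε := 1 / 4) (by simp)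
  refine ⟨min δ₁ δ₂, lt_min hδ₁ hδ₂, fun c R hR hvol => ?_⟩
  have hS := h.measurableSet_badSet c R
  have a₁ := hs₁ _ hS (hvol.trans_le (min_le_left _ _))
  have a₂ := hs₂ _ hS (hvol.trans_le (min_le_right _ _))
  have hmw := h.measurable_indicator_sub_refl c R
  have hv1 := h.lpn_sub_pot_le hls₁ c hR
  have hw1 := h.lpn_sub_refl_le hls₂ c hR
  -- Absorbing `W / 2` on the left requires `W` to be finite.
  have hWt : lpn (2 * d / (d - 2)) ((ball c R).indicator fun y => u y - refl c R u y) ≠ ⊤ := by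
    refine ne_top_of_le_ne_top hNt (lpn_mono hp (Eventually.of_forall fun y => ?_))
    exact (indicator_le_self _ _ y).trans tsub_le_self
  have hW0 : lpn (2 * d / (d - 2)) ((ball c R).indicator fun y => u y - refl c R u y) = 0 := by
    generalize lpn (2 * d / (d - 2)) ((ball c R).indicator fun y => u y - refl c R u y) = W at *
    generalize lpn (d / 2) ((ball c R).indicator fun y => pot u y - kelvin 4 c R (pot u) y) = Z at *
    generalize lpn (d / 2) ((badSet c R u).indicator (pot u)) = A at *
    generalize lpn (2 * d / (d - 2)) ((badSet c R u).indicator u) = B at *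
    generalize lpn (2 * d / (d - 2)) u = N at *
    have hw2 : W ≤ 1 / 2 * W := by
      calc W ≤ C * (K₂ * (A * W + N * Z)) := hw1
        _ ≤ C * (K₂ * (A * W + N * (K₁ * (2 * (B * W))))) := by gcongr
        _ = (C * K₂ * A + C * K₂ * N * K₁ * 2 * B) * W := by ring
        _ ≤ (1 / 4 + 1 / 4) * W := by gcongr
        _ = _ := by
          congr 1
          rw [show (1 / 4 : ℝ≥0∞) = 1 / 2 / 2 by
            rw [ENNReal.div_eq_inv_mul (a := 1 / 2), one_div, one_div,
              ← ENNReal.mul_inv (by simp) (by simp)]; norm_num, ENNReal.add_halves]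
    by_contra h0
    refine absurd hw2 (not_le.2 ?_)
    rw [one_div, ← ENNReal.div_eq_inv_mul]
    exact ENNReal.half_lt_self h0 hWt
  filter_upwards [ae_eq_zero_of_lpn_eq_zero hp hmw hW0] with y hy hyb
  rw [indicator_of_mem hyb] at hy
  exact tsub_eq_zero_iff_le.1 hy

end IsHartreeSystem
end System

/-! ### Moving spheres -/

section MovingSpheres

open EuclideanGeometry (inversion)

/-- The Kelvin transform is lower semicontinuous in the radius of inversion. -/
theorem eventually_lt_kelvin (b : ℝ) {c y : E} {R : ℝ} (hR : 0 < R) (hy : y ≠ c) {u : E → ℝ≥0∞}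
    (hu : LowerSemicontinuous u) {t : ℝ≥0∞} (ht : t < kelvin b c R u y) :
    ∀ᶠ R' in 𝓝 R, t < kelvin b c R' u y := by
  have ha0 := invFactor_rpow_ne_zero hR hy b
  have hat := invFactor_rpow_ne_top hR hy b
  have hpos : 0 < R / dist y c := div_pos hR (dist_pos.2 hy)
  have hcont : ContinuousAt (fun R' => invFactor c R' y ^ b) R := by
    have h1 : (fun R' => ENNReal.ofReal ((R' / dist y c) ^ b)) =ᶠ[𝓝 R]
        fun R' => invFactor c R' y ^ b := by
      filter_upwards [lt_mem_nhds hR] with R' hR'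
      rw [invFactor, ENNReal.ofReal_rpow_of_pos (div_pos hR' (dist_pos.2 hy))]
    refine ContinuousAt.congr ?_ h1
    refine ENNReal.continuous_ofReal.continuousAt.comp ?_
    exact ContinuousAt.rpow_const (by fun_prop) (Or.inl hpos.ne')
  have hcont2 : ContinuousAt (fun R' => inversion c R' y) R := by
    refine ContinuousAt.inversion continuousAt_const continuousAt_id continuousAt_const hy
  have h1 : t / invFactor c R y ^ b < u (inversion c R y) := by
    rw [ENNReal.div_lt_iff (Or.inl ha0) (Or.inl hat), mul_comm]
    exact ht
  -- The intermediate `s` separates the two effects: the conformal factor is continuous in the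
  -- radius, and `u` stays above `s` near the reflected point.
  obtain ⟨s, hs1, hs2⟩ := exists_between h1
  have h2 : t < invFactor c R y ^ b * s := by
    rw [ENNReal.div_lt_iff (Or.inl ha0) (Or.inl hat), mul_comm] at hs1
    exact hs1
  have h3 : ContinuousAt (fun R' => invFactor c R' y ^ b * s) R :=
    ENNReal.Tendsto.mul_const hcont (Or.inr hs2.ne_top)
  filter_upwards [h3.eventually_const_lt h2, hcont2.eventually (hu _ s hs2)] with R' h4 h5
  exact h4.trans_le (mul_le_mul_right h5.le _)

namespace IsHartreeSystem

variable {C : ℝ≥0∞} {u : EuclideanSpace ℝ (Fin d) → ℝ≥0∞}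

theorem ne_zero (h : IsHartreeSystem C u) : d ≠ 0 := by have := h.five_le; omega

theorem two_lt (h : IsHartreeSystem C u) : (2 : ℝ) < d := by
  have := five_le_cast h.five_le; linarith

theorem exponent_pos (h : IsHartreeSystem C u) : (0 : ℝ) < 2 * d / (d - 2) := by
  have := h.two_lt
  have h2 : (0 : ℝ) < d - 2 := by linarith
  positivity

/-- The reflection preserves the critical density. -/
theorem refl_rpow (h : IsHartreeSystem C u) (c : E) (R : ℝ) (y : E) :
    refl c R u y ^ (2 * d / (d - 2) : ℝ) =
      kelvin (2 * d) c R (fun x => u x ^ (2 * d / (d - 2) : ℝ)) y := by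
  have := h.two_lt
  have h2 : (d : ℝ) - 2 ≠ 0 := by linarith
  rw [refl, kelvin_rpow h.exponent_pos.le, mul_div_cancel₀ _ h2]

/-- Reflecting the inequality moves it outside the ball and exchanges its two sides. -/
theorem ae_le_refl_iff (h : IsHartreeSystem C u) {c : E} {R : ℝ} (hR : 0 < R) :
    (∀ᵐ y, y ∈ ball c R → u y ≤ refl c R u y) →
      ∀ᵐ y, y ∉ closedBall c R → refl c R u y ≤ u y := by
  intro hle
  filter_upwards [ae_comp_inversion h.ne_zero hR hle, ae_ne h.ne_zero c] with y hy hyc hyR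
  rw [mem_closedBall, not_le] at hyR
  have hmem : inversion c R y ∈ ball c R := by
    rw [mem_ball, EuclideanGeometry.dist_inversion_center, div_lt_iff₀ (dist_pos.2 hyc), sq]
    gcongr
  calc refl c R u y ≤ kelvin ((d : ℝ) - 2) c R (refl c R u) y := by
        rw [refl, kelvin]
        exact mul_le_mul_right (hy hmem) _
    _ = u y := kelvin_kelvin hR u hyc

theorem ae_eq_refl_of_ball (h : IsHartreeSystem C u) {c : E} {R : ℝ} (hR : 0 < R)
    (heq : ∀ᵐ y, y ∈ ball c R → u y = refl c R u y) : u =ᵐ[volume] refl c R u := by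
  have hsph : ∀ᵐ z : E, z ∉ sphere c R := by
    have : Nonempty (Fin d) := ⟨⟨0, Nat.pos_of_ne_zero h.ne_zero⟩⟩
    exact measure_eq_zero_iff_ae_notMem.1 (Measure.addHaar_sphere volume c R)
  filter_upwards [heq, ae_comp_inversion h.ne_zero (c := c) hR heq, ae_ne h.ne_zero c, hsph]
    with y h1 h2 hyc hys
  by_cases hy : y ∈ ball c R
  · exact h1 hy
  have hmem : inversion c R y ∈ ball c R := by
    rw [mem_ball, EuclideanGeometry.dist_inversion_center, div_lt_iff₀ (dist_pos.2 hyc), sq]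
    have : R < dist y c := lt_of_le_of_ne (not_lt.1 hy) (Ne.symm hys)
    gcongr
  calc u y = kelvin ((d : ℝ) - 2) c R (refl c R u) y := (kelvin_kelvin hR u hyc).symm
    _ = refl c R u y := congrArg (invFactor c R y ^ ((d : ℝ) - 2) * ·) (h2 hmem).symm

/-- The bad set lies in the ball, whose volume tends to `0` with the radius. -/
theorem exists_small_radius (h : IsHartreeSystem C u) (c : E) :
    ∃ R₀ > 0, ∀ R, 0 < R → R ≤ R₀ → ∀ᵐ y, y ∈ ball c R → u y ≤ refl c R u y := by
  obtain ⟨η, hη, hs⟩ := h.exists_ae_le_refl_of_volume_lt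
  have hlim : Tendsto (fun R : ℝ => ENNReal.ofReal (R ^ d) * volume (ball (0 : E) 1)) (𝓝 0)
      (𝓝 0) := by
    have h1 : Tendsto (fun R : ℝ => ENNReal.ofReal (R ^ d)) (𝓝 0) (𝓝 0) := by
      have : Continuous fun R : ℝ => ENNReal.ofReal (R ^ d) :=
        ENNReal.continuous_ofReal.comp (continuous_pow d)
      have h2 := this.tendsto 0
      rwa [zero_pow h.ne_zero, ENNReal.ofReal_zero] at h2
    have h3 := ENNReal.Tendsto.mul_const h1 (Or.inr (volume_unitBall_ne_top (d := d)))
    rwa [zero_mul] at h3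
  obtain ⟨ε, hε, hball⟩ := Metric.eventually_nhds_iff.1 (hlim.eventually_lt_const hη)
  refine ⟨ε / 2, by positivity, fun R hR hRε => hs c R hR ?_⟩
  refine (measure_mono (sep_subset _ _)).trans_lt ?_
  rw [volume_ball_eq c hR]
  refine hball ?_
  rw [Real.dist_eq, sub_zero, abs_of_pos hR]
  linarith

/-- If `u` lay below its reflection, the ball would carry no more of the integral of `u^(2d/(d-2))`
than its complement. This is impossible for a ball carrying more than half of that finite, nonzero
integral. -/
theorem not_ae_le_refl_of_large (h : IsHartreeSystem C u) (c : E) :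
    ∃ R₁ : ℝ, ∀ R, 0 < R → R₁ ≤ R → ¬ ∀ᵐ y, y ∈ ball c R → u y ≤ refl c R u y := by
  have hp := h.exponent_pos
  set p : ℝ := 2 * d / (d - 2) with hpd
  have hm := h.measurable
  have hT : ∫⁻ x, u x ^ p ≠ ⊤ := (lpn_ne_top_iff hp).1 h.lpn_ne_top
  have hT0 : ∫⁻ x, u x ^ p ≠ 0 := by
    intro h0
    rw [lintegral_eq_zero_iff (by fun_prop)] at h0
    have : ∀ᵐ y : E, False := by
      filter_upwards [h0, h.pos] with y hy hpos
      exact (ENNReal.rpow_pos_of_nonneg hpos hp.le).ne' hy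
    exact this.exists.choose_spec
  have hlim : Tendsto (fun n : ℕ => ∫⁻ x in ball c n, u x ^ p) atTop (𝓝 (∫⁻ x, u x ^ p)) := by
    have h1 := tendsto_measure_iUnion_atTop (μ := volume.withDensity fun x => u x ^ p)
      (s := fun n : ℕ => ball c n) fun m n hmn => ball_subset_ball (by exact_mod_cast hmn)
    simp_rw [iUnion_ball_nat, Function.comp_def, withDensity_apply _ measurableSet_ball] at h1
    rwa [withDensity_apply _ MeasurableSet.univ, setLIntegral_univ] at h1
  obtain ⟨n, hn⟩ := (hlim.eventually_const_lt (ENNReal.half_lt_self hT0 hT)).exists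
  refine ⟨n, fun R hR hRn hle => ?_⟩
  have h1 : ∫⁻ x in ball c R, u x ^ p ≤ ∫⁻ x in (ball c R)ᶜ, u x ^ p := by
    rw [lintegral_compl_ball_eq h.ne_zero hR]
    refine setLIntegral_mono_ae' measurableSet_ball ?_
    filter_upwards [hle] with y hy hyb
    rw [← h.refl_rpow]
    exact ENNReal.rpow_le_rpow (hy hyb) hp.le
  have h2 : (∫⁻ x, u x ^ p) / 2 < ∫⁻ x in ball c R, u x ^ p :=
    hn.trans_le (lintegral_mono_set (ball_subset_ball hRn))
  have h3 := lintegral_add_compl (fun x => u x ^ p) (measurableSet_ball (x := c) (ε := R))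
    (μ := volume)
  have h4 : ∫⁻ x, u x ^ p < ∫⁻ x, u x ^ p := by
    calc ∫⁻ x, u x ^ p = (∫⁻ x, u x ^ p) / 2 + (∫⁻ x, u x ^ p) / 2 := (ENNReal.add_halves _).symm
      _ < (∫⁻ x in ball c R, u x ^ p) + ∫⁻ x in (ball c R)ᶜ, u x ^ p :=
        ENNReal.add_lt_add h2 (h2.trans_le h1)
      _ = _ := h3
  exact lt_irrefl _ h4

/-- The limit of radii is taken outside the balls, where the inequality reads `refl ≤ u`: there
lower semicontinuity of the reflection in the radius points the right way. The result is then
reflected back inside. -/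
theorem ae_le_refl_of_lt (h : IsHartreeSystem C u) (c : E) {R : ℝ} (hR : 0 < R)
    (hlt : ∀ R', 0 < R' → R' < R → ∀ᵐ y, y ∈ ball c R' → u y ≤ refl c R' u y) :
    ∀ᵐ y, y ∈ ball c R → u y ≤ refl c R u y := by
  obtain ⟨s, -, hs, hlim⟩ := exists_seq_strictMono_tendsto' hR
  have h1 : ∀ᵐ y, ∀ n, y ∉ closedBall c (s n) → refl c (s n) u y ≤ u y :=
    ae_all_iff.2 fun n => h.ae_le_refl_iff (hs n).1 (hlt _ (hs n).1 (hs n).2)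
  have h2 : ∀ᵐ y, y ∉ ball c R → refl c R u y ≤ u y := by
    filter_upwards [h1, ae_ne h.ne_zero c] with y hy hyc hyb
    by_contra hcon
    obtain ⟨n, hn⟩ := (hlim.eventually
      (eventually_lt_kelvin _ hR hyc h.lowerSemicontinuous (not_le.1 hcon))).exists
    refine absurd (hy n ?_) (not_le.2 hn)
    rw [mem_closedBall, not_le]
    exact (hs n).2.trans_le (not_lt.1 hyb)
  filter_upwards [ae_comp_inversion h.ne_zero hR h2, ae_ne h.ne_zero c] with y hy hyc hyb
  have hmem : inversion c R y ∉ ball c R := by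
    rw [mem_ball, EuclideanGeometry.dist_inversion_center, not_lt, le_div_iff₀ (dist_pos.2 hyc), sq]
    rw [mem_ball] at hyb
    gcongr
  calc u y = kelvin ((d : ℝ) - 2) c R (refl c R u) y := (kelvin_kelvin hR u hyc).symm
    _ ≤ _ := by
      nth_rw 1 [kelvin]
      exact mul_le_mul_right (hy hmem) _

/-- If a solution lies below its reflection, then the two agree or the inequality is strict. -/
theorem ae_eq_refl_or_lt (h : IsHartreeSystem C u) (c : E) {R : ℝ} (hR : 0 < R)
    (hle : ∀ᵐ y, y ∈ ball c R → u y ≤ refl c R u y) :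
    u =ᵐ[volume] refl c R u ∨ ∀ᵐ y, y ∈ ball c R → u y < refl c R u y := by
  by_cases hstrict : ∀ᵐ y, y ∈ ball c R → u y < refl c R u y
  · exact Or.inr hstrict
  left
  have hd := h.ne_zero
  have hd2 := h.two_lt
  have hm := h.measurable
  have hmp := h.measurable_pot
  have hV : ∀ y ∈ ball c R, y ≠ c → pot u y ≤ kelvin 4 c R (pot u) y := fun y hy hyc =>
    (rieszPot_le_kelvin hd (by norm_num) hR (hm.pow_const 2) (by
      filter_upwards [hle] with z hz hzb
      rw [kelvin_sq]
      exact pow_le_pow_left₀ zero_le (hz hzb) 2) hy hyc).1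
  have hf : ∀ᵐ z, z ∈ ball c R → pot u z * u z ≤
      kelvin (2 * d - ((d : ℝ) - 2)) c R (fun z => pot u z * u z) z := by
    filter_upwards [hle, ae_ne hd c] with z hz hzc hzb
    rw [kelvin_pot_mul hR u hzc]
    exact mul_le_mul' (hV z hzb hzc) (hz hzb)
  -- A single point of contact, with finite value, is enough to apply strict comparison to the outer
  -- potential.
  obtain ⟨y, hy1, hy2, hyc, hyt⟩ := ((not_eventually.1 hstrict).and_eventually
    (hle.and ((ae_ne hd c).and h.ae_lt_top))).exists
  rw [Classical.not_imp, not_lt] at hy1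
  have heq : u y = refl c R u y := le_antisymm (hy2 hy1.1) hy1.2
  have hC0 := h.const_ne_zero
  have hCt := h.const_ne_top
  have key := (rieszPot_le_kelvin (a := (d : ℝ) - 2) (g := fun z => pot u z * u z) hd
    (by linarith) hR (hmp.mul hm) hf hy1.1 hyc).2 (by
      rw [h.refl_eq] at heq
      nth_rw 1 [h.eq y] at heq
      exact (ENNReal.mul_right_inj hC0 hCt).1 heq) (by
      intro htop
      rw [h.eq y, htop, ENNReal.mul_top hC0] at hyt
      exact lt_irrefl _ hyt)
  refine h.ae_eq_refl_of_ball hR ?_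
  filter_upwards [key, hle, ae_ne hd c, ae_comp_inversion hd hR h.ae_pot_lt_top, h.ae_lt_top,
    h.pos] with z hz1 hz2 hzc hzt hut hup hzb
  refine le_antisymm (hz2 hzb) ?_
  by_contra hcon
  rw [not_le] at hcon
  have h1 := hz1 hzb
  rw [kelvin_pot_mul hR u hzc] at h1
  have hVt : kelvin 4 c R (pot u) z ≠ ⊤ :=
    ENNReal.mul_ne_top (invFactor_rpow_ne_top hR hzc _) hzt.ne
  have hV0 : kelvin 4 c R (pot u) z ≠ 0 :=
    mul_ne_zero (invFactor_rpow_ne_zero hR hzc _) (h.pot_pos _)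
  -- The densities `V u` and `V' U` agree while `V ≤ V'`, `u ≤ U` and `0 < V' < ⊤`; so `u < U` is
  -- impossible.
  refine absurd h1 (ne_of_lt ?_)
  calc pot u z * u z ≤ kelvin 4 c R (pot u) z * u z := by
        gcongr
        exact hV z hzb hzc
    _ < _ := (ENNReal.mul_right_strictMono hV0 hVt) hcon

/-- Every centre admits a sphere in which the solution is invariant under reflection. -/
theorem exists_ae_eq_refl (h : IsHartreeSystem C u) (c : E) :
    ∃ R > 0, u =ᵐ[volume] refl c R u := by
  have hd := h.ne_zero
  obtain ⟨R₀, hR₀, hsmall⟩ := h.exists_small_radius c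
  obtain ⟨R₁, hlarge⟩ := h.not_ae_le_refl_of_large c
  obtain ⟨η, hη, hs⟩ := h.exists_ae_le_refl_of_volume_lt
  -- The inequality is required at all smaller radii too, so that it holds throughout the interval
  -- below the supremum.
  set S : Set ℝ := {R | 0 < R ∧ ∀ R', 0 < R' → R' ≤ R →
    ∀ᵐ y, y ∈ ball c R' → u y ≤ refl c R' u y} with hS
  have hSne : S.Nonempty := ⟨R₀, hR₀, hsmall⟩
  have hSb : BddAbove S := by
    refine ⟨R₁, fun R hR => ?_⟩
    by_contra hcon
    exact hlarge R hR.1 (not_le.1 hcon).le (hR.2 R hR.1 le_rfl)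
  set R := sSup S with hRdef
  have hR : 0 < R := hR₀.trans_le (le_csSup hSb ⟨hR₀, hsmall⟩)
  have hlt : ∀ R', 0 < R' → R' < R → ∀ᵐ y, y ∈ ball c R' → u y ≤ refl c R' u y := by
    intro R' h0 h1
    obtain ⟨R'', hR'', hlt⟩ := exists_lt_of_lt_csSup hSne h1
    exact hR''.2 R' h0 hlt.le
  have hle := h.ae_le_refl_of_lt c hR hlt
  rcases h.ae_eq_refl_or_lt c hR hle with heq | hstrict
  · exact ⟨R, hR, heq⟩
  exfalso
  -- If all slightly larger radii had bad sets of volume below `η`, the supremum could be increased.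
  have hbad : ∀ n : ℕ, ∃ R', R < R' ∧ R' < R + 1 / (n + 1) ∧ η ≤ volume (badSet c R' u) := by
    intro n
    have hn : (0 : ℝ) < 1 / (n + 1) := Nat.one_div_pos_of_nat
    by_contra! hcon
    have hmem : R + 1 / (n + 1) / 2 ∈ S := by
      refine ⟨by positivity, fun R' h0 h1 => ?_⟩
      rcases lt_trichotomy R' R with h2 | h2 | h2
      · exact hlt R' h0 h2
      · rw [h2]; exact hle
      · exact hs c R' h0 (hcon R' h2 (by linarith))
    have := le_csSup hSb hmem
    linarith
  choose s hs1 hs2 hs3 using hbad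
  have hslim : Tendsto s atTop (𝓝 R) := by
    refine tendsto_of_tendsto_of_tendsto_of_le_of_le tendsto_const_nhds ?_ (fun n => (hs1 n).le)
      (fun n => (hs2 n).le)
    simpa using tendsto_const_nhds.add (tendsto_one_div_add_atTop_nhds_zero_nat (𝕜 := ℝ))
  have hsph : ∀ᵐ z : E, z ∉ sphere c R := by
    have : Nonempty (Fin d) := ⟨⟨0, Nat.pos_of_ne_zero hd⟩⟩
    exact measure_eq_zero_iff_ae_notMem.1 (Measure.addHaar_sphere volume c R)
  -- Strict inequality at radius `R` persists pointwise for nearby radii, by semicontinuity. Off the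
  -- null sphere the indicators of the bad sets thus tend to `0`, contradicting the lower bound `η`.
  have hlim : Tendsto (fun n => volume (badSet c (s n) u)) atTop (𝓝 (volume (∅ : Set E))) := by
    refine tendsto_measure_of_ae_tendsto_indicator (B := ball c (R + 1)) atTop MeasurableSet.empty
      (fun n => h.measurableSet_badSet c (s n)) measurableSet_ball measure_ball_lt_top.ne
      (Eventually.of_forall fun n => ?_) ?_
    · refine (sep_subset _ _).trans (ball_subset_ball ?_)
      refine (hs2 n).le.trans ?_
      gcongr
      rw [div_le_one (by positivity)]
      linarith [(Nat.cast_nonneg n : (0 : ℝ) ≤ n)]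
    · filter_upwards [hstrict, ae_ne hd c, hsph] with y hy hyc hys
      rcases lt_or_gt_of_ne (show dist y c ≠ R from hys) with hlt' | hgt
      · filter_upwards [hslim.eventually
          (eventually_lt_kelvin _ hR hyc h.lowerSemicontinuous (hy hlt'))] with n hn
        simp only [mem_empty_iff_false, iff_false]
        exact fun hmem => lt_asymm hmem.2 hn
      · filter_upwards [hslim.eventually_lt_const hgt] with n hn
        simp only [mem_empty_iff_false, iff_false]
        exact fun hmem => lt_asymm hmem.1 hn
  rw [measure_empty] at hlim
  exact absurd (ge_of_tendsto' hlim hs3) (not_le.2 hη)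

end IsHartreeSystem

end MovingSpheres

/-! ### The functional equation for the radius of symmetry -/

section FunctionalEquation

open EuclideanGeometry (inversion)

variable {F : Type*} [NormedAddCommGroup F] [InnerProductSpace ℝ F] {lam : F → ℝ}

/-- Let `y` be the inverse of `x + z` in the sphere at `x`, and apply the functional equation at `x`
and at `p`. For small `z` the point `y` is far away, so its inverse in the sphere at `p` is close to
`p`: `lam²` near `x` is expressed through `lam²` near `p`. The bracket is `‖z‖² ‖y - p‖²`, so `hQ`
says that `y ≠ p`. -/
theorem sq_eq_of_inversion_eq (hpos : ∀ x, 0 < lam x)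
    (hinv : ∀ c y, y ≠ c → lam (inversion c (lam c) y) * dist y c = lam c * lam y)
    (p x z : F) (hz : z ≠ 0)
    (hQ : 0 < ‖z‖ ^ 2 * ‖x - p‖ ^ 2 + 2 * lam x ^ 2 * inner ℝ (x - p) z + (lam x ^ 2) ^ 2) :
    lam (x + z) ^ 2 =
      (‖z‖ ^ 2 * ‖x - p‖ ^ 2 + 2 * lam x ^ 2 * inner ℝ (x - p) z + (lam x ^ 2) ^ 2) *
      ((lam x ^ 2 * lam p ^ 2)⁻¹ * lam (p + (lam p ^ 2 * (‖z‖ ^ 2 * ‖x - p‖ ^ 2 + 2 * lam x ^ 2 *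
        inner ℝ (x - p) z + (lam x ^ 2) ^ 2)⁻¹) • (‖z‖ ^ 2 • (x - p) + lam x ^ 2 • z)) ^ 2) := by
  have hx := hpos x
  have hp := hpos p
  have hz' : 0 < ‖z‖ := norm_pos_iff.2 hz
  set Q := ‖z‖ ^ 2 * ‖x - p‖ ^ 2 + 2 * lam x ^ 2 * inner ℝ (x - p) z + (lam x ^ 2) ^ 2 with hQd
  set y := inversion x (lam x) (x + z) with hy
  have hxz : x + z ≠ x := by simpa using hz
  have hyx : y ≠ x := by
    rw [hy, Ne, EuclideanGeometry.inversion_eq_center hx.ne']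
    exact hxz
  have hyinv : inversion x (lam x) y = x + z := EuclideanGeometry.inversion_inversion x hx.ne' _
  have hyv : y = x + (lam x ^ 2 / ‖z‖ ^ 2) • z := by
    rw [hy, inversion, dist_eq_norm]
    simp [div_pow, add_comm]
  have hyp2 : ‖z‖ ^ 2 * ‖y - p‖ ^ 2 = Q := by
    rw [hyv, show x + (lam x ^ 2 / ‖z‖ ^ 2) • z - p = (x - p) + (lam x ^ 2 / ‖z‖ ^ 2) • z by abel,
      norm_add_sq_real, inner_smul_right, norm_smul, Real.norm_of_nonneg (by positivity), hQd]
    field_simp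
  have hyp : y ≠ p := by
    rintro h
    rw [h, sub_self, norm_zero] at hyp2
    simp at hyp2
    linarith
  have hyp' : 0 < ‖y - p‖ := norm_pos_iff.2 (sub_ne_zero.2 hyp)
  have e1 := hinv x y hyx
  have e2 := hinv p y hyp
  rw [hyinv, EuclideanGeometry.dist_inversion_center, dist_eq_norm,
    show x + z - x = z by abel] at e1
  rw [dist_eq_norm] at e2
  have hip : inversion p (lam p) y =
      p + (lam p ^ 2 * Q⁻¹) • (‖z‖ ^ 2 • (x - p) + lam x ^ 2 • z) := by
    have : ‖z‖ ^ 2 • (x - p) + lam x ^ 2 • z = ‖z‖ ^ 2 • (y - p) := by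
      rw [hyv, show x + (lam x ^ 2 / ‖z‖ ^ 2) • z - p = (x - p) + (lam x ^ 2 / ‖z‖ ^ 2) • z by abel,
        smul_add, smul_smul, mul_div_cancel₀ _ (by positivity)]
    rw [this, smul_smul, ← hyp2]
    simp only [inversion, dist_eq_norm, vsub_eq_sub, vadd_eq_add]
    rw [add_comm p]
    congr 2
    field_simp
  rw [← hip]
  have e3 : lam (x + z) = lam y * ‖z‖ / lam x := by
    field_simp at e1 ⊢
    linarith
  have e4 : lam y = lam (inversion p (lam p) y) * ‖y - p‖ / lam p := by
    field_simp at e2 ⊢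
    linarith
  rw [e3, e4, ← hyp2]
  field_simp

/-- The first-order behaviour of `lam ^ 2` at one point determines it at all points. -/
theorem hasFDerivAt_sq_of_inversion_eq (hpos : ∀ x, 0 < lam x)
    (hinv : ∀ c y, y ≠ c → lam (inversion c (lam c) y) * dist y c = lam c * lam y)
    {p : F} {D : F →L[ℝ] ℝ} (hD : HasFDerivAt (fun x => lam x ^ 2) D p) (x : F) :
    HasFDerivAt (fun x => lam x ^ 2) ((2 : ℝ) • innerSL ℝ (x - p) + D) x := by
  have hx := hpos x
  have hp := hpos p
  set A := lam x ^ 2 with hA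
  set B := lam p ^ 2 with hB
  have hA0 : 0 < A := by positivity
  have hB0 : 0 < B := by positivity
  set Q : F → ℝ := fun z => ‖z‖ ^ 2 * ‖x - p‖ ^ 2 + 2 * A * inner ℝ (x - p) z + A ^ 2 with hQ
  set W : F → F := fun z => p + (B * (Q z)⁻¹) • (‖z‖ ^ 2 • (x - p) + A • z) with hW
  have hQ0 : Q 0 = A ^ 2 := by simp [hQ]
  have hW0 : W 0 = p := by simp [hW]
  have hQd : HasFDerivAt Q ((2 * A) • innerSL ℝ (x - p)) 0 := by
    have h1 : HasFDerivAt (fun z : F => ‖z‖ ^ 2) (0 : F →L[ℝ] ℝ) 0 := by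
      have := (hasFDerivAt_id (𝕜 := ℝ) (0 : F)).norm_sq
      simpa using this
    have h2 : HasFDerivAt (fun z : F => inner ℝ (x - p) z) (innerSL ℝ (x - p)) 0 :=
      (innerSL ℝ (x - p)).hasFDerivAt
    have := ((h1.mul_const (‖x - p‖ ^ 2)).add (h2.const_mul (2 * A))).add_const (A ^ 2)
    refine HasFDerivAt.congr_fderiv (f := Q) this ?_
    ext z
    simp
  have hWd : HasFDerivAt W ((B / A) • ContinuousLinearMap.id ℝ F) 0 := by
    have h1 : HasFDerivAt (fun z : F => ‖z‖ ^ 2) (0 : F →L[ℝ] ℝ) 0 := by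
      have := (hasFDerivAt_id (𝕜 := ℝ) (0 : F)).norm_sq
      simpa using this
    have h2 : HasFDerivAt (fun z : F => ‖z‖ ^ 2 • (x - p) + A • z)
        (A • ContinuousLinearMap.id ℝ F) 0 := by
      have := (h1.smul_const (x - p)).add ((hasFDerivAt_id (𝕜 := ℝ) (0 : F)).const_smul A)
      refine HasFDerivAt.congr_fderiv (f := fun z : F => ‖z‖ ^ 2 • (x - p) + A • z) this ?_
      ext z
      simp
    have h3 : HasFDerivAt (fun z => B * (Q z)⁻¹)
        (B • (-(Q 0 ^ 2)⁻¹ • ((2 * A) • innerSL ℝ (x - p)))) 0 := by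
      have := ((hasDerivAt_inv (x := Q 0) (by rw [hQ0]; positivity)).comp_hasFDerivAt _ hQd)
      exact this.const_mul B
    have h4 := (h3.smul h2).const_add p
    refine h4.congr_fderiv ?_
    ext z
    simp [hQ0]
    rw [smul_smul]
    congr 1
    field_simp
  have hcomp : HasFDerivAt (fun z => lam (W z) ^ 2) (D.comp ((B / A) • ContinuousLinearMap.id ℝ F))
      0 := by
    have hD' : HasFDerivAt (fun x => lam x ^ 2) D (W 0) := by rwa [hW0]
    exact hD'.comp (0 : F) hWd
  have hmain : HasFDerivAt (fun z => Q z * ((A * B)⁻¹ * lam (W z) ^ 2))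
      ((2 : ℝ) • innerSL ℝ (x - p) + D) 0 := by
    refine (hQd.mul (hcomp.const_mul (A * B)⁻¹)).congr_fderiv ?_
    ext z
    simp [hQ0, hW0, ← hB]
    field_simp
    ring
  -- `Q 0 = A ^ 2` is positive, so `Q` is positive near `0`; the point `z = 0` itself is checked by
  -- hand.
  have hev : (fun z => lam (x + z) ^ 2) =ᶠ[𝓝 0] fun z => Q z * ((A * B)⁻¹ * lam (W z) ^ 2) := by
    have hQc : ContinuousAt Q 0 := hQd.continuousAt
    filter_upwards [hQc.eventually_const_lt (show 0 < Q 0 by rw [hQ0]; positivity)] with z hz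
    rcases eq_or_ne z 0 with rfl | hz0
    · rw [hQ0, hW0, add_zero, ← hA, ← hB]
      field_simp
    · exact sq_eq_of_inversion_eq hpos hinv p x z hz0 hz
  have h5 := hmain.congr_of_eventuallyEq hev
  have h6 : HasFDerivAt (fun z => lam (x + z) ^ 2) ((2 : ℝ) • innerSL ℝ (x - p) + D) (x - x) := by
    rwa [sub_self]
  have h7 := HasFDerivAt.comp (f := fun y : F => y - x) x h6
    ((hasFDerivAt_id (𝕜 := ℝ) x).sub_const x)
  simpa only [Function.comp_def, add_sub_cancel, ContinuousLinearMap.comp_id] using h7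

/-- Rademacher gives one point of differentiability, hence `lam²` has gradient `2 x` plus a constant
everywhere. Integrating and completing the square gives the form, and evaluation at the vertex shows
`b > 0`. -/
theorem exists_sq_eq_of_inversion_eq [FiniteDimensional ℝ F] [MeasurableSpace F] [BorelSpace F]
    (hpos : ∀ x, 0 < lam x) (hlip : LipschitzWith 1 lam)
    (hinv : ∀ c y, y ≠ c → lam (inversion c (lam c) y) * dist y c = lam c * lam y) :
    ∃ (e : F) (b : ℝ), 0 < b ∧ ∀ x, lam x ^ 2 = ‖x - e‖ ^ 2 + b := by
  obtain ⟨p, hp⟩ := (hlip.ae_differentiableAt (μ := volume)).exists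
  obtain ⟨D, hD⟩ : ∃ D, HasFDerivAt (fun x => lam x ^ 2) D p := ⟨_, (hp.pow 2).hasFDerivAt⟩
  set L : F →L[ℝ] ℝ := D - (2 : ℝ) • innerSL ℝ p with hL
  have hk : ∀ x, HasFDerivAt (fun x => lam x ^ 2 - ‖x‖ ^ 2 - L x) (0 : F →L[ℝ] ℝ) x := by
    intro x
    have h1 := hasFDerivAt_sq_of_inversion_eq hpos hinv hD x
    have h2 := (hasFDerivAt_id (𝕜 := ℝ) x).norm_sq
    refine ((h1.sub h2).sub L.hasFDerivAt).congr_fderiv ?_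
    ext z
    simp [hL]
    ring
  have hconst : ∀ x, lam x ^ 2 - ‖x‖ ^ 2 - L x = lam 0 ^ 2 - ‖(0 : F)‖ ^ 2 - L 0 := fun x =>
    is_const_of_fderiv_eq_zero (𝕜 := ℝ) (f := fun x => lam x ^ 2 - ‖x‖ ^ 2 - L x)
      (fun x => (hk x).differentiableAt) (fun x => (hk x).fderiv) x 0
  set l := (InnerProductSpace.toDual ℝ F).symm L with hl
  have hLl : ∀ x, L x = inner ℝ l x := fun x => by
    rw [hl, InnerProductSpace.toDual_symm_apply]
  have hform : ∀ x, lam x ^ 2 = ‖x - (-(1 / 2 : ℝ)) • l‖ ^ 2 + (lam 0 ^ 2 - ‖l‖ ^ 2 / 4) := by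
    intro x
    have h1 := hconst x
    rw [hLl] at h1
    simp only [norm_zero, map_zero] at h1
    rw [norm_sub_sq_real, inner_smul_right, norm_smul, real_inner_comm]
    norm_num
    linarith
  refine ⟨(-(1 / 2 : ℝ)) • l, lam 0 ^ 2 - ‖l‖ ^ 2 / 4, ?_, hform⟩
  have h1 := hform ((-(1 / 2 : ℝ)) • l)
  rw [sub_self, norm_zero] at h1
  have := hpos ((-(1 / 2 : ℝ)) • l)
  nlinarith

end FunctionalEquation

/-! ### Solutions of the integral system are bubbles -/

section Classification

open EuclideanGeometry (inversion)

namespace IsHartreeSystem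

variable {C : ℝ≥0∞} {u : EuclideanSpace ℝ (Fin d) → ℝ≥0∞}

/-- The measure with the critical density of a solution. -/
def critMeasure (u : E → ℝ≥0∞) : Measure E :=
  volume.withDensity fun x => u x ^ (2 * d / (d - 2) : ℝ)

theorem measurable_rpow (h : IsHartreeSystem C u) :
    Measurable fun x => u x ^ (2 * d / (d - 2) : ℝ) := by
  have := h.measurable
  fun_prop

theorem isFiniteMeasure_critMeasure (h : IsHartreeSystem C u) :
    IsFiniteMeasure (critMeasure u) := by
  have hT := (lpn_ne_top_iff h.exponent_pos).1 h.lpn_ne_top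
  exact isFiniteMeasure_withDensity hT

theorem volume_absolutelyContinuous (h : IsHartreeSystem C u) : volume ≪ critMeasure u := by
  refine withDensity_absolutelyContinuous' h.measurable_rpow.aemeasurable ?_
  filter_upwards [h.pos] with x hx
  exact (ENNReal.rpow_pos_of_nonneg hx h.exponent_pos.le).ne'

theorem critMeasure_absolutelyContinuous : critMeasure u ≪ volume :=
  withDensity_absolutelyContinuous _ _

/-- Under the symmetry the critical density is invariant, and inversion exchanges the radii `ρ` and
`R ^ 2 / ρ`. -/
theorem critMeasure_compl_closedBall (h : IsHartreeSystem C u) {c : E} {R : ℝ} (hR : 0 < R)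
    (hsym : u =ᵐ[volume] refl c R u) {ρ : ℝ} (hρ : 0 < ρ) :
    critMeasure u (closedBall c ρ)ᶜ = critMeasure u (closedBall c (R ^ 2 / ρ)) := by
  have hcb : critMeasure u (closedBall c (R ^ 2 / ρ)) = critMeasure u (ball c (R ^ 2 / ρ)) := by
    have : Nonempty (Fin d) := ⟨⟨0, Nat.pos_of_ne_zero h.ne_zero⟩⟩
    have h0 := critMeasure_absolutelyContinuous (u := u)
      (Measure.addHaar_sphere volume c (R ^ 2 / ρ))
    refine measure_congr ?_
    filter_upwards [measure_eq_zero_iff_ae_notMem.1 h0] with x hx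
    rw [mem_sphere] at hx
    refine propext ?_
    change dist x c ≤ _ ↔ dist x c < _
    exact ⟨fun h => lt_of_le_of_ne h hx, le_of_lt⟩
  rw [hcb]
  unfold critMeasure
  rw [withDensity_apply _ isClosed_closedBall.measurableSet.compl,
    withDensity_apply _ measurableSet_ball,
    ← lintegral_indicator isClosed_closedBall.measurableSet.compl,
    ← lintegral_indicator measurableSet_ball,
    ← lintegral_kelvin h.ne_zero (c := c) hR]
  refine lintegral_congr_ae ?_
  filter_upwards [hsym, ae_ne h.ne_zero c] with y hy hyc
  have hiff : inversion c R y ∈ (closedBall c ρ)ᶜ ↔ y ∈ ball c (R ^ 2 / ρ) := by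
    rw [mem_compl_iff, mem_closedBall, EuclideanGeometry.dist_inversion_center, not_le,
      mem_ball, lt_div_comm₀ hρ (dist_pos.2 hyc)]
  by_cases hb : y ∈ ball c (R ^ 2 / ρ)
  · rw [indicator_of_mem hb, kelvin, indicator_of_mem (hiff.2 hb)]
    rw [hy, h.refl_rpow, kelvin]
  · rw [indicator_of_notMem hb, kelvin, indicator_of_notMem (fun h => hb (hiff.1 h)), mul_zero]

/-- The radius of symmetry is a Lipschitz function of the centre. -/
theorem lipschitzWith_radius (h : IsHartreeSystem C u) {lam : E → ℝ} (hpos : ∀ x, 0 < lam x)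
    (hsym : ∀ x, u =ᵐ[volume] refl x (lam x) u) : LipschitzWith 1 lam := by
  have := h.isFiniteMeasure_critMeasure
  -- Taking `ρ = lam x` shows that each ball of symmetry carries half of the mass.
  have hhalf : ∀ x, critMeasure u (closedBall x (lam x)) + critMeasure u (closedBall x (lam x)) =
      critMeasure u univ := by
    intro x
    have h1 := h.critMeasure_compl_closedBall (hpos x) (hsym x) (hpos x)
    rw [sq, mul_div_cancel_right₀ _ (hpos x).ne'] at h1
    nth_rw 2 [← h1]
    exact measure_add_measure_compl isClosed_closedBall.measurableSet
  have heq : ∀ x y,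
      critMeasure u (closedBall x (lam x)) = critMeasure u (closedBall y (lam y)) := by
    intro x y
    have h1 := (hhalf x).trans (hhalf y).symm
    rw [← two_mul, ← two_mul] at h1
    exact (ENNReal.mul_right_inj (by simp) (by simp)).1 h1
  refine LipschitzWith.of_le_add fun x y => ?_
  by_contra! hcon
  set r := lam y + dist x y with hr
  have hr0 : 0 < r := by have := hpos y; positivity
  have hsub : closedBall y (lam y) ⊆ closedBall x r :=
    closedBall_subset_closedBall' (by rw [hr, dist_comm])
  have hsub2 : closedBall x r ⊆ closedBall x (lam x) := closedBall_subset_closedBall hcon.le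
  -- The ball at `y` lies in the ball of radius `r` at `x` and already has half of the mass, so the
  -- remaining shell is null. But the density is positive and the shell has positive volume.
  have h1 : critMeasure u (closedBall x (lam x) \ closedBall x r) = 0 := by
    rw [measure_sdiff hsub2 isClosed_closedBall.measurableSet.nullMeasurableSet
      (measure_ne_top _ _),
      heq x y]
    exact tsub_eq_zero_of_le (measure_mono hsub)
  have h2 := h.volume_absolutelyContinuous h1
  have h3 : volume (closedBall x (lam x)) ≤ volume (closedBall x r) := by
    have := measure_le_inter_add_sdiff volume (closedBall x (lam x)) (closedBall x r)
    rw [h2, add_zero] at this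
    exact this.trans (measure_mono inter_subset_right)
  rw [volume_closedBall_eq x (hpos x), volume_closedBall_eq x hr0] at h3
  refine absurd h3 (not_le.2 ?_)
  refine ENNReal.mul_lt_mul_left volume_unitBall_ne_zero volume_unitBall_ne_top ?_
  rw [ENNReal.ofReal_lt_ofReal_iff (pow_pos (hpos x) _)]
  exact pow_lt_pow_left₀ hcon hr0.le h.ne_zero

/-- Asymptotics of the mass near infinity in terms of the value of a solution at a point. -/
theorem ae_tendsto_mass (h : IsHartreeSystem C u) {lam : E → ℝ} (hpos : ∀ x, 0 < lam x)
    (hsym : ∀ x, u =ᵐ[volume] refl x (lam x) u) :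
    ∀ᵐ x, Tendsto (fun ρ : ℝ => ENNReal.ofReal (ρ ^ d) * critMeasure u (closedBall x ρ)ᶜ) atTop
      (𝓝 (ENNReal.ofReal ((lam x ^ 2) ^ d) * volume (ball (0 : E) 1) *
        u x ^ (2 * d / (d - 2) : ℝ))) := by
  have := h.isFiniteMeasure_critMeasure
  filter_upwards [Besicovitch.ae_tendsto_rnDeriv (critMeasure u) volume,
    Measure.rnDeriv_withDensity volume h.measurable_rpow] with x hx hx2
  rw [show (critMeasure u).rnDeriv volume x = _ from hx2] at hx
  have hlim : Tendsto (fun ρ : ℝ => lam x ^ 2 / ρ) atTop (𝓝[>] 0) := by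
    refine tendsto_nhdsWithin_iff.2 ⟨tendsto_const_nhds.div_atTop tendsto_id, ?_⟩
    filter_upwards [eventually_gt_atTop 0] with ρ hρ
    exact div_pos (pow_pos (hpos x) 2) hρ
  -- The exterior mass equals that of a ball of radius `lam x ^ 2 / ρ → 0`. The constant is `ρ ^ d`
  -- times the volume of that ball, so Lebesgue differentiation yields the limit.
  have h1 := ENNReal.Tendsto.const_mul (hx.comp hlim) (a := ENNReal.ofReal ((lam x ^ 2) ^ d) *
    volume (ball (0 : E) 1)) (Or.inr (ENNReal.mul_ne_top ENNReal.ofReal_ne_top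
      volume_unitBall_ne_top))
  refine h1.congr' ?_
  filter_upwards [eventually_gt_atTop 0] with ρ hρ
  have hr : 0 < lam x ^ 2 / ρ := div_pos (pow_pos (hpos x) 2) hρ
  rw [h.critMeasure_compl_closedBall (hpos x) (hsym x) hρ]
  simp only [Function.comp_apply]
  have hv := volume_closedBall_eq x hr
  have e : ENNReal.ofReal ((lam x ^ 2) ^ d) * volume (ball (0 : E) 1) =
      ENNReal.ofReal (ρ ^ d) * volume (closedBall x (lam x ^ 2 / ρ)) := by
    rw [hv, ← mul_assoc, ← ENNReal.ofReal_mul (by positivity), ← mul_pow,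
      mul_div_cancel₀ _ hρ.ne']
  rw [e, mul_assoc, ENNReal.mul_div_cancel]
  · exact (measure_closedBall_pos volume x hr).ne'
  · exact measure_closedBall_lt_top.ne

/-- Moving the centre changes radii by a bounded amount, which is negligible relative to `ρ`. By
symmetry the limit does not depend on the centre. -/
theorem le_of_tendsto_mass {x x' : E} {L L' : ℝ≥0∞}
    (hL : Tendsto (fun ρ : ℝ => ENNReal.ofReal (ρ ^ d) * critMeasure u (closedBall x ρ)ᶜ) atTop
      (𝓝 L))
    (hL' : Tendsto (fun ρ : ℝ => ENNReal.ofReal (ρ ^ d) * critMeasure u (closedBall x' ρ)ᶜ) atTop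
      (𝓝 L')) : L' ≤ L := by
  set D := dist x x'
  have h1 : Tendsto (fun ρ : ℝ => ENNReal.ofReal ((ρ + D) ^ d) *
      critMeasure u (closedBall x' (ρ + D))ᶜ) atTop (𝓝 L') :=
    hL'.comp (tendsto_atTop_add_const_right _ _ tendsto_id)
  have h2 : Tendsto (fun ρ : ℝ => ENNReal.ofReal (((ρ + D) / ρ) ^ d) *
      (ENNReal.ofReal (ρ ^ d) * critMeasure u (closedBall x ρ)ᶜ)) atTop (𝓝 (1 * L)) := by
    refine ENNReal.Tendsto.mul ?_ (Or.inl one_ne_zero) hL (Or.inr ENNReal.one_ne_top)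
    have h3 : Tendsto (fun ρ : ℝ => ((ρ + D) / ρ) ^ d) atTop (𝓝 1) := by
      have h4 : Tendsto (fun ρ : ℝ => 1 + D / ρ) atTop (𝓝 (1 + 0)) :=
        tendsto_const_nhds.add (tendsto_const_nhds.div_atTop tendsto_id)
      have h5 := h4.pow d
      rw [add_zero, one_pow] at h5
      refine h5.congr' ?_
      filter_upwards [eventually_gt_atTop 0] with ρ hρ
      rw [add_div, div_self (ne_of_gt hρ)]
    have := (ENNReal.continuous_ofReal.tendsto 1).comp h3
    rwa [ENNReal.ofReal_one] at this
  rw [one_mul] at h2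
  refine le_of_tendsto_of_tendsto h1 h2 ?_
  filter_upwards [eventually_gt_atTop 0] with ρ hρ
  have hD : 0 ≤ D := dist_nonneg
  rw [← mul_assoc, ← ENNReal.ofReal_mul (by positivity), ← mul_pow, div_mul_cancel₀ _ hρ.ne']
  gcongr
  exact closedBall_subset_closedBall' le_rfl

/-- A solution is a power of its radius of symmetry. -/
theorem exists_ae_eq_radius (h : IsHartreeSystem C u) {lam : E → ℝ} (hpos : ∀ x, 0 < lam x)
    (hsym : ∀ x, u =ᵐ[volume] refl x (lam x) u) :
    ∃ a : ℝ, 0 < a ∧ ∀ᵐ x, u x = ENNReal.ofReal (a * lam x ^ (-((d : ℝ) - 2))) := by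
  have hm := h.ae_tendsto_mass hpos hsym
  have hd2 := h.two_lt
  have h2 : (0 : ℝ) < d - 2 := by linarith
  have hd0 : (0 : ℝ) < d := by linarith
  have hp := h.exponent_pos
  have hfin : ∀ x, u x < ⊤ → ENNReal.ofReal ((lam x ^ 2) ^ d) * volume (ball (0 : E) 1) *
      u x ^ (2 * d / (d - 2) : ℝ) ≠ ⊤ := fun x hx =>
    ENNReal.mul_ne_top (ENNReal.mul_ne_top ENNReal.ofReal_ne_top volume_unitBall_ne_top)
      (ENNReal.rpow_ne_top_of_nonneg hp.le hx.ne)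
  obtain ⟨x₀, hx₀, hx₀t, hx₀p⟩ := (hm.and (h.ae_lt_top.and h.pos)).exists
  have hl0 := hpos x₀
  have ht0 := ENNReal.toReal_pos hx₀p.ne' hx₀t.ne
  refine ⟨(u x₀).toReal * lam x₀ ^ ((d : ℝ) - 2), by positivity, ?_⟩
  filter_upwards [hm, h.ae_lt_top, h.pos] with x hx hxt hxp
  have hlx := hpos x
  -- Comparing the limits at `x` and `x₀`, the quantity `lam^(2d) u^(2d/(d-2))` is constant; its
  -- power `(d - 2) / (2 d)` is `lam^(d-2) u`.
  have heq := le_antisymm (le_of_tendsto_mass hx₀ hx)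
    (le_of_tendsto_mass hx hx₀)
  rw [mul_right_comm, mul_right_comm _ _ (u x₀ ^ _),
    ENNReal.mul_left_inj volume_unitBall_ne_zero volume_unitBall_ne_top] at heq
  have hux := ENNReal.toReal_pos hxp.ne' hxt.ne
  have e1 : u x = ENNReal.ofReal (u x).toReal := (ENNReal.ofReal_toReal hxt.ne).symm
  have e2 : u x₀ = ENNReal.ofReal (u x₀).toReal := (ENNReal.ofReal_toReal hx₀t.ne).symm
  rw [e1, e2, ENNReal.ofReal_rpow_of_pos hux, ENNReal.ofReal_rpow_of_pos ht0,
    ← ENNReal.ofReal_mul (by positivity), ← ENNReal.ofReal_mul (by positivity),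
    ENNReal.ofReal_eq_ofReal_iff (by positivity) (by positivity)] at heq
  rw [e1]
  congr 1
  set s := (u x).toReal
  set s₀ := (u x₀).toReal
  have h3 := congrArg (fun t : ℝ => t ^ (((d : ℝ) - 2) / (2 * d))) heq
  beta_reduce at h3
  have e3 : ∀ l t : ℝ, 0 < l → 0 < t →
      ((l ^ 2) ^ d * t ^ (2 * (d : ℝ) / (d - 2))) ^ (((d : ℝ) - 2) / (2 * d)) =
      l ^ ((d : ℝ) - 2) * t := by
    intro l t hl ht
    rw [Real.mul_rpow (by positivity) (by positivity), ← pow_mul, ← Real.rpow_natCast,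
      ← Real.rpow_mul hl.le, ← Real.rpow_mul ht.le]
    congr 1
    · congr 1; push_cast; field_simp
    · rw [show 2 * (d : ℝ) / (d - 2) * ((d - 2) / (2 * d)) = 1 by field_simp, Real.rpow_one]
  rw [e3 _ _ hlx hux, e3 _ _ hl0 ht0] at h3
  rw [Real.rpow_neg hlx.le, mul_comm s₀, ← h3]
  field_simp

/-- Solutions of the integral system are standard bubbles. -/
theorem exists_ae_eq_bubble (h : IsHartreeSystem C u) :
    ∃ (a b : ℝ) (e : E), 0 < a ∧ 0 < b ∧
      ∀ᵐ x, u x = ENNReal.ofReal (a * (b + ‖x - e‖ ^ 2) ^ (-(((d : ℝ) - 2) / 2))) := by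
  choose lam hpos hsym using h.exists_ae_eq_refl
  have hlip := h.lipschitzWith_radius hpos hsym
  have hd2 := h.two_lt
  have h2 : (0 : ℝ) < d - 2 := by linarith
  obtain ⟨a, ha, hu⟩ := h.exists_ae_eq_radius hpos hsym
  -- Inserting `u = a * lam^(2-d)` into the symmetry gives the identity almost everywhere;
  -- continuity of `lam` extends it to every `y ≠ c`.
  have hinv : ∀ c y, y ≠ c → lam (inversion c (lam c) y) * dist y c = lam c * lam y := by
    intro c y hy
    have hcont : Continuous lam := hlip.continuous
    refine Measure.eqOn_open_of_ae_eq (μ := volume) (U := {c}ᶜ)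
      (f := fun y => lam (inversion c (lam c) y) * dist y c) (g := fun y => lam c * lam y)
      ?_ isOpen_compl_singleton ?_ ?_ hy
    · refine ae_restrict_of_ae ?_
      filter_upwards [hsym c, hu, ae_comp_inversion h.ne_zero (c := c) (hpos c) hu,
        ae_ne h.ne_zero c] with z hz1 hz2 hz3 hzc
      have hD := dist_pos.2 hzc
      have hc := hpos c
      have hz := hpos z
      have hi := hpos (inversion c (lam c) z)
      rw [hz2, refl, kelvin, hz3, invFactor, ENNReal.ofReal_rpow_of_pos (by positivity),
        ← ENNReal.ofReal_mul (by positivity),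
        ENNReal.ofReal_eq_ofReal_iff (by positivity) (by positivity)] at hz1
      rw [Real.rpow_neg hz.le, Real.rpow_neg hi.le, Real.div_rpow hc.le hD.le] at hz1
      have h3 : (lam (inversion c (lam c) z) * dist z c) ^ ((d : ℝ) - 2) =
          (lam c * lam z) ^ ((d : ℝ) - 2) := by
        rw [Real.mul_rpow hi.le hD.le, Real.mul_rpow hc.le hz.le]
        have p1 := Real.rpow_pos_of_pos hz ((d : ℝ) - 2)
        have p2 := Real.rpow_pos_of_pos hi ((d : ℝ) - 2)
        have p3 := Real.rpow_pos_of_pos hD ((d : ℝ) - 2)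
        field_simp at hz1
        linarith
      exact (Real.rpow_left_inj (by positivity) (by positivity) h2.ne').1 h3
    · refine ContinuousOn.mul ?_ (by fun_prop)
      refine hcont.comp_continuousOn ?_
      exact ContinuousOn.inversion continuousOn_const continuousOn_const continuousOn_id
        fun z hz => hz
    · fun_prop
  obtain ⟨e, b, hb, hform⟩ := exists_sq_eq_of_inversion_eq hpos hlip hinv
  refine ⟨a, b, e, ha, hb, ?_⟩
  filter_upwards [hu] with x hx
  rw [hx, add_comm b, ← hform x, ← Real.rpow_natCast, ← Real.rpow_mul (hpos x).le]
  congr 3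
  push_cast
  ring

end IsHartreeSystem

end Classification

/-! ### Smooth truncations of the Newtonian kernel -/

/-- The Laplacian of a radial function. -/
theorem laplacian_radial {V : Type*} [NormedAddCommGroup V] [InnerProductSpace ℝ V]
    [FiniteDimensional ℝ V] {H H' : ℝ → ℝ} {h : ℝ} (x y : V)
    (h1 : ∀ᶠ r in 𝓝 (‖y - x‖ ^ 2), HasDerivAt H (H' r) r)
    (h2 : HasDerivAt H' h (‖y - x‖ ^ 2)) :
    Δ (fun y => H (‖y - x‖ ^ 2)) y =
      4 * ‖y - x‖ ^ 2 * h + 2 * Module.finrank ℝ V * H' (‖y - x‖ ^ 2) := by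
  obtain ⟨B, hB⟩ : ∃ B : V →L[ℝ] V →L[ℝ] ℝ, ∀ v w, B v w = inner ℝ v w :=
    ⟨innerSL ℝ, fun _ _ => rfl⟩
  have hq : ∀ z : V, HasFDerivAt (fun z : V => ‖z - x‖ ^ 2) ((2 : ℝ) • B (z - x)) z := by
    intro z
    have := ((hasFDerivAt_id z).sub_const x).norm_sq
    refine this.congr_fderiv (ContinuousLinearMap.ext fun w => ?_)
    simp [hB, two_mul]
  have hc : Continuous (fun z : V => ‖z - x‖ ^ 2) := by fun_prop
  have hf : fderiv ℝ (fun y => H (‖y - x‖ ^ 2)) =ᶠ[𝓝 y]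
      fun z => H' (‖z - x‖ ^ 2) • ((2 : ℝ) • B (z - x)) := by
    filter_upwards [hc.continuousAt.eventually h1] with z hz
    exact (hz.comp_hasFDerivAt z (hq z)).fderiv
  have hs : HasFDerivAt (fun z => H' (‖z - x‖ ^ 2) • ((2 : ℝ) • B (z - x)))
      (H' (‖y - x‖ ^ 2) • ((2 : ℝ) • B) +
        (h • ((2 : ℝ) • B (y - x))).smulRight ((2 : ℝ) • B (y - x))) y := by
    have hg : HasFDerivAt (fun z => (2 : ℝ) • B (z - x)) ((2 : ℝ) • B) y :=
      (hasFDerivAt_comp_sub (f := ⇑((2 : ℝ) • B)) x).2 ((2 : ℝ) • B).hasFDerivAt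
    have hh : HasFDerivAt (fun z => H' (‖z - x‖ ^ 2)) (h • ((2 : ℝ) • B (y - x))) y :=
      h2.comp_hasFDerivAt y (hq y)
    exact hh.smul hg
  let b := stdOrthonormalBasis ℝ V
  rw [InnerProductSpace.laplacian_eq_iteratedFDeriv_orthonormalBasis _ b]
  simp only [iteratedFDeriv_two_apply, hf.fderiv_eq, hs.fderiv]
  simp only [Matrix.cons_val_zero, Matrix.cons_val_one, _root_.add_apply,
    _root_.smul_apply, ContinuousLinearMap.smulRight_apply, hB]
  rw [Finset.sum_add_distrib]
  have e2 : ∀ i, inner ℝ (b i) (b i) = (1 : ℝ) := by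
    intro i; simp
  have e3 := b.sum_sq_inner_left (y - x)
  simp only [e2, smul_eq_mul]
  rw [Finset.sum_const, Finset.card_univ, Fintype.card_fin, nsmul_eq_mul, add_comm,
    ← e3, Finset.mul_sum, Finset.sum_mul]
  congr 1
  · refine Finset.sum_congr rfl fun i _ => ?_
    ring
  · ring

/-- A smooth function equal to `r ^ (-m)` for `1 ≤ r` and to `0` for `r ≤ 1 / 2`. -/
def cutPow (m r : ℝ) : ℝ := Real.smoothTransition (2 * r - 1) * r ^ (-m)

theorem cutPow_of_one_le {m r : ℝ} (hr : 1 ≤ r) : cutPow m r = r ^ (-m) := by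
  rw [cutPow, Real.smoothTransition.one_of_one_le (by linarith), one_mul]

theorem cutPow_of_le_half {m r : ℝ} (hr : r ≤ 1 / 2) : cutPow m r = 0 := by
  rw [cutPow, Real.smoothTransition.zero_of_nonpos (by linarith), zero_mul]

theorem cutPow_nonneg {m r : ℝ} (hr : 0 ≤ r) : 0 ≤ cutPow m r :=
  mul_nonneg (Real.smoothTransition.nonneg _) (Real.rpow_nonneg hr _)

theorem cutPow_le {m r : ℝ} (hr : 0 ≤ r) : cutPow m r ≤ r ^ (-m) :=
  mul_le_of_le_one_left (Real.rpow_nonneg hr _) (Real.smoothTransition.le_one _)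

theorem contDiff_cutPow (m : ℝ) {n : WithTop ℕ∞} (hn : n ≤ (⊤ : ℕ∞)) :
    ContDiff ℝ n (cutPow m) := by
  refine ContDiff.of_le ?_ hn
  rw [contDiff_iff_contDiffAt]
  intro r
  rcases lt_or_ge r (1 / 2) with hr | hr
  · refine (contDiffAt_const (c := (0 : ℝ))).congr_of_eventuallyEq ?_
    filter_upwards [Iio_mem_nhds hr] with s hs
    exact cutPow_of_le_half (le_of_lt hs)
  · refine ContDiffAt.mul ?_ (Real.contDiffAt_rpow_const_of_ne (by linarith))
    have : ContDiff ℝ (⊤ : ℕ∞) Real.smoothTransition := Real.smoothTransition.contDiff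
    exact (this.comp ((contDiff_const.mul contDiff_id).sub contDiff_const)).contDiffAt

/-- The radial profile of `-Δ` of `z ↦ cutPow ((d - 2) / 2) (‖z‖ ^ 2)`. -/
def cutLaplacian (d : ℕ) (r : ℝ) : ℝ :=
  -(4 * r * deriv (deriv (cutPow ((d - 2) / 2))) r + 2 * d * deriv (cutPow ((d - 2) / 2)) r)

theorem contDiff_deriv_cutPow (m : ℝ) : ContDiff ℝ 1 (deriv (cutPow m)) :=
  ((contDiff_succ_iff_deriv (n := 1)).1 (contDiff_cutPow m (n := 1 + 1)
    (show (((1 + 1 : ℕ∞)) : WithTop ℕ∞) ≤ _ from WithTop.coe_le_coe.2 le_top))).2.2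

theorem continuous_cutLaplacian : Continuous (cutLaplacian d) := by
  have h1 := (contDiff_deriv_cutPow (((d : ℝ) - 2) / 2)).continuous
  have h2 := (contDiff_deriv_cutPow (((d : ℝ) - 2) / 2)).continuous_deriv le_rfl
  unfold cutLaplacian
  fun_prop

/-- Beyond `1` the profile is that of the harmonic function `|z|^(2-d)`. -/
theorem cutLaplacian_of_one_lt {r : ℝ} (hr : 1 < r) : cutLaplacian d r = 0 := by
  set m := ((d : ℝ) - 2) / 2 with hm
  have h1 : ∀ s, 1 < s → deriv (cutPow m) s = -m * s ^ (-m - 1) := by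
    intro s hs
    have : cutPow m =ᶠ[𝓝 s] fun r => r ^ (-m) := by
      filter_upwards [Ioi_mem_nhds hs] with r hr using cutPow_of_one_le (le_of_lt hr)
    rw [this.deriv_eq, Real.deriv_rpow_const]
  have h2 : deriv (deriv (cutPow m)) r = -m * ((-m - 1) * r ^ (-m - 1 - 1)) := by
    have : deriv (cutPow m) =ᶠ[𝓝 r] fun s => -m * s ^ (-m - 1) := by
      filter_upwards [Ioi_mem_nhds hr] with s hs using h1 s hs
    rw [this.deriv_eq, deriv_const_mul_field, Real.deriv_rpow_const]
  have h3 : r ^ (-m - 1) = r * r ^ (-m - 1 - 1) := by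
    rw [Real.rpow_sub_one (by linarith) (-m - 1)]; field_simp
  rw [cutLaplacian, h1 r hr, h2, h3, hm]
  ring

theorem exists_abs_cutLaplacian_le (d : ℕ) : ∃ M, 0 ≤ M ∧ ∀ r, 0 ≤ r → |cutLaplacian d r| ≤ M := by
  obtain ⟨M, hM⟩ := isCompact_Icc.exists_bound_of_continuousOn
    (continuous_cutLaplacian (d := d)).continuousOn (s := Icc 0 1)
  refine ⟨max M 0, le_max_right _ _, fun r hr => ?_⟩
  rcases le_or_gt r 1 with h | h
  · exact (hM r ⟨hr, h⟩).trans (le_max_left _ _)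
  · rw [cutLaplacian_of_one_lt h, abs_zero]; exact le_max_right _ _

/-- A smooth truncation at scale `a` of the Newtonian kernel with pole `x`. -/
def cutNewton (a : ℝ) (x y : E) : ℝ :=
  a ^ (-((d : ℝ) - 2)) * cutPow (((d : ℝ) - 2) / 2) (‖y - x‖ ^ 2 / a ^ 2)

theorem scale_rpow {a r : ℝ} (ha : 0 < a) (hr : 0 ≤ r) (b : ℝ) :
    a ^ (-b) * (r ^ 2 / a ^ 2) ^ (-(b / 2)) = r ^ (-b) := by
  rw [← div_pow, ← Real.rpow_natCast, ← Real.rpow_mul (by positivity),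
    show ((2 : ℕ) : ℝ) * -(b / 2) = -b by push_cast; ring, Real.div_rpow hr ha.le,
    mul_div_cancel₀ _ (Real.rpow_pos_of_pos ha _).ne']

theorem cutNewton_of_le {a : ℝ} (ha : 0 < a) {x y : E} (h : a ≤ ‖y - x‖) :
    cutNewton a x y = ‖y - x‖ ^ (-((d : ℝ) - 2)) := by
  rw [cutNewton, cutPow_of_one_le, scale_rpow ha (norm_nonneg _)]
  rw [one_le_div (by positivity)]
  gcongr

theorem cutNewton_of_two_mul_le {a : ℝ} (ha : 0 < a) {x y : E} (h : 2 * ‖y - x‖ ≤ a) :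
    cutNewton a x y = 0 := by
  rw [cutNewton, cutPow_of_le_half, mul_zero]
  rw [div_le_iff₀ (by positivity)]
  nlinarith [norm_nonneg (y - x)]

theorem cutNewton_nonneg {a : ℝ} (ha : 0 < a) (x y : E) : 0 ≤ cutNewton a x y :=
  mul_nonneg (by positivity) (cutPow_nonneg (by positivity))

theorem cutNewton_le {a : ℝ} (ha : 0 < a) (x y : E) :
    cutNewton a x y ≤ ‖y - x‖ ^ (-((d : ℝ) - 2)) := by
  rw [← scale_rpow ha (norm_nonneg (y - x))]
  exact mul_le_mul_of_nonneg_left (cutPow_le (by positivity)) (by positivity)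

theorem contDiff_cutNewton (a : ℝ) (x : E) {n : WithTop ℕ∞} (hn : n ≤ (⊤ : ℕ∞)) :
    ContDiff ℝ n (cutNewton a x) := by
  refine contDiff_const.mul ((contDiff_cutPow _ hn).comp ?_)
  exact ((contDiff_id.sub contDiff_const).norm_sq ℝ).div_const _

theorem laplacian_cutNewton {a : ℝ} (ha : 0 < a) (x y : E) :
    Δ (cutNewton a x) y = -(a ^ (-(d : ℝ)) * cutLaplacian d (‖y - x‖ ^ 2 / a ^ 2)) := by
  set m := ((d : ℝ) - 2) / 2 with hm
  have g1 : ∀ s, HasDerivAt (cutPow m) (deriv (cutPow m) s) s := fun s =>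
    ((contDiff_cutPow m (n := 1) (by exact_mod_cast le_top)).differentiable one_ne_zero
      s).hasDerivAt
  have g2 : ∀ s, HasDerivAt (deriv (cutPow m)) (deriv (deriv (cutPow m)) s) s := fun s =>
    ((contDiff_deriv_cutPow m).differentiable one_ne_zero s).hasDerivAt
  have hdiv : ∀ s, HasDerivAt (fun s : ℝ => s / a ^ 2) (1 / a ^ 2) s := fun s =>
    (hasDerivAt_id s).div_const _
  have := laplacian_radial (H := fun r => a ^ (-((d : ℝ) - 2)) * cutPow m (r / a ^ 2))
    (H' := fun r => a ^ (-((d : ℝ) - 2)) * (deriv (cutPow m) (r / a ^ 2) * (1 / a ^ 2)))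
    (h := a ^ (-((d : ℝ) - 2)) *
      (deriv (deriv (cutPow m)) (‖y - x‖ ^ 2 / a ^ 2) * (1 / a ^ 2) * (1 / a ^ 2))) x y
    (Eventually.of_forall fun r => ((g1 _).comp r (hdiv r)).const_mul _)
    ((((g2 _).comp _ (hdiv _)).mul_const _).const_mul _)
  have e : (fun y => a ^ (-((d : ℝ) - 2)) * cutPow m (‖y - x‖ ^ 2 / a ^ 2)) = cutNewton a x := rfl
  rw [e] at this
  rw [this, cutLaplacian, ← hm, finrank_euclideanSpace_fin,
    show -((d : ℝ) - 2) = -d + (2 : ℕ) by push_cast; ring,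
    Real.rpow_add_natCast ha.ne']
  field_simp

/-- `-Δ` of the truncated Newtonian kernel: an approximate identity, up to its mass. -/
def cutKernel (a : ℝ) (x y : E) : ℝ := a ^ (-(d : ℝ)) * cutLaplacian d (‖y - x‖ ^ 2 / a ^ 2)

theorem continuous_cutKernel (a : ℝ) (x : E) : Continuous (cutKernel a x) := by
  have := continuous_cutLaplacian (d := d)
  unfold cutKernel
  fun_prop

theorem cutKernel_of_notMem {a : ℝ} (ha : 0 < a) {x y : E} (h : y ∉ closedBall x a) :
    cutKernel a x y = 0 := by
  rw [mem_closedBall, dist_eq_norm, not_le] at h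
  rw [cutKernel, cutLaplacian_of_one_lt, mul_zero]
  rw [one_lt_div (by positivity)]
  gcongr

theorem hasCompactSupport_cutKernel {a : ℝ} (ha : 0 < a) (x : E) :
    HasCompactSupport (cutKernel a x) :=
  HasCompactSupport.intro (isCompact_closedBall x a) fun _ h => cutKernel_of_notMem ha h

/-- By scaling and translation the mass is independent of `a` and `x`. Its value is never computed;
its sign will follow from the equation itself. -/
theorem integral_cutKernel {a : ℝ} (ha : 0 < a) (x : E) :
    ∫ y, cutKernel a x y = ∫ z : E, cutLaplacian d (‖z‖ ^ 2) := by
  have h1 : ∀ y : E, cutKernel a x y =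
      a ^ (-(d : ℝ)) * (fun z : E => cutLaplacian d (‖a⁻¹ • z‖ ^ 2)) (y - x) := by
    intro y
    rw [cutKernel]
    beta_reduce
    rw [norm_smul, mul_pow, norm_inv, Real.norm_of_nonneg ha.le, inv_pow, ← div_eq_inv_mul]
  simp_rw [h1]
  rw [integral_const_mul, integral_sub_right_eq_self (fun z : E => cutLaplacian d (‖a⁻¹ • z‖ ^ 2)),
    Measure.integral_comp_smul_of_nonneg volume (fun z : E => cutLaplacian d (‖z‖ ^ 2)) a⁻¹
      (hR := by positivity), finrank_euclideanSpace_fin, smul_eq_mul, ← mul_assoc,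
    Real.rpow_neg ha.le, Real.rpow_natCast, inv_pow, inv_inv,
    inv_mul_cancel₀ (pow_pos ha d).ne', one_mul]

theorem integrable_mul_cutKernel {u : E → ℝ} (hu : LocallyIntegrable u volume) {a : ℝ}
    (ha : 0 < a) (x : E) : Integrable (fun y => u y * cutKernel a x y) := by
  have := hu.integrable_smul_left_of_hasCompactSupport (continuous_cutKernel a x)
    (hasCompactSupport_cutKernel ha x)
  simpa only [smul_eq_mul, mul_comm] using this

theorem abs_cutKernel_le {M : ℝ} (hM : ∀ r, 0 ≤ r → |cutLaplacian d r| ≤ M) {a : ℝ} (ha : 0 < a)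
    (x y : E) : |cutKernel a x y| ≤ a ^ (-(d : ℝ)) * M := by
  rw [cutKernel, abs_mul, abs_of_pos (by positivity)]
  gcongr
  exact hM _ (by positivity)

/-- The kernel has size `a^(-d)` on a ball of radius `a`, so convergence holds at every Lebesgue
point even though the kernel may change sign. -/
theorem ae_tendsto_integral_mul_cutKernel {u : E → ℝ} (hu : LocallyIntegrable u volume) :
    ∀ᵐ x, Tendsto (fun a => ∫ y, u y * cutKernel a x y) (𝓝[>] 0)
      (𝓝 (u x * ∫ z : E, cutLaplacian d (‖z‖ ^ 2))) := by
  obtain ⟨M, hM0, hM⟩ := exists_abs_cutLaplacian_le d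
  filter_upwards [IsUnifLocDoublingMeasure.ae_tendsto_average_norm_sub volume hu 1] with x hx
  have h1 := hx (l := 𝓝[>] (0 : ℝ)) (fun _ => x) id tendsto_id (by
    filter_upwards [self_mem_nhdsWithin] with a ha
    exact mem_closedBall_self (by simpa using le_of_lt ha))
  rw [tendsto_iff_norm_sub_tendsto_zero]
  have h2 := h1.const_mul (M * volume.real (ball (0 : E) 1))
  rw [mul_zero] at h2
  refine squeeze_zero' (Eventually.of_forall fun _ => norm_nonneg _) ?_ h2
  filter_upwards [self_mem_nhdsWithin] with a ha
  have ha : 0 < a := ha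
  have hub : IntegrableOn (fun y => ‖u y - u x‖) (closedBall x a) := by
    refine Integrable.norm ((hu.integrableOn_isCompact (isCompact_closedBall x a)).sub ?_)
    exact integrableOn_const measure_closedBall_lt_top.ne
  have hck : Integrable (fun y => u x * cutKernel a x y) := by
    refine Integrable.const_mul ?_ _
    exact (continuous_cutKernel a x).integrable_of_hasCompactSupport
      (hasCompactSupport_cutKernel ha x)
  have hv : volume.real (closedBall x a) = a ^ d * volume.real (ball (0 : E) 1) := by
    rw [measureReal_def, volume_closedBall_eq x ha, ENNReal.toReal_mul,
      ENNReal.toReal_ofReal (by positivity), measureReal_def]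
  have hv1 : 0 < volume.real (ball (0 : E) 1) :=
    ENNReal.toReal_pos volume_unitBall_ne_zero volume_unitBall_ne_top
  rw [← integral_cutKernel ha x, ← integral_const_mul, ← integral_sub
    (integrable_mul_cutKernel hu ha x) hck]
  have h3 : ∀ y, u y * cutKernel a x y - u x * cutKernel a x y =
      (closedBall x a).indicator (fun y => (u y - u x) * cutKernel a x y) y := by
    intro y
    by_cases hy : y ∈ closedBall x a
    · rw [indicator_of_mem hy, sub_mul]
    · rw [indicator_of_notMem hy, cutKernel_of_notMem ha hy, mul_zero, mul_zero, sub_zero]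
  simp_rw [h3]
  rw [integral_indicator measurableSet_closedBall]
  refine (norm_integral_le_of_norm_le (hub.mul_const (a ^ (-(d : ℝ)) * M))
    (Eventually.of_forall fun y => ?_)).trans ?_
  · rw [norm_mul]
    exact mul_le_mul_of_nonneg_left (abs_cutKernel_le hM ha x y) (norm_nonneg _)
  · rw [integral_mul_const]
    simp only [id]
    rw [setAverage_eq, hv, smul_eq_mul, Real.rpow_neg ha.le, Real.rpow_natCast]
    apply le_of_eq
    have := pow_pos ha d
    field_simp

/-- Hölder on the ball of radius `R` gives decay `R^(-d) R^(d(1 - 1/p)) = R^(-d/p)`. This is how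
integrability of `u` excludes an additive harmonic part. -/
theorem tendsto_integral_mul_cutKernel_atTop {p : ℝ} (hp : 1 < p) {u : E → ℝ}
    (hm : AEStronglyMeasurable u volume) (hu : lpn p (fun x => ‖u x‖ₑ) ≠ ⊤) (hd : d ≠ 0) (x : E) :
    Tendsto (fun R => ∫ y, u y * cutKernel R x y) atTop (𝓝 0) := by
  obtain ⟨M, hM0, hM⟩ := exists_abs_cutLaplacian_le d
  set v := volume (ball (0 : E) 1)
  set N := lpn p (fun x => ‖u x‖ₑ)
  have hp0 : 0 < p := by linarith
  have hq : 0 < 1 - 1 / p := by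
    rw [sub_pos, div_lt_one hp0]; exact hp
  rw [tendsto_zero_iff_enorm_tendsto_zero]
  have h1 : Tendsto (fun R : ℝ => ENNReal.ofReal (R ^ (-(d / p))) *
      (ENNReal.ofReal M * (N * v ^ (1 - 1 / p)))) atTop (𝓝 0) := by
    have h2 : Tendsto (fun R : ℝ => ENNReal.ofReal (R ^ (-(d / p)))) atTop (𝓝 0) := by
      rw [← ENNReal.ofReal_zero]
      exact (ENNReal.continuous_ofReal.tendsto 0).comp (tendsto_rpow_neg_atTop (by positivity))
    have := ENNReal.Tendsto.mul_const (b := ENNReal.ofReal M * (N * v ^ (1 - 1 / p))) h2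
      (Or.inr (by
        have : v ^ (1 - 1 / p) ≠ ⊤ :=
          ENNReal.rpow_ne_top_of_nonneg hq.le volume_unitBall_ne_top
        finiteness))
    rwa [zero_mul] at this
  refine tendsto_of_tendsto_of_tendsto_of_le_of_le' tendsto_const_nhds h1
    (Eventually.of_forall fun _ => zero_le) ?_
  filter_upwards [eventually_gt_atTop 0] with R hR
  calc ‖∫ y, u y * cutKernel R x y‖ₑ ≤ ∫⁻ y, ‖u y * cutKernel R x y‖ₑ :=
        enorm_integral_le_lintegral_enorm _
    _ = ∫⁻ y in closedBall x R, ‖u y * cutKernel R x y‖ₑ := by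
        rw [← lintegral_indicator measurableSet_closedBall]
        congr 1
        ext y
        by_cases hy : y ∈ closedBall x R
        · rw [indicator_of_mem hy]
        · rw [indicator_of_notMem hy, cutKernel_of_notMem hR hy, mul_zero, enorm_zero]
    _ ≤ ∫⁻ y in closedBall x R, ‖u y‖ₑ * ENNReal.ofReal (R ^ (-(d : ℝ)) * M) := by
        refine lintegral_mono fun y => ?_
        rw [enorm_mul]
        gcongr
        rw [Real.enorm_eq_ofReal_abs]
        exact ENNReal.ofReal_le_ofReal (abs_cutKernel_le hM hR x y)
    _ = (∫⁻ y in closedBall x R, ‖u y‖ₑ) * ENNReal.ofReal (R ^ (-(d : ℝ)) * M) :=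
        lintegral_mul_const' _ _ ENNReal.ofReal_ne_top
    _ ≤ (N * volume (closedBall x R) ^ (1 - 1 / p)) * ENNReal.ofReal (R ^ (-(d : ℝ)) * M) := by
        gcongr
        exact setLIntegral_le_lpn_mul hp hm.enorm _
    _ = _ := by
        rw [volume_closedBall_eq x hR, ENNReal.mul_rpow_of_nonneg _ _ hq.le,
          ENNReal.ofReal_rpow_of_pos (by positivity), ENNReal.ofReal_mul (by positivity),
          ← Real.rpow_natCast R d, ← Real.rpow_mul hR.le]
        have : ENNReal.ofReal (R ^ (-((d : ℝ) / p))) =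
            ENNReal.ofReal (R ^ ((d : ℝ) * (1 - 1 / p))) * ENNReal.ofReal (R ^ (-(d : ℝ))) := by
          rw [← ENNReal.ofReal_mul (by positivity), ← Real.rpow_add hR]
          congr 2
          field_simp
          ring
        rw [this]
        ring

/-! ### From the distributional equation to the integral system -/

/-- True also where the potential is infinite: both the Bochner integral and `toReal` then take the
default value `0`. -/
theorem hartreePotential_eq_toReal (hd : d ≠ 0) {u : E → ℝ} (hu : AEStronglyMeasurable u volume)
    (x : E) : hartreePotential u x = (rieszPot 4 (fun y => ‖u y‖ₑ ^ 2) x).toReal := by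
  have hm : AEStronglyMeasurable (fun y => |u y| ^ 2 / ‖x - y‖ ^ 4) volume := by
    have := hu.aemeasurable
    have h1 : AEMeasurable (fun y => |u y|) volume := this.norm
    exact ((h1.pow_const 2).div (by fun_prop)).aestronglyMeasurable
  rw [hartreePotential, integral_eq_lintegral_of_nonneg_ae
    (Eventually.of_forall fun _ => by positivity) hm, rieszPot]
  congr 1
  refine lintegral_congr_ae ?_
  filter_upwards [ae_ne hd x] with y hy
  have hxy : 0 < ‖x - y‖ := norm_pos_iff.2 (sub_ne_zero.2 hy.symm)
  rw [edist_dist, dist_eq_norm, ENNReal.ofReal_rpow_of_pos hxy, Real.enorm_eq_ofReal_abs,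
    ← ENNReal.ofReal_pow (abs_nonneg _), ← ENNReal.ofReal_mul (by positivity), Real.rpow_neg hxy.le,
    div_eq_inv_mul]
  norm_cast

theorem lpn_enorm_ne_top {p : ℝ} (hp : 0 < p) {u : E → ℝ}
    (hu : MemLp u (ENNReal.ofReal p) volume) : lpn p (fun x => ‖u x‖ₑ) ≠ ⊤ := by
  have h := hu.2
  rw [eLpNorm_eq_lintegral_rpow_enorm_toReal (by simpa using hp) ENNReal.ofReal_ne_top,
    ENNReal.toReal_ofReal hp.le] at h
  exact h.ne

theorem integral_mul_norm_rpow_eq (hd : d ≠ 0) {a : ℝ} {F : E → ℝ}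
    (hF : AEStronglyMeasurable F volume) (hF0 : ∀ᵐ y, 0 ≤ F y) (x : E) :
    ∫ y, F y * ‖y - x‖ ^ (-a) = (rieszPot a (fun y => ‖F y‖ₑ) x).toReal := by
  have hm : Measurable fun y : E => ‖y - x‖ ^ (-a) := by fun_prop
  rw [integral_eq_lintegral_of_nonneg_ae (hF0.mono fun y hy => mul_nonneg hy (by positivity))
    (hF.mul hm.aestronglyMeasurable), rieszPot]
  congr 1
  refine lintegral_congr_ae ?_
  filter_upwards [hF0, ae_ne hd x] with y h0 hy
  have hxy : 0 < ‖y - x‖ := norm_pos_iff.2 (sub_ne_zero.2 hy)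
  rw [edist_comm, edist_dist, dist_eq_norm, ENNReal.ofReal_rpow_of_pos hxy,
    Real.enorm_eq_ofReal h0, ← ENNReal.ofReal_mul (by positivity), mul_comm]

theorem integrable_mul_norm_rpow (hd : d ≠ 0) {a : ℝ} {F : E → ℝ}
    (hF : AEStronglyMeasurable F volume) {x : E} (hx : rieszPot a (fun y => ‖F y‖ₑ) x ≠ ⊤) :
    Integrable fun y => F y * ‖y - x‖ ^ (-a) := by
  have hm : Measurable fun y : E => ‖y - x‖ ^ (-a) := by fun_prop
  refine ⟨hF.mul hm.aestronglyMeasurable, ?_⟩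
  refine lt_of_le_of_lt (le_of_eq ?_) hx.lt_top
  refine lintegral_congr_ae ?_
  filter_upwards [ae_ne hd x] with y hy
  have hxy : 0 < ‖y - x‖ := norm_pos_iff.2 (sub_ne_zero.2 hy)
  rw [edist_comm, edist_dist, dist_eq_norm, ENNReal.ofReal_rpow_of_pos hxy, enorm_mul,
    Real.enorm_eq_ofReal (by positivity : 0 ≤ ‖y - x‖ ^ (-a)), mul_comm]

/-- The truncated Newtonian kernels exhaust the Newtonian kernel. -/
theorem tendsto_integral_mul_cutNewton_sub (hd : d ≠ 0) {F : E → ℝ}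
    (hF : AEStronglyMeasurable F volume) {x : E}
    (hx : rieszPot ((d : ℝ) - 2) (fun y => ‖F y‖ₑ) x ≠ ⊤) :
    Tendsto (fun a => ∫ y, F y * (cutNewton a x y - cutNewton a⁻¹ x y)) (𝓝[>] 0)
      (𝓝 (∫ y, F y * ‖y - x‖ ^ (-((d : ℝ) - 2)))) := by
  have hint := integrable_mul_norm_rpow hd hF hx
  refine tendsto_integral_filter_of_dominated_convergence _ ?_ ?_ hint.norm ?_
  · refine Eventually.of_forall fun a => hF.mul ?_
    exact ((contDiff_cutNewton a x (n := 0) (by simp)).continuous.sub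
      (contDiff_cutNewton a⁻¹ x (n := 0) (by simp)).continuous).aestronglyMeasurable
  · filter_upwards [self_mem_nhdsWithin] with a ha
    have ha : 0 < a := ha
    refine Eventually.of_forall fun y => ?_
    rw [norm_mul, norm_mul]
    refine mul_le_mul_of_nonneg_left ?_ (norm_nonneg _)
    rw [Real.norm_of_nonneg (by positivity : 0 ≤ ‖y - x‖ ^ (-((d : ℝ) - 2))), Real.norm_eq_abs,
      abs_le]
    have h1 := cutNewton_nonneg ha x y
    have h2 := cutNewton_le ha x y
    have h3 := cutNewton_nonneg (inv_pos.2 ha) x y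
    have h4 := cutNewton_le (inv_pos.2 ha) x y
    constructor <;> linarith
  · filter_upwards [ae_ne hd x] with y hy
    have hxy : 0 < ‖y - x‖ := norm_pos_iff.2 (sub_ne_zero.2 hy)
    refine tendsto_const_nhds.congr' ?_
    have h1 : ∀ᶠ a in 𝓝[>] (0 : ℝ), a < ‖y - x‖ :=
      nhdsWithin_le_nhds (Iio_mem_nhds hxy)
    have h2 : ∀ᶠ a in 𝓝[>] (0 : ℝ), 2 * ‖y - x‖ ≤ a⁻¹ :=
      tendsto_inv_nhdsGT_zero.eventually (eventually_ge_atTop _)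
    filter_upwards [h1, h2, self_mem_nhdsWithin] with a h1 h2 ha
    rw [cutNewton_of_le ha h1.le, cutNewton_of_two_mul_le (inv_pos.2 ha) h2, sub_zero]

/-- Testing a distributional equation with the difference of two truncated kernels. -/
theorem integral_mul_cutKernel_sub {u F : E → ℝ} (hu : LocallyIntegrable u volume)
    (h : ∀ φ : E → ℝ, ContDiff ℝ ∞ φ → HasCompactSupport φ →
      ∫ x, u x * (-(Δ φ x)) = ∫ x, F x * φ x) (x : E) {a R : ℝ} (ha : 0 < a) (hR : 0 < R) :
    (∫ y, u y * cutKernel a x y) - ∫ y, u y * cutKernel R x y =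
      ∫ y, F y * (cutNewton a x y - cutNewton R x y) := by
  have hs : ∀ b, ContDiff ℝ ∞ (cutNewton b x) := fun b => contDiff_cutNewton b x le_rfl
  have h2 : ∀ b y, ContDiffAt ℝ 2 (cutNewton b x) y := fun b y =>
    (contDiff_cutNewton b x (WithTop.coe_le_coe.2 le_top :
      ((2 : ℕ∞) : WithTop ℕ∞) ≤ _)).contDiffAt
  -- Both truncations equal the Newtonian kernel away from `x`, so their difference is an admissible
  -- test function.
  have := h (cutNewton a x - cutNewton R x) ((hs a).sub (hs R)) (by
    refine HasCompactSupport.intro (isCompact_closedBall x (max a R)) fun y hy => ?_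
    rw [mem_closedBall, dist_eq_norm, not_le, max_lt_iff] at hy
    rw [Pi.sub_apply, cutNewton_of_le ha hy.1.le, cutNewton_of_le hR hy.2.le, sub_self])
  simp only [Pi.sub_apply] at this
  rw [← this, ← integral_sub (integrable_mul_cutKernel hu ha x) (integrable_mul_cutKernel hu hR x)]
  congr 1
  ext y
  rw [ContDiffAt.laplacian_sub (h2 a y) (h2 R y), laplacian_cutNewton ha, laplacian_cutNewton hR]
  simp only [cutKernel]
  ring

/-- Newtonian representation: as the inner scale tends to `0` and the outer one to `∞`, one side
tends to `κ u(x)`, the other to the Newtonian potential `N` of the nonlinearity. -/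
theorem IsPositiveHartreeSolution.exists_isHartreeSystem (hd : 5 ≤ d) {u : E → ℝ}
    (h : IsPositiveHartreeSolution u) :
    ∃ (C : ℝ≥0∞) (U : E → ℝ≥0∞), IsHartreeSystem C U ∧ ∀ᵐ x, U x = ENNReal.ofReal (u x) := by
  have hd5 := five_le_cast hd
  have hd0 : d ≠ 0 := by omega
  have h2 : (0 : ℝ) < d - 2 := by linarith
  have hp0 : 0 < 2 * (d : ℝ) / (d - 2) := by positivity
  have hp1 : 1 < 2 * (d : ℝ) / (d - 2) := by rw [lt_div_iff₀ h2]; linarith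
  have hL := lpn_enorm_ne_top hp0 h.memLp
  have hloc : LocallyIntegrable u volume := h.memLp.locallyIntegrable (by
    rw [← ENNReal.ofReal_one]; exact ENNReal.ofReal_le_ofReal hp1.le)
  have hum := h.memLp.1
  set w : E → ℝ≥0∞ := fun x => ‖hum.mk u x‖ₑ with hw
  have hwm : Measurable w := hum.stronglyMeasurable_mk.measurable.enorm
  have hwu : w =ᵐ[volume] fun x => ‖u x‖ₑ := hum.ae_eq_mk.mono fun x hx => by simp only [hw, ← hx]
  have hwL : lpn (2 * d / (d - 2)) w ≠ ⊤ := by rwa [lpn_congr hwu]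
  have hw2 : rieszPot 4 (fun y => ‖u y‖ₑ ^ 2) = rieszPot 4 (fun y => w y ^ 2) :=
    rieszPot_congr (hwu.mono fun x hx => by simp only [hx])
  set V := rieszPot 4 (fun y => w y ^ 2) with hV
  have hVm : Measurable V :=
    (lowerSemicontinuous_rieszPot 4 (hwm.pow_const 2).aemeasurable).measurable
  have hVL : lpn (d / 2) V ≠ ⊤ := lpn_rieszPot_four_sq_ne_top hd hwm.aemeasurable hwL
  have hVt := ae_lt_top_of_lpn_ne_top (by positivity) hVm hVL
  have hF0L : lpn (2 * d / (d + 2)) (fun x => V x * w x) ≠ ⊤ := by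
    refine ne_top_of_le_ne_top (ENNReal.mul_ne_top hVL hwL)
      (lpn_mul_le (by positivity) ?_ ?_ hVm hwm)
    · rw [div_lt_div_iff₀ (by positivity) two_pos]; nlinarith
    · field_simp; ring
  have hFm0 : Measurable fun x => V x * w x := hVm.mul hwm
  set F : E → ℝ := fun y => hartreePotential u y * u y with hF
  have hpot : hartreePotential u = fun y => (V y).toReal := by
    ext y; rw [hartreePotential_eq_toReal hd0 hum, hw2]
  have hFm : AEStronglyMeasurable F volume := by
    rw [hF, hpot]; exact hVm.ennreal_toReal.aestronglyMeasurable.mul hum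
  have hFe : (fun y => ‖F y‖ₑ) =ᵐ[volume] fun y => V y * w y := by
    filter_upwards [hVt, hwu] with y hy hwy
    simp only [hF, hpot]
    rw [enorm_mul, hwy, Real.enorm_eq_ofReal ENNReal.toReal_nonneg, ENNReal.ofReal_toReal hy.ne]
  have hFpos : ∀ᵐ y, 0 ≤ F y := h.pos.mono fun y hy => by
    simp only [hF, hpot]; positivity
  set N := rieszPot ((d : ℝ) - 2) (fun y => V y * w y) with hN
  have hNF : rieszPot ((d : ℝ) - 2) (fun y => ‖F y‖ₑ) = N := rieszPot_congr hFe
  have hNm : Measurable N := (lowerSemicontinuous_rieszPot _ hFm0.aemeasurable).measurable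
  have hNt : ∀ᵐ x, N x < ⊤ := by
    obtain ⟨K, hK, hH⟩ := exists_lpn_rieszPot_sub_two_le hd
    exact ae_lt_top_of_lpn_ne_top hp0 hNm
      (ne_top_of_le_ne_top (ENNReal.mul_ne_top hK hF0L) (hH _ hFm0.aemeasurable))
  have hwpos : ∀ᵐ x, 0 < w x := by
    filter_upwards [hwu, h.pos] with x hx hp
    rw [hx]; simpa using hp.ne'
  have hN0 : ∀ x, N x ≠ 0 := by
    refine rieszPot_ne_zero h2 hFm0.aemeasurable (hwpos.mono fun x hx => ?_)
    have := rieszPot_ne_zero four_pos (hwm.pow_const 2).aemeasurable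
      (hwpos.mono fun x hx => ENNReal.pow_pos hx 2) x
    exact ENNReal.mul_pos this hx.ne'
  set κ := ∫ z : E, cutLaplacian d (‖z‖ ^ 2)
  have hkey : ∀ᵐ x, u x * κ = (N x).toReal := by
    filter_upwards [ae_tendsto_integral_mul_cutKernel hloc, hNt] with x hx hNx
    have t1 := tendsto_integral_mul_cutNewton_sub hd0 hFm (x := x) (by rw [hNF]; exact hNx.ne)
    rw [integral_mul_norm_rpow_eq hd0 hFm hFpos, hNF] at t1
    have t2 := hx.sub ((tendsto_integral_mul_cutKernel_atTop hp1 hum hL hd0 x).comp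
      tendsto_inv_nhdsGT_zero)
    rw [sub_zero] at t2
    refine tendsto_nhds_unique t2 (t1.congr' ?_)
    filter_upwards [self_mem_nhdsWithin] with a ha
    exact (integral_mul_cutKernel_sub hloc h.solves x ha (inv_pos.2 ha)).symm
  -- In `u x * κ = N x` both `u x` and `N x` are positive at some point, which decides the sign of
  -- `κ`.
  have hκ : 0 < κ := by
    obtain ⟨x, h1, h2, h3⟩ := (hkey.and (hNt.and h.pos)).exists
    have := ENNReal.toReal_pos (hN0 x) h2.ne
    rw [← h1] at this
    exact pos_of_mul_pos_right this h3.le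
  set C := ENNReal.ofReal κ⁻¹ with hC
  have hU : (fun x => C * N x) =ᵐ[volume] fun x => ENNReal.ofReal (u x) := by
    filter_upwards [hkey, hNt] with x hx hNx
    rw [← ENNReal.ofReal_toReal hNx.ne, ← hx, hC, ← ENNReal.ofReal_mul (by positivity)]
    congr 1
    field_simp
  have hUw : (fun x => C * N x) =ᵐ[volume] w := by
    filter_upwards [hU, hwu, h.pos] with x h1 h2 h3
    rw [h1, h2, Real.enorm_eq_ofReal h3.le]
  -- Taking the right-hand side as representative makes the equation hold at every point, since
  -- potentials ignore null sets.
  refine ⟨C, fun x => C * N x, ⟨hd, ?_, ENNReal.ofReal_ne_top, hNm.const_mul C, ?_, ?_, ?_⟩, hU⟩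
  · simpa [hC] using hκ
  · intro x
    have e1 : rieszPot 4 (fun z => (C * N z) ^ 2) = V :=
      rieszPot_congr (hUw.mono fun x hx => by simp only [hx])
    rw [e1]
    have e2 : rieszPot ((d : ℝ) - 2) (fun y => V y * (C * N y)) = N :=
      rieszPot_congr (hUw.mono fun x hx => by simp only [hx])
    rw [e2]
  · rwa [lpn_congr hUw]
  · filter_upwards [hUw, hwpos] with x h1 h2
    rwa [h1]

/-! ### Green's identity by two integrations by parts -/

/-- Symmetry of the Laplacian, tested against a compactly supported function. -/
theorem integral_mul_laplacian_eq {V : Type*} [NormedAddCommGroup V] [InnerProductSpace ℝ V]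
    [FiniteDimensional ℝ V] [MeasurableSpace V] [BorelSpace V] {f φ : V → ℝ}
    (hf : ContDiff ℝ 2 f) (hφ : ContDiff ℝ 2 φ) (hc : HasCompactSupport φ) :
    ∫ x, f x * Δ φ x = ∫ x, Δ f x * φ x := by
  let b := stdOrthonormalBasis ℝ V
  rw [InnerProductSpace.laplacian_eq_iteratedFDeriv_orthonormalBasis f b,
    InnerProductSpace.laplacian_eq_iteratedFDeriv_orthonormalBasis φ b]
  simp only [iteratedFDeriv_two_apply, Matrix.cons_val_zero, Matrix.cons_val_one, Finset.mul_sum,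
    Finset.sum_mul]
  have hf1 : ContDiff ℝ 1 (fderiv ℝ f) := hf.fderiv_right (by norm_num)
  have hφ1 : ContDiff ℝ 1 (fderiv ℝ φ) := hφ.fderiv_right (by norm_num)
  have hf2 : Continuous (fderiv ℝ (fderiv ℝ f)) := hf1.continuous_fderiv one_ne_zero
  have hφ2 : Continuous (fderiv ℝ (fderiv ℝ φ)) := hφ1.continuous_fderiv one_ne_zero
  have hc1 : HasCompactSupport (fderiv ℝ φ) := hc.fderiv ℝ
  have hc2 : HasCompactSupport (fderiv ℝ (fderiv ℝ φ)) := hc1.fderiv ℝ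
  have key : ∀ {g h : V → ℝ}, Continuous g → Continuous h → HasCompactSupport h →
      Integrable (fun x => g x * h x) := fun hg hh hs =>
    (hg.mul hh).integrable_of_hasCompactSupport hs.mul_left
  have hs1 : ∀ v, HasCompactSupport fun x => fderiv ℝ φ x v := fun v =>
    hc1.mono' fun x hx => subset_tsupport _ fun h0 => hx (by simp only [h0]; rfl)
  have hs2 : ∀ v, HasCompactSupport fun x => fderiv ℝ (fderiv ℝ φ) x v v := fun v =>
    hc2.mono' fun x hx => subset_tsupport _ fun h0 => hx (by simp only [h0]; rfl)
  have hcf : ∀ v, Continuous fun x => fderiv ℝ f x v := fun v => hf1.continuous.clm_apply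
    continuous_const
  have hcφ : ∀ v, Continuous fun x => fderiv ℝ φ x v := fun v => hφ1.continuous.clm_apply
    continuous_const
  have hcf2 : ∀ v, Continuous fun x => fderiv ℝ (fderiv ℝ f) x v v := fun v =>
    (hf2.clm_apply continuous_const).clm_apply continuous_const
  have hcφ2 : ∀ v, Continuous fun x => fderiv ℝ (fderiv ℝ φ) x v v := fun v =>
    (hφ2.clm_apply continuous_const).clm_apply continuous_const
  have hdf : Differentiable ℝ (fderiv ℝ f) := hf1.differentiable one_ne_zero
  have hdφ : Differentiable ℝ (fderiv ℝ φ) := hφ1.differentiable one_ne_zero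
  have h2 : ∀ {g : V → ℝ} (_ : Differentiable ℝ (fderiv ℝ g)) (v x : V),
      fderiv ℝ (fderiv ℝ g) x v v = fderiv ℝ (fun y => fderiv ℝ g y v) x v := by
    intro g hg v x
    rw [fderiv_clm_apply (hg x) (differentiableAt_const v)]
    simp
  rw [integral_finsetSum _ fun i _ => key hf.continuous (hcφ2 _) (hs2 _),
    integral_finsetSum _ fun i _ => key (hcf2 _) hφ.continuous hc]
  refine Finset.sum_congr rfl fun i _ => ?_
  have hfd : Differentiable ℝ f := hf.differentiable two_ne_zero
  have hφd : Differentiable ℝ φ := hφ.differentiable two_ne_zero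
  have i1 := integral_mul_fderiv_eq_neg_fderiv_mul_of_integrable (μ := volume) (f := f)
    (g := fun x => fderiv ℝ φ x (b i)) (v := b i) (key (hcf _) (hcφ _) (hs1 _))
    (by simpa only [← h2 hdφ] using key hf.continuous (hcφ2 (b i)) (hs2 _))
    (key hf.continuous (hcφ _) (hs1 _)) (fun x _ => hfd x)
    (fun x _ => (hdφ x).clm_apply (differentiableAt_const _))
  have i2 := integral_mul_fderiv_eq_neg_fderiv_mul_of_integrable (μ := volume) (g := φ)
    (f := fun x => fderiv ℝ f x (b i)) (v := b i)
    (by simpa only [← h2 hdf] using key (hcf2 (b i)) hφ.continuous hc)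
    (key (hcf _) (hcφ _) (hs1 _))
    (key (hcf _) hφ.continuous hc) (fun x _ => (hdf x).clm_apply (differentiableAt_const _))
    (fun x _ => hφd x)
  simp only [← h2 hdf, ← h2 hdφ] at i1 i2
  rw [i1, i2, neg_neg]

/-! ### The Hartree potential of a bubble by conformal symmetry -/

section Weight

open EuclideanGeometry (inversion)

/-- The conformal weight of the bubble of scale `t` centred at `x₀`. -/
def bubbleWeight (t : ℝ) (x₀ x : E) : ℝ := t / (t ^ 2 + ‖x - x₀‖ ^ 2)

theorem bubbleWeight_pos {t : ℝ} (ht : 0 < t) (x₀ x : E) : 0 < bubbleWeight t x₀ x := by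
  unfold bubbleWeight; positivity

theorem bubbleWeight_self {t : ℝ} (ht : 0 < t) (x₀ : E) : bubbleWeight t x₀ x₀ = t⁻¹ := by
  rw [bubbleWeight, sub_self, norm_zero]
  field_simp
  ring

theorem measurable_bubbleWeight (t : ℝ) (x₀ : E) : Measurable (bubbleWeight t x₀) := by
  unfold bubbleWeight; fun_prop

theorem norm_inversion_sub_sq (p x₀ y : E) (R : ℝ) :
    ‖inversion p R y - x₀‖ ^ 2 = ((R / dist y p) ^ 2) ^ 2 * ‖y - p‖ ^ 2 +
      (R / dist y p) ^ 2 * (‖y - x₀‖ ^ 2 - ‖y - p‖ ^ 2 - ‖p - x₀‖ ^ 2) + ‖p - x₀‖ ^ 2 := by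
  set s := (R / dist y p) ^ 2
  have h1 : inversion p R y - x₀ = s • (y - p) + (p - x₀) := by
    simp [inversion, s]; abel
  have h2 : y - x₀ = (y - p) + (p - x₀) := by abel
  rw [h1, h2, norm_add_sq_real, norm_add_sq_real, norm_smul, inner_smul_left, mul_pow,
    Real.norm_eq_abs, sq_abs]
  simp only [conj_trivial]
  ring

/-- Inversions in spheres of radius `√(t² + |p - x₀|²)` preserve the weight. -/
theorem bubbleWeight_inversion {t R : ℝ} (ht : 0 < t) {p x₀ y : E} (hR : 0 < R)
    (hRt : R ^ 2 = t ^ 2 + ‖p - x₀‖ ^ 2) (hy : y ≠ p) :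
    (R / dist y p) ^ 2 * bubbleWeight t x₀ (inversion p R y) = bubbleWeight t x₀ y := by
  have hn := dist_pos.2 hy
  have hs : 0 < (R / dist y p) ^ 2 := by positivity
  have hsn : (R / dist y p) ^ 2 * ‖y - p‖ ^ 2 = R ^ 2 := by
    rw [← dist_eq_norm, div_pow, div_mul_cancel₀ _ (by positivity)]
  have e : t ^ 2 + ‖inversion p R y - x₀‖ ^ 2 =
      (R / dist y p) ^ 2 * (t ^ 2 + ‖y - x₀‖ ^ 2) := by
    rw [norm_inversion_sub_sq]
    linear_combination ((R / dist y p) ^ 2 - 1) * hsn + (1 - (R / dist y p) ^ 2) * (-1) * hRt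
  rw [bubbleWeight, bubbleWeight, e]
  have : 0 < t ^ 2 + ‖y - x₀‖ ^ 2 := by positivity
  field_simp

/-- Inversions about the centre change the scale of the weight. -/
theorem bubbleWeight_inversion_self {t R : ℝ} (ht : 0 < t) {x₀ y : E} (hR : 0 < R) (hy : y ≠ x₀) :
    (R / dist y x₀) ^ 2 * bubbleWeight t x₀ (inversion x₀ R y) =
      bubbleWeight (R ^ 2 / t) x₀ y := by
  have hn := dist_pos.2 hy
  rw [bubbleWeight, bubbleWeight, ← dist_eq_norm, ← dist_eq_norm,
    EuclideanGeometry.dist_inversion_center]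
  have : 0 < t ^ 2 + (R ^ 2 / dist y x₀) ^ 2 := by positivity
  have : 0 < (R ^ 2 / t) ^ 2 + dist y x₀ ^ 2 := by positivity
  field_simp
  ring

/-- The source of the Hartree potential of a bubble. -/
def bubbleSource (t : ℝ) (x₀ y : E) : ℝ≥0∞ := ENNReal.ofReal (bubbleWeight t x₀ y) ^ ((d : ℝ) - 2)

theorem kelvin_bubbleSource (hd : 5 ≤ d) {t t' R : ℝ} {p x₀ y : E} (hR : 0 < R)
    (h : (R / dist y p) ^ 2 * bubbleWeight t x₀ (inversion p R y) = bubbleWeight t' x₀ y) :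
    kelvin (2 * d - 4) p R (bubbleSource t x₀) y = bubbleSource t' x₀ y := by
  have hd5 := five_le_cast hd
  have h2 : (0 : ℝ) ≤ d - 2 := by linarith
  rw [bubbleSource, ← h, ENNReal.ofReal_mul (by positivity), ENNReal.mul_rpow_of_nonneg _ _ h2,
    kelvin, bubbleSource, ENNReal.ofReal_pow (by positivity), ← ENNReal.rpow_natCast,
    ← ENNReal.rpow_mul]
  congr 2
  push_cast; ring

theorem rieszPot_bubbleSource_inversion (hd : 5 ≤ d) {t t' R : ℝ} {p x₀ : E} (hR : 0 < R)
    (h : ∀ y, y ≠ p →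
      (R / dist y p) ^ 2 * bubbleWeight t x₀ (inversion p R y) = bubbleWeight t' x₀ y)
    {y : E} (hy : y ≠ p) :
    rieszPot 4 (bubbleSource t' x₀) y =
      ENNReal.ofReal ((R / dist y p) ^ 2) ^ 2 *
        rieszPot 4 (bubbleSource t x₀) (inversion p R y) := by
  have hd0 : d ≠ 0 := by omega
  have h1 : rieszPot 4 (bubbleSource t' x₀) =
      rieszPot 4 (kelvin (2 * d - 4) p R (bubbleSource t x₀)) :=
    rieszPot_congr ((ae_ne hd0 p).mono fun z hz => (kelvin_bubbleSource hd hR (h z hz)).symm)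
  rw [h1, ← kelvin_rieszPot hd0 hR _ hy, kelvin, invFactor, ENNReal.ofReal_pow (by positivity),
    ← pow_mul, ← ENNReal.rpow_natCast]
  norm_num

/-- The weight-preserving inversions carry the centre `x₀` to every other point. The centre `p` lies
on the line through `x` and `x₀`, on the side opposite to `x`, at distance `t² / |x - x₀|` from
`x₀`. -/
theorem exists_inversion_eq {t : ℝ} (ht : 0 < t) {x₀ x : E} (hx : x ≠ x₀) :
    ∃ (p : E) (R : ℝ), 0 < R ∧ R ^ 2 = t ^ 2 + ‖p - x₀‖ ^ 2 ∧ x₀ ≠ p ∧ inversion p R x₀ = x := by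
  have hn : 0 < ‖x - x₀‖ := norm_pos_iff.2 (sub_ne_zero.2 hx)
  have hpd : ∀ p : E, p = x₀ - (t ^ 2 / ‖x - x₀‖ ^ 2) • (x - x₀) → ‖p - x₀‖ = t ^ 2 / ‖x - x₀‖ := by
    rintro p rfl
    rw [sub_sub_cancel_left, norm_neg, norm_smul, Real.norm_of_nonneg (by positivity)]
    field_simp
  obtain ⟨p, hp⟩ : ∃ p : E, p = x₀ - (t ^ 2 / ‖x - x₀‖ ^ 2) • (x - x₀) := ⟨_, rfl⟩
  have hpn := hpd p hp
  have hRs : Real.sqrt (t ^ 2 + ‖p - x₀‖ ^ 2) ^ 2 = t ^ 2 + ‖p - x₀‖ ^ 2 :=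
    Real.sq_sqrt (by positivity)
  have hpx : x₀ ≠ p := by
    intro h
    rw [← h, sub_self, norm_zero] at hpn
    exact (div_pos (pow_pos ht 2) hn).ne hpn
  refine ⟨p, Real.sqrt (t ^ 2 + ‖p - x₀‖ ^ 2), by positivity, hRs, hpx, ?_⟩
  have hs : (Real.sqrt (t ^ 2 + ‖p - x₀‖ ^ 2) / dist x₀ p) ^ 2 = 1 + ‖x - x₀‖ ^ 2 / t ^ 2 := by
    rw [div_pow, hRs, dist_comm, dist_eq_norm, hpn]
    field_simp
    ring
  simp only [inversion, hs, vsub_eq_sub, vadd_eq_add]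
  have e : x₀ - p = (t ^ 2 / ‖x - x₀‖ ^ 2) • (x - x₀) := by rw [hp, sub_sub_cancel]
  rw [e, smul_smul]
  nth_rw 1 [hp]
  have e3 : (1 + ‖x - x₀‖ ^ 2 / t ^ 2) * (t ^ 2 / ‖x - x₀‖ ^ 2) = t ^ 2 / ‖x - x₀‖ ^ 2 + 1 := by
    field_simp
  rw [e3, add_smul, one_smul]
  abel

/-- A weight-preserving inversion taking `x₀` to `x` transports the value of the potential, which
replaces any computation of the integral. -/
theorem rieszPot_bubbleSource_eq_center (hd : 5 ≤ d) {t : ℝ} (ht : 0 < t) (x₀ x : E) :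
    rieszPot 4 (bubbleSource t x₀) x =
      rieszPot 4 (bubbleSource t x₀) x₀ * ENNReal.ofReal (t * bubbleWeight t x₀ x) ^ 2 := by
  rcases eq_or_ne x x₀ with rfl | hx
  · rw [bubbleWeight_self ht, mul_inv_cancel₀ ht.ne', ENNReal.ofReal_one, one_pow, mul_one]
  obtain ⟨p, R, hR, hRt, hp, rfl⟩ := exists_inversion_eq ht hx
  have h1 := bubbleWeight_inversion ht hR hRt hp
  rw [bubbleWeight_self ht] at h1
  rw [rieszPot_bubbleSource_inversion hd hR (fun y hy => bubbleWeight_inversion ht hR hRt hy) hp,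
    mul_right_comm, ← mul_pow, ← ENNReal.ofReal_mul (by positivity), mul_left_comm, h1,
    mul_inv_cancel₀ ht.ne', ENNReal.ofReal_one, one_pow, one_mul]

/-- Inversion about `x₀` with radius `√t` turns scale `1` into scale `t`. As it is singular at `x₀`,
the potentials are compared at an auxiliary point `y ≠ x₀`. -/
theorem rieszPot_bubbleSource_center (hd : 5 ≤ d) {t : ℝ} (ht : 0 < t) (x₀ : E) :
    rieszPot 4 (bubbleSource t x₀) x₀ * ENNReal.ofReal t ^ 2 =
      rieszPot 4 (bubbleSource 1 x₀) x₀ := by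
  obtain ⟨y, hy⟩ := (ae_ne (by omega : d ≠ 0) x₀).exists
  have hR : 0 < Real.sqrt t := Real.sqrt_pos.2 ht
  have hself : ∀ y : E, y ≠ x₀ → (Real.sqrt t / dist y x₀) ^ 2 *
      bubbleWeight 1 x₀ (inversion x₀ (Real.sqrt t) y) = bubbleWeight t x₀ y := by
    intro y hy
    rw [bubbleWeight_inversion_self one_pos hR hy, Real.sq_sqrt ht.le, div_one]
  have h1 := rieszPot_bubbleSource_inversion hd hR hself hy
  rw [rieszPot_bubbleSource_eq_center hd ht, rieszPot_bubbleSource_eq_center hd one_pos,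
    mul_left_comm, ← mul_pow, ← ENNReal.ofReal_mul (by positivity), one_mul, hself y hy,
    ENNReal.ofReal_mul ht.le, mul_pow, ← mul_assoc] at h1
  have hw := bubbleWeight_pos ht x₀ y
  exact (ENNReal.mul_left_inj (by simpa using hw) (by finiteness)).1 h1

theorem rieszPot_bubbleSource_translate (x₀ : E) :
    rieszPot 4 (bubbleSource 1 x₀) x₀ = rieszPot 4 (bubbleSource 1 (0 : E)) 0 := by
  have h := lintegral_sub_right_eq_self (μ := volume)
    (fun z : E => edist 0 z ^ (-4 : ℝ) * bubbleSource 1 0 z) x₀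
  unfold rieszPot
  rw [← h]
  congr 1
  ext y
  simp only [bubbleSource, bubbleWeight, sub_zero]
  rw [← sub_self x₀, edist_sub_right]

/-- The constant in the Hartree potential of the standard bubble. -/
def bubbleConst (d : ℕ) : ℝ≥0∞ := rieszPot 4 (bubbleSource 1 (0 : EuclideanSpace ℝ (Fin d))) 0

theorem rieszPot_bubbleSource (hd : 5 ≤ d) {t : ℝ} (ht : 0 < t) (x₀ x : E) :
    rieszPot 4 (bubbleSource t x₀) x =
      bubbleConst d * ENNReal.ofReal (bubbleWeight t x₀ x) ^ 2 := by
  rw [rieszPot_bubbleSource_eq_center hd ht, ENNReal.ofReal_mul ht.le, mul_pow, ← mul_assoc,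
    rieszPot_bubbleSource_center hd ht, rieszPot_bubbleSource_translate, bubbleConst]

end Weight

/-! ### Bubbles as solutions -/

theorem bubble_eq (c t : ℝ) (x₀ x : E) :
    bubble c t x₀ x = c * bubbleWeight t x₀ x ^ (((d : ℝ) - 2) / 2) := rfl

theorem bubble_pos {c t : ℝ} (hc : 0 < c) (ht : 0 < t) (x₀ x : E) : 0 < bubble c t x₀ x :=
  mul_pos hc (Real.rpow_pos_of_pos (bubbleWeight_pos ht x₀ x) _)

theorem contDiff_bubbleWeight {t : ℝ} (ht : 0 < t) (x₀ : E) {n : WithTop ℕ∞} :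
    ContDiff ℝ n (bubbleWeight t x₀) :=
  contDiff_const.div (contDiff_const.add ((contDiff_id.sub contDiff_const).norm_sq ℝ))
    fun x => (by positivity : 0 < t ^ 2 + ‖x - x₀‖ ^ 2).ne'

theorem contDiff_bubble (c : ℝ) {t : ℝ} (ht : 0 < t) (x₀ : E) {n : WithTop ℕ∞} :
    ContDiff ℝ n (bubble c t x₀) :=
  contDiff_const.mul ((contDiff_bubbleWeight ht x₀).rpow_const_of_ne
    fun x => (bubbleWeight_pos ht x₀ x).ne')

theorem hasDerivAt_div_add_rpow {t r : ℝ} (ht : 0 < t) (hr : 0 < t ^ 2 + r) (k : ℝ) :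
    HasDerivAt (fun r => (t / (t ^ 2 + r)) ^ k) (-(k / t) * (t / (t ^ 2 + r)) ^ (k + 1)) r := by
  have h1 : HasDerivAt (fun r : ℝ => t / (t ^ 2 + r)) (-(t / (t ^ 2 + r) ^ 2)) r := by
    have := (hasDerivAt_const r t).div ((hasDerivAt_id r).const_add (t ^ 2)) hr.ne'
    refine this.congr_deriv ?_
    simp only [id]
    ring
  have hw : 0 < t / (t ^ 2 + r) := div_pos ht hr
  convert h1.rpow_const (p := k) (Or.inl hw.ne') using 1
  rw [show k + 1 = (k - 1) + (2 : ℕ) by push_cast; ring, Real.rpow_add_natCast hw.ne']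
  field_simp

theorem laplacian_bubble (c : ℝ) {t : ℝ} (ht : 0 < t) (x₀ x : E) :
    Δ (bubble c t x₀) x = -(d * (d - 2) * (bubbleWeight t x₀ x ^ 2 * bubble c t x₀ x)) := by
  set m := ((d : ℝ) - 2) / 2 with hm
  have hpos : 0 < t ^ 2 + ‖x - x₀‖ ^ 2 := by positivity
  have h1 := laplacian_radial (H := fun r => c * (t / (t ^ 2 + r)) ^ m)
    (H' := fun r => c * (-(m / t) * (t / (t ^ 2 + r)) ^ (m + 1)))
    (h := c * (-(m / t) * (-((m + 1) / t) * (t / (t ^ 2 + ‖x - x₀‖ ^ 2)) ^ (m + 1 + 1)))) x₀ x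
    (by
      have : ∀ᶠ r : ℝ in 𝓝 (‖x - x₀‖ ^ 2), 0 < t ^ 2 + r :=
        (by fun_prop : Continuous fun r : ℝ => t ^ 2 + r).continuousAt.eventually
          (lt_mem_nhds hpos)
      filter_upwards [this] with r hr
      exact (hasDerivAt_div_add_rpow ht hr m).const_mul c)
    (((hasDerivAt_div_add_rpow ht hpos (m + 1)).const_mul _).const_mul c)
  have e : (fun y => c * (t / (t ^ 2 + ‖y - x₀‖ ^ 2)) ^ m) = bubble c t x₀ := rfl
  rw [e] at h1
  have hw := bubbleWeight_pos ht x₀ x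
  rw [h1, bubble_eq, ← hm, finrank_euclideanSpace_fin]
  change 4 * ‖x - x₀‖ ^ 2 * (c * (-(m / t) * (-((m + 1) / t) *
    bubbleWeight t x₀ x ^ (m + 1 + 1)))) + 2 * d * (c * (-(m / t) *
    bubbleWeight t x₀ x ^ (m + 1))) = _
  rw [Real.rpow_add_one hw.ne', Real.rpow_add_one hw.ne']
  -- Eliminating the radius in favour of the weight leaves a polynomial identity in which only the
  -- term with the squared weight survives.
  have hr : ‖x - x₀‖ ^ 2 = t / bubbleWeight t x₀ x - t ^ 2 := by
    rw [bubbleWeight]; field_simp; ring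
  rw [hr, hm]
  field_simp
  ring

theorem memLp_bubble (hd : 5 ≤ d) {c t : ℝ} (hc : 0 < c) (ht : 0 < t) (x₀ : E) :
    MemLp (bubble c t x₀) (ENNReal.ofReal (2 * (d : ℝ) / ((d : ℝ) - 2))) volume := by
  have hd5 := five_le_cast hd
  have h2 : (0 : ℝ) < d - 2 := by linarith
  have hp0 : 0 < 2 * (d : ℝ) / (d - 2) := by positivity
  have hcont : Continuous (bubble c t x₀) := (contDiff_bubble c ht x₀ (n := 0)).continuous
  rw [← integrable_norm_rpow_iff hcont.aestronglyMeasurable (by simpa using hp0)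
    ENNReal.ofReal_ne_top, ENNReal.toReal_ofReal hp0.le]
  -- The critical power of the bubble is a multiple of `weight ^ d`, and the weight is at most `(t +
  -- t⁻¹) / (1 + ‖x - x₀‖²)`.
  have h1 := ((integrable_rpow_neg_one_add_norm_sq (μ := (volume : Measure E)) (r := 2 * d)
    (by rw [finrank_euclideanSpace_fin]; linarith)).comp_sub_right x₀).const_mul
      (c ^ (2 * (d : ℝ) / (d - 2)) * (t + t⁻¹) ^ (d : ℝ))
  refine h1.mono' ?_ (Eventually.of_forall fun x => ?_)
  · have : Continuous fun x => ‖bubble c t x₀ x‖ ^ (2 * (d : ℝ) / (d - 2)) :=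
      hcont.norm.rpow_const fun _ => Or.inr hp0.le
    exact this.aestronglyMeasurable
  · have hw := bubbleWeight_pos ht x₀ x
    rw [Real.norm_of_nonneg (by positivity), Real.norm_of_nonneg (bubble_pos hc ht x₀ x).le,
      bubble_eq, Real.mul_rpow hc.le (by positivity), ← Real.rpow_mul hw.le, mul_assoc]
    gcongr
    rw [show ((d : ℝ) - 2) / 2 * (2 * d / (d - 2)) = d by field_simp,
      show -(2 * (d : ℝ)) / 2 = -d by ring, Real.rpow_neg (by positivity),
      ← Real.inv_rpow (by positivity), ← Real.mul_rpow (by positivity) (by positivity)]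
    refine Real.rpow_le_rpow hw.le ?_ (by positivity)
    rw [bubbleWeight, ← div_eq_mul_inv, div_le_div_iff₀ (by positivity) (by positivity)]
    have : t * t⁻¹ = 1 := mul_inv_cancel₀ ht.ne'
    have h3 : t⁻¹ * t ^ 2 = t := by field_simp
    have : 0 ≤ t⁻¹ * ‖x - x₀‖ ^ 2 := by positivity
    have : 0 < t ^ 3 := by positivity
    nlinarith

theorem enorm_bubble_sq {c t : ℝ} (hc : 0 < c) (ht : 0 < t) (x₀ x : E) :
    ‖bubble c t x₀ x‖ₑ ^ 2 = ENNReal.ofReal (c ^ 2) * bubbleSource t x₀ x := by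
  have hw := bubbleWeight_pos ht x₀ x
  rw [Real.enorm_eq_ofReal (bubble_pos hc ht x₀ x).le, bubble_eq, bubbleSource,
    ENNReal.ofReal_rpow_of_pos hw, ← ENNReal.ofReal_mul (by positivity),
    ← ENNReal.ofReal_pow (by positivity), mul_pow, ← Real.rpow_natCast (_ ^ _) 2,
    ← Real.rpow_mul hw.le]
  congr 3
  push_cast; ring

theorem rieszPot_bubble (hd : 5 ≤ d) {c t : ℝ} (hc : 0 < c) (ht : 0 < t) (x₀ x : E) :
    rieszPot 4 (fun y => ‖bubble c t x₀ y‖ₑ ^ 2) x =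
      ENNReal.ofReal (c ^ 2) * (bubbleConst d * ENNReal.ofReal (bubbleWeight t x₀ x) ^ 2) := by
  rw [← rieszPot_bubbleSource hd ht x₀ x, rieszPot, rieszPot,
    ← lintegral_const_mul' _ _ ENNReal.ofReal_ne_top]
  congr 1
  ext y
  rw [enorm_bubble_sq hc ht, mul_left_comm]

theorem bubbleConst_ne_zero : bubbleConst d ≠ 0 := by
  have hm : Measurable (bubbleSource 1 (0 : E)) :=
    ((measurable_bubbleWeight 1 (0 : E)).ennreal_ofReal).pow_const _
  refine rieszPot_ne_zero four_pos hm.aemeasurable (Eventually.of_forall fun y => ?_) 0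
  exact ENNReal.rpow_pos (by simpa using bubbleWeight_pos one_pos 0 y) ENNReal.ofReal_ne_top

/-- Hardy–Littlewood–Sobolev makes the potential of the unit bubble finite almost everywhere, and
one point of finiteness suffices. -/
theorem bubbleConst_ne_top (hd : 5 ≤ d) : bubbleConst d ≠ ⊤ := by
  have hd5 := five_le_cast hd
  have h2 : (0 : ℝ) < d - 2 := by linarith
  have hL := lpn_enorm_ne_top (by positivity) (memLp_bubble hd one_pos one_pos (0 : E))
  have hm : Measurable fun x : E => ‖bubble 1 1 0 x‖ₑ :=
    (contDiff_bubble 1 one_pos (0 : E) (n := 0)).continuous.measurable.enorm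
  have hV := lpn_rieszPot_four_sq_ne_top hd hm.aemeasurable hL
  obtain ⟨x, hx⟩ := (ae_lt_top_of_lpn_ne_top (by positivity)
    (lowerSemicontinuous_rieszPot 4 (hm.pow_const 2).aemeasurable).measurable hV).exists
  rw [rieszPot_bubble hd one_pos one_pos] at hx
  intro htop
  have hw := bubbleWeight_pos one_pos (0 : E) x
  rw [htop, ENNReal.top_mul (by simpa using hw)] at hx
  simp at hx

theorem bubbleConst_toReal_pos (hd : 5 ≤ d) : 0 < (bubbleConst d).toReal :=
  ENNReal.toReal_pos bubbleConst_ne_zero (bubbleConst_ne_top hd)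

theorem hartreePotential_bubble (hd : 5 ≤ d) {c t : ℝ} (hc : 0 < c) (ht : 0 < t) (x₀ x : E) :
    hartreePotential (bubble c t x₀) x =
      c ^ 2 * (bubbleConst d).toReal * bubbleWeight t x₀ x ^ 2 := by
  rw [hartreePotential_eq_toReal (by omega)
    (contDiff_bubble c ht x₀ (n := 0)).continuous.aestronglyMeasurable, rieszPot_bubble hd hc ht,
    ENNReal.toReal_mul, ENNReal.toReal_mul, ENNReal.toReal_ofReal (by positivity),
    ENNReal.toReal_pow, ENNReal.toReal_ofReal (bubbleWeight_pos ht x₀ x).le, mul_assoc]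

/-- Both sides of the equation are multiples of the same functional of the test function. One
direction shows that bubbles solve; the other fixes the constant of a given solution. -/
theorem isHartreeSolution_bubble_iff (hd : 5 ≤ d) {c t : ℝ} (hc : 0 < c) (ht : 0 < t) (x₀ : E) :
    IsHartreeSolution (bubble c t x₀) ↔ (d : ℝ) * (d - 2) = c ^ 2 * (bubbleConst d).toReal := by
  set I : (E → ℝ) → ℝ := fun φ => ∫ x, bubbleWeight t x₀ x ^ 2 * bubble c t x₀ x * φ x with hI
  have hl : ∀ φ : E → ℝ, ContDiff ℝ ∞ φ → HasCompactSupport φ →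
      ∫ x, bubble c t x₀ x * (-(Δ φ x)) = d * (d - 2) * I φ := by
    intro φ hφ hs
    simp_rw [mul_neg]
    rw [integral_neg, integral_mul_laplacian_eq (contDiff_bubble c ht x₀)
      (hφ.of_le (WithTop.coe_le_coe.2 le_top : ((2 : ℕ∞) : WithTop ℕ∞) ≤ _)) hs, ← integral_neg,
      hI, ← integral_const_mul]
    congr 1
    ext x
    rw [laplacian_bubble c ht]
    ring
  have hr : ∀ φ : E → ℝ, ∫ x, hartreePotential (bubble c t x₀) x * bubble c t x₀ x * φ x =
      c ^ 2 * (bubbleConst d).toReal * I φ := by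
    intro φ
    rw [hI, ← integral_const_mul]
    congr 1
    ext x
    rw [hartreePotential_bubble hd hc ht]
    ring
  constructor
  · intro h
    -- A nonnegative bump makes the common functional nonzero, so it can be cancelled.
    let φ : ContDiffBump x₀ := ⟨1, 2, one_pos, one_lt_two⟩
    have h1 := h φ φ.contDiff φ.hasCompactSupport
    rw [hl φ φ.contDiff φ.hasCompactSupport, hr] at h1
    have hpos : 0 < I φ := by
      have hc1 : Continuous fun x => bubbleWeight t x₀ x ^ 2 * bubble c t x₀ x * φ x :=
        (((contDiff_bubbleWeight ht x₀ (n := 0)).continuous.pow 2).mul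
          (contDiff_bubble c ht x₀ (n := 0)).continuous).mul φ.continuous
      refine hc1.integral_pos_of_hasCompactSupport_nonneg_nonzero φ.hasCompactSupport.mul_left
        (fun x => ?_) (x := x₀) ?_
      · exact mul_nonneg (mul_nonneg (sq_nonneg _) (bubble_pos hc ht x₀ x).le) φ.nonneg
      · have := φ.pos_of_mem_ball (x := x₀) (mem_ball_self two_pos)
        exact (mul_pos (mul_pos (pow_pos (bubbleWeight_pos ht x₀ x₀) 2)
          (bubble_pos hc ht x₀ x₀)) this).ne'
    exact mul_right_cancel₀ hpos.ne' h1
  · intro h φ hφ hs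
    rw [hl φ hφ hs, hr, h]

theorem IsHartreeSolution.congr {u v : E → ℝ} (h : IsHartreeSolution u) (huv : u =ᵐ[volume] v) :
    IsHartreeSolution v := by
  intro φ hφ hs
  have e : hartreePotential u = hartreePotential v := by
    ext x
    exact integral_congr_ae (huv.mono fun y hy => by simp only [hy])
  have h1 := h φ hφ hs
  rw [e] at h1
  refine Eq.trans (integral_congr_ae ?_) (h1.trans (integral_congr_ae ?_))
  · filter_upwards [huv] with x hx
    rw [hx]
  · filter_upwards [huv] with x hx
    rw [hx]

/-! ### Normal form, scaling and the classification theorem -/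

theorem rpow_bubble_eq {a b : ℝ} (hb : 0 < b) (m r : ℝ) :
    a * (b + r ^ 2) ^ (-m) =
      a * Real.sqrt b ^ (-m) * (Real.sqrt b / (Real.sqrt b ^ 2 + r ^ 2)) ^ m := by
  have h1 := Real.sqrt_pos.2 hb
  rw [Real.sq_sqrt hb.le, Real.div_rpow h1.le (by positivity), Real.rpow_neg (by positivity),
    Real.rpow_neg h1.le]
  have := Real.rpow_pos_of_pos h1 m
  field_simp

theorem strictAntiOn_bubble_profile {c t m : ℝ} (hc : 0 < c) (ht : 0 < t) (hm : 0 < m) :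
    StrictAntiOn (fun r : ℝ => c * (t / (t ^ 2 + r ^ 2)) ^ m) (Ici 0) := by
  intro r hr s hs hrs
  have hr : 0 ≤ r := hr
  refine mul_lt_mul_of_pos_left (Real.rpow_lt_rpow (by positivity) ?_ hm) hc
  gcongr

theorem ae_comp_smul_sub {p : E → Prop} (hp : ∀ᵐ x, p x) {s : ℝ} (hs : s ≠ 0) (a : E) :
    ∀ᵐ x, p (s • (x - a)) := by
  have h1 : Measure.QuasiMeasurePreserving (fun x : E => s • x) volume volume :=
    ⟨measurable_const_smul s, by
      rw [Measure.map_addHaar_smul _ hs]; exact Measure.smul_absolutelyContinuous⟩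
  exact (measurePreserving_sub_right volume a).quasiMeasurePreserving.ae (h1.ae hp)

theorem bubble_comp_smul_sub {c t₁ t₂ : ℝ} (ht₁ : 0 < t₁) (ht₂ : 0 < t₂) (x₁ x₂ x : E) :
    bubble c t₂ x₂ x = (t₁ / t₂) ^ (((d : ℝ) - 2) / 2) *
      bubble c t₁ x₁ ((t₁ / t₂) • (x - (x₂ - (t₁ / t₂)⁻¹ • x₁))) := by
  have hs : 0 < t₁ / t₂ := div_pos ht₁ ht₂
  have e : (t₁ / t₂) • (x - (x₂ - (t₁ / t₂)⁻¹ • x₁)) - x₁ = (t₁ / t₂) • (x - x₂) := by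
    rw [← sub_add, smul_add, smul_smul, mul_inv_cancel₀ hs.ne', one_smul, add_sub_cancel_right]
  rw [bubble, bubble, e, norm_smul, Real.norm_of_nonneg hs.le, mul_left_comm,
    ← Real.mul_rpow hs.le (by positivity)]
  congr 2
  field_simp

/-- Every positive solution is a bubble with the constant determined by the dimension. -/
theorem IsPositiveHartreeSolution.exists_ae_eq_bubble (hd : 5 ≤ d) {u : E → ℝ}
    (h : IsPositiveHartreeSolution u) : ∃ (c t : ℝ) (x₀ : E), 0 < c ∧ 0 < t ∧
      (d : ℝ) * (d - 2) = c ^ 2 * (bubbleConst d).toReal ∧ ∀ᵐ x, u x = bubble c t x₀ x := by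
  obtain ⟨C, U, hU, hUu⟩ := h.exists_isHartreeSystem hd
  obtain ⟨a, b, e, ha, hb, hab⟩ := hU.exists_ae_eq_bubble
  have hsb := Real.sqrt_pos.2 hb
  have hc : 0 < a * Real.sqrt b ^ (-(((d : ℝ) - 2) / 2)) := by positivity
  have hu : ∀ᵐ x, u x = bubble (a * Real.sqrt b ^ (-(((d : ℝ) - 2) / 2))) (Real.sqrt b) e x := by
    filter_upwards [hUu, hab, h.pos] with x h1 h2 h3
    rw [h1, ENNReal.ofReal_eq_ofReal_iff h3.le (by positivity)] at h2
    rw [h2, rpow_bubble_eq hb, bubble]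
  exact ⟨_, _, e, hc, hsb, (isHartreeSolution_bubble_iff hd hc hsb e).1 (h.solves.congr hu), hu⟩

end

theorem propositionA1 (d : ℕ) (hd : 5 ≤ d) :
    (∃ c₀ : ℝ, 0 < c₀ ∧
      (∀ u : EuclideanSpace ℝ (Fin d) → ℝ, IsPositiveHartreeSolution u →
        ∃ x₀ : EuclideanSpace ℝ (Fin d), IsRadiallyDecreasingAbout x₀ u ∧
          ∃ t : ℝ, 0 < t ∧ ∀ᵐ x, u x = bubble c₀ t x₀ x) ∧
      (∀ (x₀ : EuclideanSpace ℝ (Fin d)) (t : ℝ), 0 < t →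
        IsPositiveHartreeSolution (bubble c₀ t x₀))) ∧
    (∀ u₁ u₂ : EuclideanSpace ℝ (Fin d) → ℝ,
      IsPositiveHartreeSolution u₁ → IsPositiveHartreeSolution u₂ →
        ∃ (a : EuclideanSpace ℝ (Fin d)) (s : ℝ), 0 < s ∧
          ∀ᵐ x, u₂ x = s ^ (((d : ℝ) - 2) / 2) * u₁ (s • (x - a))) := by
  have hd5 := five_le_cast hd
  have h2 : (0 : ℝ) < d - 2 := by linarith
  have hκ := bubbleConst_toReal_pos hd
  have hpos : 0 < (d : ℝ) * (d - 2) / (bubbleConst d).toReal := by positivity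
  obtain ⟨c₀, hc₀, hc₀κ⟩ : ∃ c₀ : ℝ, 0 < c₀ ∧
      (d : ℝ) * (d - 2) = c₀ ^ 2 * (bubbleConst d).toReal :=
    ⟨_, Real.sqrt_pos.2 hpos, by rw [Real.sq_sqrt hpos.le, div_mul_cancel₀ _ hκ.ne']⟩
  have hmain : ∀ u : EuclideanSpace ℝ (Fin d) → ℝ, IsPositiveHartreeSolution u →
      ∃ (x₀ : EuclideanSpace ℝ (Fin d)) (t : ℝ), 0 < t ∧ ∀ᵐ x, u x = bubble c₀ t x₀ x := by
    intro u hu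
    obtain ⟨c, t, x₀, hc, ht, hcκ, hux⟩ := hu.exists_ae_eq_bubble hd
    -- Both constants are positive and have the same square.
    have hcc : c = c₀ := by
      rw [hc₀κ] at hcκ
      exact ((pow_left_inj₀ hc₀.le hc.le two_ne_zero).1 (mul_right_cancel₀ hκ.ne' hcκ)).symm
    exact ⟨x₀, t, ht, hcc ▸ hux⟩
  refine ⟨⟨c₀, hc₀, fun u hu => ?_, fun x₀ t ht => ⟨memLp_bubble hd hc₀ ht x₀,
    Eventually.of_forall (bubble_pos hc₀ ht x₀),
    (isHartreeSolution_bubble_iff hd hc₀ ht x₀).2 hc₀κ⟩⟩, fun u₁ u₂ hu₁ hu₂ => ?_⟩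
  · obtain ⟨x₀, t, ht, hux⟩ := hmain u hu
    exact ⟨x₀, ⟨_, strictAntiOn_bubble_profile hc₀ ht (half_pos h2), hux⟩, t, ht, hux⟩
  · obtain ⟨x₁, t₁, ht₁, h₁⟩ := hmain u₁ hu₁
    obtain ⟨x₂, t₂, ht₂, h₂⟩ := hmain u₂ hu₂
    refine ⟨x₂ - (t₁ / t₂)⁻¹ • x₁, t₁ / t₂, div_pos ht₁ ht₂, ?_⟩
    filter_upwards [h₂, ae_comp_smul_sub h₁ (div_pos ht₁ ht₂).ne' (x₂ - (t₁ / t₂)⁻¹ • x₁)]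
      with x e₂ e₁
    rw [e₂, e₁, bubble_comp_smul_sub ht₁ ht₂ x₁ x₂ x]
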